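/- Let $G$ be a connected and simply connected Lie group of dimension $n$ whose Lie algebra $\mathfrak g$ is semisimple and unimodular (that is, $\operatorname{tr}(\operatorname{ad}_\xi)=0$ for all $\xi\in\mathfrak g$), let $k$ be the Killing form of $\mathfrak g$, let $E_1,\dots,E_n$ be a basis of $\mathfrak g$ with dual basis $\theta^1,\dots,\theta^n$, and put $|k|=|\det(k(E_a,E_b))|$. Let $\pi:P\to M$ be a smooth principal $G$-bundle over a smooth manifold, with right translations $R_g$ and fundamental vector fields $\xi^P$, and fix a connection on $P$ with connection form $\omega_\nabla$. Functions and forms take values in $\mathbb K=\mathbb R$ or $\mathbb K=\mathbb C$; where values in $\mathfrak g$ are concerned, $\mathfrak g$ stands for $\mathbb K\otimes_{\mathbb R}\mathfrak g$. Notation. * $\Gamma_G(TP)$ is the space of $G$-invariant smooth vector fields on $P$, $\Gamma_G(P,\mathfrak g)$ the space of smooth $v:P\to\mathfrak g$ with $v(pg)=\mathrm{Ad}_{g^{-1}}v(p)$, and $\Omega^q_{\mathrm{Lie}}(P,\mathfrak g)$ the space of alternating $C^\infty(M)$-multilinear maps $\Gamma_G(TP)^q\to\Gamma_G(P,\mathfrak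 g)$. * $\Omega^q_{\mathrm{TLA}}(P,\mathfrak g)=(\Omega^\bullet(P)\otimes\Lambda^\bullet\mathfrak g^*\otimes\mathfrak g)^q$ is the space of smooth $\mathfrak g$-valued $q$-forms on the trivial Lie algebroid $TP\oplus(P\times\mathfrak g)$. A form $\widehat\omega$ in it is *basic* if, for every $\xi\in\mathfrak g$, it is annihilated by the inner contraction with $\xi^P\oplus\xi$ and by the Lie derivative along $\xi^P\oplus\xi$, where $X\oplus\gamma$ acts on $\mathfrak g$-valued maps by $v\mapsto X\cdot v+[\gamma,v]$. The inclusion $\Omega^q_{\mathrm{Lie}}(P,\mathfrak g)\hookrightarrow\Omega^q_{\mathrm{TLA}}(P,\mathfrak g)$ sends $\omega$ to the unique basic $\widehat\omega$ with $\widehat\omega(\mathsf X_1\oplus0,\dots,\mathsf X_q\oplus0)=\omega(\mathsf X_1,\dots,\mathsf X_q)$ for all $\mathsf X_i\in\Gamma_G(TP)$. * $\int_{\mathrm{alg}}:\Omega^{\bullet}_{\mathrm{TLA}}(P,\mathfrak g)\to\Omega^{\bullet-n}(P)\otimes\mathfrak g$ takes the factor of $\sqrt{|k|}\,\theta^1\wedge\dots\wedge\theta^n$: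 it sends $\alpha\otimes\sqrt{|k|}\,\theta^1\wedge\dots\wedge\theta^n\otimes\xi$ to $\alpha\otimes\xi$ and vanishes on $\Omega^\bullet(P)\otimes\Lambda^s\mathfrak g^*\otimes\mathfrak g$ for $s<n$. * Let $\mathcal L=P\times_{\mathrm{Ad}}\mathfrak g$. A local section $s:U\to P$ gives $\omega\in\Omega^q_{\mathrm{Lie}}(P,\mathfrak g)$ the local expression $\omega_{\mathrm{loc}}$, a $\mathfrak g$-valued form on $TU\oplus(U\times\mathfrak g)$, with $\omega_{\mathrm{loc}}(X_1\oplus\gamma_1,\dots,X_q\oplus\gamma_q)(x)=\omega(\mathsf X_1,\dots,\mathsf X_q)(s(x))$ whenever $\mathsf X_i(s(x))=T_xs(X_i)-\gamma_i(x)^P(s(x))$ for all $i$. Let $a^1,\dots,a^n$ be the components in the basis $(E_a)$ of $X\oplus\gamma\mapsto (s^*\omega_\nabla)(X)-\gamma$. The inner integration $\int_{\mathrm{inner}}:\Omega^{\bullet}_{\mathrm{Lie}}(P,\mathfrak g)\to\Omega^{\bullet-n}(M,\mathcal L)$, for the inner metric given by $k$, sends $\omega$ to the form $\omega^{\mathrm{m.i.}}$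 such that, for every local trivialization of $P$ with section $s$, $$\omega_{\mathrm{loc}}=\omega^{\mathrm{m.i.}}_{\mathrm{loc}}\wedge(-1)^n\sqrt{|k|}\,a^1\wedge\dots\wedge a^n+(\text{terms of degree}<n\text{ in }\mathfrak g^*).$$ * $\Omega^{r}(M,\mathcal L)\hookrightarrow\Omega^{r}(P)\otimes\mathfrak g$ is the pull-back $\eta\mapsto\widetilde\eta$, $\widetilde\eta_p(Y_1,\dots,Y_r)=\eta_{\pi(p)}(\pi_*Y_1,\dots,\pi_*Y_r)$ read in $\mathfrak g$ by means of $p$; a form $\tau\in\Omega^r(P)\otimes\mathfrak g$ is *tensorial* if it vanishes when one argument is vertical and $R_g^*\tau=\mathrm{Ad}_{g^{-1}}\tau$ for all $g\in G$. Then these four maps are well defined and linear, the two inclusions are injective with images the basic forms and the tensorial forms respectively, and the diagram $$\begin{array}{ccc}\Omega^{\bullet}_{\mathrm{Lie}}(P,\mathfrak g)&\hookrightarrow&\Omega^{\bullet}_{\mathrm{TLA}}(P,\mathfrak g)\\ {\scriptstyle\int_{\mathrm{inner}}}\downarrow&&\downarrow{\scriptstyle\int_{\mathrm{alg}}}\\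 \Omega^{\bullet-n}(M,\mathcal L)&\hookrightarrow&\Omega^{\bullet-n}(P)\otimes\mathfrak g\end{array}$$ commutes: $\int_{\mathrm{alg}}\widehat\omega=\widetilde{\int_{\mathrm{inner}}\omega}$ for every $\omega\in\Omega^\bullet_{\mathrm{Lie}}(P,\mathfrak g)$. In degrees below $n$ both integrations are zero. -/

import Mathlib

open scoped Manifold ContDiff TensorProduct

noncomputable section

namespace AtiyahLie

/-! ### Smooth maps into finite-dimensional vector spaces -/

section VectorValued

variable {k : ℕ} {P : Type*} [TopologicalSpace P] [ChartedSpace (EuclideanSpace ℝ (Fin k)) P]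

/-- Smoothness of a map from a manifold to a finite-dimensional real vector space: all real linear
functionals of the map are smooth. -/
def SmoothInto (k : ℕ) {P : Type*} [TopologicalSpace P]
    [ChartedSpace (EuclideanSpace ℝ (Fin k)) P] {V : Type*} [AddCommGroup V] [Module ℝ V]
    (f : P → V) : Prop :=
  ∀ l : V →ₗ[ℝ] ℝ, ContMDiff (𝓡 k) 𝓘(ℝ, ℝ) ∞ (fun p => l (f p))

theorem SmoothInto.add {V : Type*} [AddCommGroup V] [Module ℝ V] {f g : P → V}
    (hf : SmoothInto k f) (hg : SmoothInto k g) : SmoothInto k (fun p => f p + g p) := by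
  intro l
  simpa [Pi.add_def] using (hf l).add (hg l)

theorem SmoothInto.zero {V : Type*} [AddCommGroup V] [Module ℝ V] :
    SmoothInto k (fun _ : P => (0 : V)) := by
  intro l
  simpa using contMDiff_const

theorem SmoothInto.smul {𝕜 V : Type*} [RCLike 𝕜] [AddCommGroup V] [Module ℝ V] [Module 𝕜 V]
    [SMulCommClass ℝ 𝕜 V] (c : 𝕜) {f : P → V} (hf : SmoothInto k f) :
    SmoothInto k (fun p => c • f p) := by
  intro l
  have : SMulCommClass 𝕜 ℝ V := SMulCommClass.symm ℝ 𝕜 V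
  exact hf (l ∘ₗ LinearMap.mk ⟨fun v => c • v, smul_add c⟩ (fun a v => smul_comm c a v))

/-- The derivative at `p`, in the direction `v`, of a map with values in a finite-dimensional real
vector space, computed in coordinates with respect to a basis. -/
def dirDeriv {V : Type*} [AddCommGroup V] [Module ℝ V] [Module.Finite ℝ V]
    (f : P → V) (p : P) (v : TangentSpace (𝓡 k) p) : V :=
  ∑ i, (NormedSpace.fromTangentSpace _
      (mfderiv (𝓡 k) 𝓘(ℝ, ℝ) (fun y => (Module.finBasis ℝ V).repr (f y) i) p v) : ℝ) •
    Module.finBasis ℝ V i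

/-- Smooth vector fields. -/
abbrev VF (k : ℕ) (P : Type*) [TopologicalSpace P] [ChartedSpace (EuclideanSpace ℝ (Fin k)) P]
    [IsManifold (𝓡 k) ∞ P] : Type _ :=
  ContMDiffSection (𝓡 k) (EuclideanSpace ℝ (Fin k)) ∞ (fun p : P => TangentSpace (𝓡 k) p)

end VectorValued

/-! ### The structure group and its Lie algebra -/

section Group

variable (n : ℕ) (G : Type*) [TopologicalSpace G] [ChartedSpace (EuclideanSpace ℝ (Fin n)) G]
  [Group G]

/-- The Lie algebra `𝔤` of `G`. -/
abbrev LieAlg : Type := GroupLieAlgebra (𝓡 n) G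

instance : Module.Finite ℝ (LieAlg n G) :=
  inferInstanceAs (Module.Finite ℝ (EuclideanSpace ℝ (Fin n)))

instance [LieGroup (𝓡 n) ∞ G] : LieGroup (𝓡 n) (minSmoothness ℝ 3) G :=
  LieGroup.of_le (n := ∞) (by
    rw [minSmoothness_of_isRCLikeNormedField]
    exact WithTop.coe_le_coe.mpr (le_top : (3 : ℕ∞) ≤ ⊤))

/-- The Lie algebra with scalars extended to `𝕜 = ℝ` or `𝕜 = ℂ`. -/
abbrev LieAlgK (𝕜 : Type*) [RCLike 𝕜] : Type _ := 𝕜 ⊗[ℝ] LieAlg n G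

instance (𝕜 : Type*) [RCLike 𝕜] : Module.Finite ℝ (LieAlgK n G 𝕜) :=
  inferInstanceAs (Module.Finite ℝ (𝕜 ⊗[ℝ] LieAlg n G))

variable {G}

/-- The adjoint action of `G` on `𝔤`. -/
def Ad (g : G) : LieAlg n G →ₗ[ℝ] LieAlg n G :=
  (mfderiv (𝓡 n) (𝓡 n) (fun h : G => g * h * g⁻¹) 1 :
    EuclideanSpace ℝ (Fin n) →L[ℝ] EuclideanSpace ℝ (Fin n)).toLinearMap

/-- The adjoint action of `G` on `𝕜 ⊗ 𝔤`. -/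
def AdK (𝕜 : Type*) [RCLike 𝕜] (g : G) : LieAlgK n G 𝕜 →ₗ[𝕜] LieAlgK n G 𝕜 :=
  (Ad n g).baseChange 𝕜

/-- The adjoint action of `𝔤` on `𝕜 ⊗ 𝔤`. -/
def adK (𝕜 : Type*) [RCLike 𝕜] [LieGroup (𝓡 n) ∞ G] (ξ : LieAlg n G) :
    LieAlgK n G 𝕜 →ₗ[𝕜] LieAlgK n G 𝕜 :=
  (LieAlgebra.ad ℝ (LieAlg n G) ξ).baseChange 𝕜

variable {n}

/-- The form `√|k| θ¹ ∧ ⋯ ∧ θⁿ` on `𝔤`, where `(θᵃ)` is the basis dual to `b` and `|k|` is the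
absolute value of the determinant of the matrix of the Killing form in the basis `b`. -/
def killingVolume [LieGroup (𝓡 n) ∞ G] (b : Module.Basis (Fin n) ℝ (LieAlg n G)) :
    LieAlg n G [⋀^Fin n]→ₗ[ℝ] ℝ :=
  Real.sqrt |(Matrix.of fun i j => killingForm ℝ (LieAlg n G) (b i) (b j)).det| • b.det

end Group

/-! ### Exterior algebra on `T ⊕ 𝔤` -/

section Exterior

variable {T L W : Type*} [AddCommGroup T] [Module ℝ T] [AddCommGroup L] [Module ℝ L]
  [AddCommGroup W] [Module ℝ W]

/-- The exterior product `α ∧ β` (without factorials) of a `W`-valued form `α` on `T`, pulled back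
to `T ⊕ L`, with a scalar form `β` on `T ⊕ L`. -/
def wedge {r n : ℕ} (α : T [⋀^Fin r]→ₗ[ℝ] W) (β : (T × L) [⋀^Fin n]→ₗ[ℝ] ℝ) :
    (T × L) [⋀^Fin (r + n)]→ₗ[ℝ] W :=
  (((TensorProduct.rid ℝ W).toLinearMap.compAlternatingMap
    ((α.compLinearMap (LinearMap.fst ℝ T L)).domCoprod β))).domDomCongr finSumFinEquiv

/-- All the components of `R ∈ ⨁ Λʳ T* ⊗ Λˢ L* ⊗ W` with `s ≥ n` vanish. -/
def InnerDegreeLT (n : ℕ) {q : ℕ} (R : (T × L) [⋀^Fin q]→ₗ[ℝ] W) : Prop :=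
  ∀ (v : Fin q → T × L) (S : Finset (Fin q)), S.card = n → (∀ i ∈ S, (v i).1 = 0) → R v = 0

end Exterior

/-! ### Principal bundles -/

section Bundle

/-- A local trivialization over `U` of a space `P` over `M` with a right action of `G`: the map
`p ↦ (proj p, τ p)` is a diffeomorphism from `proj ⁻¹ U` to `U × G` with inverse
`(x, g) ↦ s(x) · g`; in particular it is equivariant and `s` is the associated local section. -/
structure IsLocalTriv {n k m : ℕ} {G P M : Type*}
    [TopologicalSpace G] [ChartedSpace (EuclideanSpace ℝ (Fin n)) G]
    [TopologicalSpace P] [ChartedSpace (EuclideanSpace ℝ (Fin k)) P]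
    [TopologicalSpace M] [ChartedSpace (EuclideanSpace ℝ (Fin m)) M]
    (proj : P → M) (act : P → G → P) (U : Set M) (s : M → P) (τ : P → G) : Prop where
  isOpen : IsOpen U
  smooth_section : ContMDiffOn (𝓡 m) (𝓡 k) ∞ s U
  smooth_fibre : ContMDiffOn (𝓡 k) (𝓡 n) ∞ τ (proj ⁻¹' U)
  proj_section : ∀ x ∈ U, proj (s x) = x
  section_act : ∀ p, proj p ∈ U → act (s (proj p)) (τ p) = p
  fibre_act : ∀ x ∈ U, ∀ g, τ (act (s x) g) = g

/-- A smooth principal `G`-bundle `P → M`, with its right action. -/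
structure PrincipalBundle (n k m : ℕ) (G P M : Type*)
    [TopologicalSpace G] [ChartedSpace (EuclideanSpace ℝ (Fin n)) G] [Group G]
    [TopologicalSpace P] [ChartedSpace (EuclideanSpace ℝ (Fin k)) P]
    [TopologicalSpace M] [ChartedSpace (EuclideanSpace ℝ (Fin m)) M] where
  proj : P → M
  act : P → G → P
  smooth_proj : ContMDiff (𝓡 k) (𝓡 m) ∞ proj
  smooth_act : ContMDiff ((𝓡 k).prod (𝓡 n)) (𝓡 k) ∞ (fun z : P × G => act z.1 z.2)
  act_one : ∀ p, act p 1 = p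
  act_mul : ∀ p g h, act p (g * h) = act (act p g) h
  proj_act : ∀ p g, proj (act p g) = proj p
  locally_trivial : ∀ x, ∃ (U : Set M) (s : M → P) (τ : P → G),
    x ∈ U ∧ IsLocalTriv (n := n) (k := k) (m := m) proj act U s τ

variable {n k m : ℕ} {G P M : Type*}
  [TopologicalSpace G] [ChartedSpace (EuclideanSpace ℝ (Fin n)) G] [Group G]
  [TopologicalSpace P] [ChartedSpace (EuclideanSpace ℝ (Fin k)) P]
  [TopologicalSpace M] [ChartedSpace (EuclideanSpace ℝ (Fin m)) M]

namespace PrincipalBundle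

variable (Q : PrincipalBundle n k m G P M)

/-- The fundamental vector field `ξ^P` at `p`: the velocity at `t = 0` of `p · exp (t ξ)`. -/
def fund (ξ : LieAlg n G) (p : P) : TangentSpace (𝓡 k) p :=
  (mfderiv (𝓡 n) (𝓡 k) (fun g : G => Q.act p g) 1 :
    EuclideanSpace ℝ (Fin n) →L[ℝ] EuclideanSpace ℝ (Fin k)) ξ

/-- The differential at `p` of the right translation by `g`. -/
def dR (g : G) (p : P) : TangentSpace (𝓡 k) p →ₗ[ℝ] TangentSpace (𝓡 k) (Q.act p g) :=
  (mfderiv (𝓡 k) (𝓡 k) (fun y => Q.act y g) p).toLinearMap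

/-- The differential at `p` of the projection. -/
def dproj (p : P) : TangentSpace (𝓡 k) p →ₗ[ℝ] TangentSpace (𝓡 m) (Q.proj p) :=
  (mfderiv (𝓡 k) (𝓡 m) Q.proj p).toLinearMap

/-- A connection on `P`, given by its (ordinary) connection 1-form. -/
structure Connection [IsManifold (𝓡 k) ∞ P] where
  form : ∀ p : P, TangentSpace (𝓡 k) p →ₗ[ℝ] LieAlg n G
  smooth : ∀ Y : VF k P, SmoothInto k (fun p => form p (Y p))
  form_fund : ∀ p ξ, form p (Q.fund ξ p) = ξ
  equivariant : ∀ g p Y, form (Q.act p g) (Q.dR g p Y) = Ad n g⁻¹ (form p Y)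

/-- The Atiyah Lie algebroid `Γ_G(TP)`: smooth `G`-invariant vector fields on `P`. -/
def InvField [IsManifold (𝓡 k) ∞ P] : Submodule ℝ (VF k P) where
  carrier := {X | ∀ g p, Q.dR g p (X p) = X (Q.act p g)}
  add_mem' := by
    intro X Y hX hY g p
    simp [hX g p, hY g p]
  zero_mem' := by
    intro g p
    simp
  smul_mem' := by
    intro c X hX g p
    simp [hX g p]

variable (𝕜 : Type*) [RCLike 𝕜]

/-- The kernel `Γ_G(P, 𝔤)` of the Atiyah Lie algebroid: smooth maps `v` with
`v (p · g) = Ad_{g⁻¹} v(p)`. -/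
def EquivMap : Submodule 𝕜 (P → LieAlgK n G 𝕜) where
  carrier := {v | SmoothInto k v ∧ ∀ g p, v (Q.act p g) = AdK n 𝕜 g⁻¹ (v p)}
  add_mem' := by
    rintro v w ⟨hv, hv'⟩ ⟨hw, hw'⟩
    exact ⟨hv.add hw, fun g p => by simp [hv' g p, hw' g p]⟩
  zero_mem' := ⟨SmoothInto.zero, fun g p => by simp⟩
  smul_mem' := by
    rintro c v ⟨hv, hv'⟩
    exact ⟨hv.smul c, fun g p => by simp [hv' g p]⟩

/-- `Ω_Lie^q(P, 𝔤)`: alternating `C^∞(M)`-multilinear maps from the Atiyah Lie algebroid to its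
kernel, where `f ∈ C^∞(M)` acts as multiplication by `f ∘ proj`. -/
def LieForm [IsManifold (𝓡 k) ∞ P] (q : ℕ) :
    Submodule 𝕜 (Q.InvField [⋀^Fin q]→ₗ[ℝ] Q.EquivMap 𝕜) where
  carrier := {w | ∀ (f : M → ℝ), ContMDiff (𝓡 m) 𝓘(ℝ, ℝ) ∞ f →
    ∀ (X : Fin q → Q.InvField) (i : Fin q) (Y : Q.InvField),
      (∀ p, Y.1 p = f (Q.proj p) • (X i).1 p) →
      ∀ p, (w (Function.update X i Y)).1 p = f (Q.proj p) • (w X).1 p}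
  add_mem' := by
    intro w η hw hη f hf X i Y hY p
    have h1 := hw f hf X i Y hY p
    have h2 := hη f hf X i Y hY p
    simp [h1, h2]
  zero_mem' := by
    intro f hf X i Y hY p
    simp
  smul_mem' := by
    intro c w hw f hf X i Y hY p
    have h1 := hw f hf X i Y hY p
    simp [h1, smul_comm c]

/-- The fibre at `x` of the bundle `𝓛 = P ×_Ad 𝔤`; the class of `(p, ξ)` is the equivariant map
on the fibre of `P` at `x` with value `ξ` at `p`. -/
def AdFibre (x : M) : Submodule 𝕜 ({p : P // Q.proj p = x} → LieAlgK n G 𝕜) where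
  carrier := {v | ∀ g p, v ⟨Q.act p.1 g, (Q.proj_act p.1 g).trans p.2⟩ = AdK n 𝕜 g⁻¹ (v p)}
  add_mem' := by
    intro v w hv hw g p
    simp [hv g p, hw g p]
  zero_mem' := by
    intro g p
    simp
  smul_mem' := by
    intro c v hv g p
    simp [hv g p]

/-- `Ω^r(M, 𝓛)`: smooth de Rham forms on `M` with values in `𝓛`; they map vector fields on `M` to
smooth sections of `𝓛`, that is, to smooth equivariant maps on `P`. -/
def BundleForm [IsManifold (𝓡 m) ∞ M] (r : ℕ) :
    Submodule 𝕜 (∀ x : M, TangentSpace (𝓡 m) x [⋀^Fin r]→ₗ[ℝ] Q.AdFibre 𝕜 x) where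
  carrier := {η | ∀ X : Fin r → VF m M,
    SmoothInto k (fun p : P => (η (Q.proj p) (fun i => X i (Q.proj p))).1 ⟨p, rfl⟩)}
  add_mem' := by
    intro η ζ hη hζ X
    exact (hη X).add (hζ X)
  zero_mem' := fun X => SmoothInto.zero
  smul_mem' := by
    intro c η hη X
    exact (hη X).smul c

end PrincipalBundle

variable (n k G P) (𝕜 : Type*) [RCLike 𝕜]

/-- `Ω_TLA^q(P, 𝔤) = (Ω(P) ⊗ Λ𝔤* ⊗ 𝔤)^q`: smooth forms of degree `q` on the trivial Lie algebroid
`TP ⊕ (P × 𝔤)` with values in `𝔤`. -/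
def TLAForm [IsManifold (𝓡 k) ∞ P] (q : ℕ) :
    Submodule 𝕜 (∀ p : P, (TangentSpace (𝓡 k) p × LieAlg n G) [⋀^Fin q]→ₗ[ℝ] LieAlgK n G 𝕜) where
  carrier := {w | ∀ (Y : Fin q → VF k P) (c : Fin q → P → LieAlg n G),
    (∀ i, SmoothInto k (c i)) → SmoothInto k (fun p => w p (fun i => (Y i p, c i p)))}
  add_mem' := by
    intro w η hw hη Y c hc
    exact (hw Y c hc).add (hη Y c hc)
  zero_mem' := fun Y c hc => SmoothInto.zero
  smul_mem' := by
    intro a w hw Y c hc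
    exact (hw Y c hc).smul a

/-- `Ω^r(P) ⊗ 𝔤`. -/
def VForm [IsManifold (𝓡 k) ∞ P] (r : ℕ) :
    Submodule 𝕜 (∀ p : P, TangentSpace (𝓡 k) p [⋀^Fin r]→ₗ[ℝ] LieAlgK n G 𝕜) where
  carrier := {w | ∀ Y : Fin r → VF k P, SmoothInto k (fun p => w p (fun i => Y i p))}
  add_mem' := by
    intro w η hw hη Y
    exact (hw Y).add (hη Y)
  zero_mem' := fun Y => SmoothInto.zero
  smul_mem' := by
    intro a w hw Y
    exact (hw Y).smul a

variable {n k G P 𝕜}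

/-- The value at `p` of the bracket `[X ⊕ γ, Y ⊕ η] = [X, Y] ⊕ (X·η - Y·γ + [γ, η])` of the trivial
Lie algebroid. -/
def tlaBracket (X Y : ∀ p : P, TangentSpace (𝓡 k) p) (γ η : P → LieAlg n G) (p : P) :
    TangentSpace (𝓡 k) p × LieAlg n G :=
  (VectorField.mlieBracket (𝓡 k) X Y p,
    dirDeriv (k := k) η p (X p) - dirDeriv (k := k) γ p (Y p) + ⁅γ p, η p⁆)

namespace PrincipalBundle

variable (Q : PrincipalBundle n k m G P M) [IsManifold (𝓡 k) ∞ P]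

/-- The value at `p` of `(L_ξ w)(Y₁ ⊕ c₁, …, Y_q ⊕ c_q)`, with `L_ξ` the Lie derivative along the
element `ξ^P ⊕ ξ` of the trivial Lie algebroid, which acts on `𝔤`-valued maps `v` as
`ξ^P · v + [ξ, v]`. -/
def lieDeriv [LieGroup (𝓡 n) ∞ G] (ξ : LieAlg n G) {q : ℕ} (w : TLAForm n k G P 𝕜 q)
    (Y : Fin q → VF k P) (c : Fin q → P → LieAlg n G) (p : P) : LieAlgK n G 𝕜 :=
  dirDeriv (k := k) (fun y => w.1 y (fun i => (Y i y, c i y))) p (Q.fund ξ p)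
    + adK n 𝕜 ξ (w.1 p (fun i => (Y i p, c i p)))
    - ∑ j, w.1 p (Function.update (fun i => (Y i p, c i p)) j
        (tlaBracket (Q.fund ξ) (Y j) (fun _ => ξ) (c j) p))

/-- `𝔤_equ`-basic forms, where `𝔤_equ = {ξ^P ⊕ ξ}`: horizontal and invariant forms for the
operation of `𝔤_equ` on the forms of the trivial Lie algebroid. -/
structure IsBasic [LieGroup (𝓡 n) ∞ G] {q : ℕ} (w : TLAForm n k G P 𝕜 q) : Prop where
  horizontal : ∀ (ξ : LieAlg n G) (p : P) (v : Fin q → TangentSpace (𝓡 k) p × LieAlg n G)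
    (i : Fin q), v i = (Q.fund ξ p, ξ) → w.1 p v = 0
  invariant : ∀ (ξ : LieAlg n G) (Y : Fin q → VF k P) (c : Fin q → P → LieAlg n G),
    (∀ i, SmoothInto k (c i)) → ∀ p, Q.lieDeriv ξ w Y c p = 0

/-- `w` is the image of the basic form `w'` under the identification of basic forms of the trivial
Lie algebroid with forms of the Atiyah Lie algebroid: an invariant vector field `X` lifts to
`X ⊕ 0`. -/
def Corresponds {q : ℕ} (w' : TLAForm n k G P 𝕜 q) (w : Q.LieForm 𝕜 q) : Prop :=
  ∀ (X : Fin q → Q.InvField) (p : P), (w.1 X).1 p = w'.1 p (fun i => ((X i).1 p, 0))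

/-- Tensorial forms in `Ω^r(P) ⊗ 𝔤` (of type `Ad`): horizontal and `G`-equivariant forms. -/
structure IsTensorial {r : ℕ} (τ : VForm n k G P 𝕜 r) : Prop where
  horizontal : ∀ (p : P) (Y : Fin r → TangentSpace (𝓡 k) p) (i : Fin r),
    Q.dproj p (Y i) = 0 → τ.1 p Y = 0
  equivariant : ∀ (g : G) (p : P) (Y : Fin r → TangentSpace (𝓡 k) p),
    τ.1 (Q.act p g) (fun i => Q.dR g p (Y i)) = AdK n 𝕜 g⁻¹ (τ.1 p Y)

/-- `wloc` is, over `U`, the local expression `Ψ⁻¹ ∘ w ∘ S` of `w` in the trivialization of the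
Atiyah Lie algebroid given by the local section `s`. An invariant field `X` is trivialized at `x` as
`v ⊕ c` when `X(s(x)) = T_x s (v) - c^P(s(x))`, and `Ψ⁻¹` evaluates an equivariant map at `s(x)`. -/
def IsLocalExpr {q : ℕ} (w : Q.LieForm 𝕜 q) (U : Set M) (s : M → P)
    (wloc : ∀ x : M, (TangentSpace (𝓡 m) x × LieAlg n G) [⋀^Fin q]→ₗ[ℝ] LieAlgK n G 𝕜) : Prop :=
  ∀ (X : Fin q → Q.InvField), ∀ x ∈ U, ∀ (v : Fin q → TangentSpace (𝓡 m) x)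
    (c : Fin q → LieAlg n G),
    (∀ i, (X i).1 (s x) = mfderiv (𝓡 m) (𝓡 k) s x (v i) - Q.fund (c i) (s x)) →
      wloc x (fun i => (v i, c i)) = (w.1 X).1 (s x)

variable {Q} in
/-- The local expression `v ⊕ c ↦ A(v) - c` at `x` of the connection 1-form, with `A = s^* form`;
its components are the mixed basis of 1-forms. -/
def Connection.mixed (conn : Q.Connection) (s : M → P) (x : M) :
    TangentSpace (𝓡 m) x × LieAlg n G →ₗ[ℝ] LieAlg n G :=
  conn.form (s x) ∘ₗ (mfderiv (𝓡 m) (𝓡 k) s x).toLinearMap ∘ₗ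
    LinearMap.fst ℝ (TangentSpace (𝓡 m) x) (LieAlg n G)
    - LinearMap.snd ℝ (TangentSpace (𝓡 m) x) (LieAlg n G)

/-- The evaluation at `p` of the elements of the fibre of `𝓛` over the point under `p`. -/
def evalFibre (x : M) (p : P) (h : Q.proj p = x) : Q.AdFibre 𝕜 x →ₗ[ℝ] LieAlgK n G 𝕜 where
  toFun v := v.1 ⟨p, h⟩
  map_add' _ _ := rfl
  map_smul' _ _ := rfl

/-- `η` is the inner integral of `w` for the inner metric `h` given by the Killing form: in every
local trivialization, up to terms of inner degree less than `n`, the local expression of `w` is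
`η_loc ∧ (-1)ⁿ √|h| a¹ ∧ ⋯ ∧ aⁿ`, with `(aⁱ)` the mixed basis relative to the connection and to the
basis `b` of `𝔤`. -/
def IsInnerIntegral [IsManifold (𝓡 m) ∞ M] [LieGroup (𝓡 n) ∞ G]
    (b : Module.Basis (Fin n) ℝ (LieAlg n G)) (conn : Q.Connection)
    {r : ℕ} (w : Q.LieForm 𝕜 (r + n)) (η : Q.BundleForm 𝕜 r) : Prop :=
  ∀ (U : Set M) (s : M → P) (τ : P → G)
    (hs : IsLocalTriv (n := n) (k := k) (m := m) Q.proj Q.act U s τ),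
    ∃ wloc : ∀ x : M, (TangentSpace (𝓡 m) x × LieAlg n G) [⋀^Fin (r + n)]→ₗ[ℝ] LieAlgK n G 𝕜,
      Q.IsLocalExpr w U s wloc ∧
      ∀ (x : M) (hx : x ∈ U),
        InnerDegreeLT n (wloc x -
          wedge ((Q.evalFibre x (s x) (hs.proj_section x hx)).compAlternatingMap (η.1 x))
            ((-1 : ℝ) ^ n • (killingVolume b).compLinearMap (conn.mixed s x)))

/-- `τ` is the tensorial form on `P` which corresponds to the `𝓛`-valued form `η` on `M`. -/
def IsPullback [IsManifold (𝓡 m) ∞ M] {r : ℕ} (η : Q.BundleForm 𝕜 r) (τ : VForm n k G P 𝕜 r) :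
    Prop :=
  ∀ (p : P) (Y : Fin r → TangentSpace (𝓡 k) p),
    τ.1 p Y = (η.1 (Q.proj p) (fun i => Q.dproj p (Y i))).1 ⟨p, rfl⟩

end PrincipalBundle

/-- `η` is the algebraic integral of `w`: it is the factor of `√|k| θ¹ ∧ ⋯ ∧ θⁿ` in `w`, that is,
`w = η ∧ √|k| θ¹ ∧ ⋯ ∧ θⁿ` up to terms of degree less than `n` in `Λ𝔤*`. -/
def IsAlgIntegral [IsManifold (𝓡 k) ∞ P] [LieGroup (𝓡 n) ∞ G]
    (b : Module.Basis (Fin n) ℝ (LieAlg n G))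
    {r : ℕ} (w : TLAForm n k G P 𝕜 (r + n)) (η : VForm n k G P 𝕜 r) : Prop :=
  ∀ p : P, InnerDegreeLT n (w.1 p -
    wedge (η.1 p) ((killingVolume b).compLinearMap
      (LinearMap.snd ℝ (TangentSpace (𝓡 k) p) (LieAlg n G))))

end Bundle

end AtiyahLie

end

/-!
A form of the Atiyah Lie algebroid is `C^∞(M)`-multilinear, so, invariant fields being plentiful by
cut-off functions, it is determined by alternating maps `w_p` on the tangent spaces `T_p P`, and the
corresponding basic form is `(Y ⊕ ξ) ↦ w_p(Y - ξ^P)`. Its Lie derivative along `ξ^P ⊕ ξ` is the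
derivative at the identity of the translates of the form by a curve in `G` of velocity `ξ`, so that
the equivariance of `w` gives the infinitesimal invariance, and for connected `G` the infinitesimal
invariance integrates back to equivariance.

Under translation by `g` the component of top degree in `𝔤*` of a basic form is multiplied by
`det Ad_g`, which is `1` because the derivative of `det Ad` is the trace of `ad` and `𝔤` is
unimodular. Hence the algebraic integral of a basic form is tensorial and descends to `M`. On a
local section the volume form of the mixed variables takes at `(0 ⊕ E_1, …, 0 ⊕ E_n)` the value
`(-1)ⁿ √|k|`, and the sign in the definition of the inner integral cancels this one: the descended
form is the inner integral.
-/

noncomputable section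

namespace AtiyahLie

open Filter Topology VectorField

/-! ### The Lie bracket as the derivative of a vector field transported by a flow -/

section Derivative

variable {𝕜 : Type*} [NontriviallyNormedField 𝕜] {E : Type*} [NormedAddCommGroup E]
  [NormedSpace 𝕜 E] [CompleteSpace E]

theorem hasDerivAt_of_clm_apply_eq {D : 𝕜 → E →L[𝕜] E} {D' : E →L[𝕜] E} {Z u : 𝕜 → E} {u' : E}
    {t : 𝕜} (hD : HasDerivAt D D' t) (hDt : D t = 1) (hu : HasDerivAt u u' t)
    (hZ : ∀ᶠ s in 𝓝 t, D s (Z s) = u s) : HasDerivAt Z (u' - D' (u t)) t := by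
  have hinverse : HasDerivAt (fun s => Ring.inverse (D s)) (-D') t := by
    have h : HasFDerivAt Ring.inverse (-ContinuousLinearMap.mulLeftRight 𝕜 (E →L[𝕜] E) 1 1)
        (D t) := by
      simpa [hDt] using hasFDerivAt_ringInverse (𝕜 := 𝕜) (1 : (E →L[𝕜] E)ˣ)
    exact (h.comp_hasDerivAt t hD).congr_deriv (by ext v; simp)
  have hunit : ∀ᶠ s in 𝓝 t, IsUnit (D s) :=
    hD.continuousAt.eventually (by rw [hDt]; exact Units.isOpen.mem_nhds isUnit_one)
  refine ((hinverse.clm_apply hu).congr_of_eventuallyEq ?_).congr_deriv ?_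
  · filter_upwards [hunit, hZ] with s hs hZs
    rw [← hZs, ← mul_apply_eq_comp, Ring.inverse_mul_cancel _ hs, one_apply_eq_self]
  · simp [hDt, sub_eq_neg_add]

end Derivative

theorem hasDerivAt_lieBracket_of_fderiv {E : Type*} [NormedAddCommGroup E] [NormedSpace ℝ E]
    [CompleteSpace E] {A : E × ℝ → E} {V Y : E → E} {Z : ℝ → E} {x₀ : E}
    (hA : ContDiffAt ℝ 2 A (x₀, 0)) (hA₀ : ∀ᶠ x in 𝓝 x₀, A (x, 0) = x)
    (hV : ∀ᶠ x in 𝓝 x₀, fderiv ℝ A (x, 0) (0, 1) = V x) (hY : DifferentiableAt ℝ Y x₀)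
    (hZ : ∀ᶠ t in 𝓝 (0 : ℝ), fderiv ℝ A (x₀, t) (Z t, 0) = Y (A (x₀, t))) :
    HasDerivAt Z (lieBracket ℝ V Y x₀) 0 := by
  -- Differentiate `∂ₓA(x₀, t) Z(t) = Y(A(x₀, t))` at `t = 0`, where `∂ₜ∂ₓA = ∂ₓ∂ₜA = DV`.
  have hx₀ : A (x₀, 0) = x₀ := hA₀.self_of_nhds
  have hA' : HasFDerivAt A (fderiv ℝ A (x₀, 0)) (x₀, 0) :=
    (hA.differentiableAt (by norm_num)).hasFDerivAt
  have hA'' : HasFDerivAt (fderiv ℝ A) (fderiv ℝ (fderiv ℝ A) (x₀, 0)) (x₀, 0) :=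
    ((hA.fderiv_right (m := 1) (by norm_num)).differentiableAt (by norm_num)).hasFDerivAt
  have hcurve : HasDerivAt (fun t : ℝ => ((x₀, t) : E × ℝ)) (0, 1) 0 :=
    (hasDerivAt_const _ _).prodMk (hasDerivAt_id _)
  have hslice : HasFDerivAt (fun x : E => ((x, 0) : E × ℝ)) (.inl ℝ E ℝ) x₀ :=
    (ContinuousLinearMap.inl ℝ E ℝ).hasFDerivAt
  have hD : HasDerivAt (fun t => (fderiv ℝ A (x₀, t)).comp (.inl ℝ E ℝ))
      ((fderiv ℝ (fderiv ℝ A) (x₀, 0) (0, 1)).comp (.inl ℝ E ℝ)) 0 := by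
    simpa using! (HasFDerivAt.comp_hasDerivAt (0 : ℝ) hA'' hcurve).clm_comp
      (hasDerivAt_const (0 : ℝ) (ContinuousLinearMap.inl ℝ E ℝ))
  have hD₀ : (fderiv ℝ A (x₀, 0)).comp (.inl ℝ E ℝ) = 1 :=
    (hA'.comp x₀ hslice).unique ((hasFDerivAt_id x₀).congr_of_eventuallyEq hA₀)
  have hYA : HasDerivAt (fun t => Y (A (x₀, t))) (fderiv ℝ Y x₀ (V x₀)) 0 := by
    have hY' : HasFDerivAt Y (fderiv ℝ Y x₀) (A (x₀, 0)) := by rw [hx₀]; exact hY.hasFDerivAt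
    rw [← hV.self_of_nhds]
    exact hY'.comp_hasDerivAt (0 : ℝ) (hA'.comp_hasDerivAt (0 : ℝ) hcurve)
  have hV' : fderiv ℝ V x₀ (Y x₀) = fderiv ℝ (fderiv ℝ A) (x₀, 0) (0, 1) (Y x₀, 0) := by
    have h : HasFDerivAt V _ x₀ :=
      ((ContinuousLinearMap.apply ℝ E ((0, 1) : E × ℝ)).hasFDerivAt.comp x₀
        (hA''.comp x₀ hslice)).congr_of_eventuallyEq (hV.mono fun _ h => h.symm)
    rw [h.fderiv]
    exact (hA.isSymmSndFDerivAt (by simp)).eq _ _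
  refine (hasDerivAt_of_clm_apply_eq hD hD₀ hYA hZ).congr_deriv ?_
  rw [hx₀]
  exact congrArg (fderiv ℝ Y x₀ (V x₀) - ·) hV'.symm

/-! ### Derivatives between model spaces -/

section ModelDeriv

variable {𝕜 : Type*} [NontriviallyNormedField 𝕜]
  {E₁ : Type*} [NormedAddCommGroup E₁] [NormedSpace 𝕜 E₁] {H₁ : Type*} [TopologicalSpace H₁]
  {I₁ : ModelWithCorners 𝕜 E₁ H₁} {A : Type*} [TopologicalSpace A] [ChartedSpace H₁ A]
  {E₂ : Type*} [NormedAddCommGroup E₂] [NormedSpace 𝕜 E₂] {H₂ : Type*} [TopologicalSpace H₂]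
  {I₂ : ModelWithCorners 𝕜 E₂ H₂} {B : Type*} [TopologicalSpace B] [ChartedSpace H₂ B]
  {E₃ : Type*} [NormedAddCommGroup E₃] [NormedSpace 𝕜 E₃] {H₃ : Type*} [TopologicalSpace H₃]
  {I₃ : ModelWithCorners 𝕜 E₃ H₃} {C : Type*} [TopologicalSpace C] [ChartedSpace H₃ C]
  {E₄ : Type*} [NormedAddCommGroup E₄] [NormedSpace 𝕜 E₄] {H₄ : Type*} [TopologicalSpace H₄]
  {I₄ : ModelWithCorners 𝕜 E₄ H₄} {D : Type*} [TopologicalSpace D] [ChartedSpace H₄ D]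

variable (I₁ I₂) in
/-- The derivative of a map between manifolds as a map between the model spaces. Its type does not
depend on the base points, so that derivatives at points which are only propositionally equal can
be compared. -/
def modelDeriv (f : A → B) (x : A) : E₁ →L[𝕜] E₂ := mfderiv I₁ I₂ f x

theorem modelDeriv_id (x : A) (v : E₁) : modelDeriv I₁ I₁ (fun a : A => a) x v = v :=
  congrArg (fun L : E₁ →L[𝕜] E₁ => L v) (mfderiv_id (I := I₁) (x := x))

theorem modelDeriv_const (x : A) (y : B) (v : E₁) : modelDeriv I₁ I₂ (fun _ : A => y) x v = 0 :=
  congrArg (fun L : E₁ →L[𝕜] E₂ => L v) (mfderiv_const (I := I₁) (I' := I₂) (x := x) (c := y))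

theorem modelDeriv_comp {f : A → B} {g : B → C} {h : A → C} {x : A} {y : B}
    (hg : MDifferentiableAt I₂ I₃ g y) (hf : MDifferentiableAt I₁ I₂ f x) (hy : f x = y)
    (hh : ∀ᶠ a in 𝓝 x, h a = g (f a)) (v : E₁) :
    modelDeriv I₁ I₃ h x v = modelDeriv I₂ I₃ g y (modelDeriv I₁ I₂ f x v) := by
  subst hy
  have hcomp : HasMFDerivAt I₁ I₃ h x _ :=
    (HasMFDerivAt.comp x hg.hasMFDerivAt hf.hasMFDerivAt).congr_of_eventuallyEq hh
  exact congrArg (fun L : E₁ →L[𝕜] E₃ => L v) hcomp.mfderiv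

theorem modelDeriv_prodMk {f : A → B} {g : A → C} {x : A} (hf : MDifferentiableAt I₁ I₂ f x)
    (hg : MDifferentiableAt I₁ I₃ g x) (v : E₁) :
    modelDeriv I₁ (I₂.prod I₃) (fun a => (f a, g a)) x v =
      (modelDeriv I₁ I₂ f x v, modelDeriv I₁ I₃ g x v) :=
  congrArg (fun L : E₁ →L[𝕜] E₂ × E₃ => L v) (hf.hasMFDerivAt.prodMk hg.hasMFDerivAt).mfderiv

theorem modelDeriv_prod_apply {F : A × B → C} {x : A} {y : B}
    (hF : MDifferentiableAt (I₁.prod I₂) I₃ F (x, y)) (v : E₁) (w : E₂) :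
    modelDeriv (I₁.prod I₂) I₃ F (x, y) (v, w) =
      modelDeriv I₁ I₃ (fun a => F (a, y)) x v + modelDeriv I₂ I₃ (fun b => F (x, b)) y w :=
  mfderiv_prod_eq_add_apply hF

theorem modelDeriv_comp_prodMk {F : B × C → D} {f : A → B} {g : A → C} {h : A → D} {x : A} {y : B}
    {z : C} (hF : MDifferentiableAt (I₂.prod I₃) I₄ F (y, z)) (hf : MDifferentiableAt I₁ I₂ f x)
    (hg : MDifferentiableAt I₁ I₃ g x) (hy : f x = y) (hz : g x = z)
    (hh : ∀ᶠ a in 𝓝 x, h a = F (f a, g a)) (v : E₁) :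
    modelDeriv I₁ I₄ h x v =
      modelDeriv I₂ I₄ (fun b => F (b, z)) y (modelDeriv I₁ I₂ f x v) +
      modelDeriv I₃ I₄ (fun c => F (y, c)) z (modelDeriv I₁ I₃ g x v) := by
  rw [modelDeriv_comp hF (hf.prodMk hg) (Prod.ext hy hz) hh, modelDeriv_prodMk hf hg,
    modelDeriv_prod_apply hF]

end ModelDeriv

section Chart

variable {E : Type*} [NormedAddCommGroup E] [NormedSpace ℝ E] {P : Type*} [TopologicalSpace P]
  [ChartedSpace E P] {a : P × ℝ → P} {p : P}

theorem contDiffAt_extChartAt_comp [IsManifold 𝓘(ℝ, E) 2 P]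
    (ha : ContMDiffAt (𝓘(ℝ, E).prod 𝓘(ℝ, ℝ)) 𝓘(ℝ, E) 2 a (p, 0)) (hap : a (p, 0) = p) :
    ContDiffAt ℝ 2
      (fun z : E × ℝ => extChartAt 𝓘(ℝ, E) p (a ((extChartAt 𝓘(ℝ, E) p).symm z.1, z.2)))
      (extChartAt 𝓘(ℝ, E) p p, 0) := by
  rw [← contMDiffAt_iff_contDiffAt]
  have hsymm := (contMDiffOn_extChartAt_symm (I := 𝓘(ℝ, E)) (n := 2) p).contMDiffAt
    (extChartAt_target_mem_nhds p)
  have hpair := (ContMDiffAt.comp (extChartAt 𝓘(ℝ, E) p p, (0 : ℝ)) hsymm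
    contDiff_fst.contMDiff.contMDiffAt).prodMk contDiff_snd.contMDiff.contMDiffAt
  refine ContMDiffAt.comp_of_eq (g := extChartAt 𝓘(ℝ, E) p) contMDiffAt_extChartAt
    (ContMDiffAt.comp_of_eq (g := a) ha hpair ?_) ?_
  all_goals simp [hap]

/-- The vector field `V` read in the preferred chart at `p`. -/
def inChart (p : P) (V : ∀ q : P, TangentSpace 𝓘(ℝ, E) q) (x : E) : E :=
  modelDeriv 𝓘(ℝ, E) 𝓘(ℝ, E) (extChartAt 𝓘(ℝ, E) p) ((extChartAt 𝓘(ℝ, E) p).symm x)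
    (V ((extChartAt 𝓘(ℝ, E) p).symm x))

theorem inChart_extChartAt {p q : P} (hq : q ∈ (extChartAt 𝓘(ℝ, E) p).source)
    (V : ∀ q : P, TangentSpace 𝓘(ℝ, E) q) :
    inChart p V (extChartAt 𝓘(ℝ, E) p q) =
      modelDeriv 𝓘(ℝ, E) 𝓘(ℝ, E) (extChartAt 𝓘(ℝ, E) p) q (V q) := by
  rw [inChart, (extChartAt 𝓘(ℝ, E) p).left_inv hq]

theorem modelDeriv_extChartAt_symm_self [IsManifold 𝓘(ℝ, E) 1 P] (p : P) (v : E) :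
    modelDeriv 𝓘(ℝ, E) 𝓘(ℝ, E) (extChartAt 𝓘(ℝ, E) p).symm (extChartAt 𝓘(ℝ, E) p p) v = v := by
  have h := mfderivWithin_range_extChartAt_symm (I := 𝓘(ℝ, E)) (x := p)
  rw [ModelWithCorners.range_eq_univ, mfderivWithin_univ] at h
  exact congrArg (fun L : E →L[ℝ] E => L v) h

theorem mpullbackWithin_extChartAt_symm_eq_inChart [IsManifold 𝓘(ℝ, E) 1 P] {p : P}
    (V : ∀ q : P, TangentSpace 𝓘(ℝ, E) q)
    {x : E} (hx : x ∈ (extChartAt 𝓘(ℝ, E) p).target) :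
    mpullbackWithin 𝓘(ℝ, E) 𝓘(ℝ, E) (extChartAt 𝓘(ℝ, E) p).symm V (Set.range 𝓘(ℝ, E)) x =
      inChart p V x := by
  have h := ContinuousLinearMap.inverse_eq
    (mfderivWithin_extChartAt_symm_comp_mfderiv_extChartAt (I := 𝓘(ℝ, E)) hx)
    (mfderiv_extChartAt_comp_mfderivWithin_extChartAt_symm hx)
  exact congrFun (congrArg DFunLike.coe h) _

theorem mpullbackWithin_extChartAt_symm_eventuallyEq_inChart [IsManifold 𝓘(ℝ, E) 1 P] (p : P)
    (V : ∀ q : P, TangentSpace 𝓘(ℝ, E) q) :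
    mpullbackWithin 𝓘(ℝ, E) 𝓘(ℝ, E) (extChartAt 𝓘(ℝ, E) p).symm V (Set.range 𝓘(ℝ, E))
      =ᶠ[𝓝 (extChartAt 𝓘(ℝ, E) p p)] inChart p V :=
  (Filter.Eventually.mono (extChartAt_target_mem_nhds p)) fun _ hx =>
    mpullbackWithin_extChartAt_symm_eq_inChart V hx

theorem differentiableAt_inChart [IsManifold 𝓘(ℝ, E) 2 P] [CompleteSpace E] {p : P}
    {V : ∀ q : P, TangentSpace 𝓘(ℝ, E) q}
    (hV : MDifferentiableAt 𝓘(ℝ, E) 𝓘(ℝ, E).tangent (fun q => (V q : TangentBundle 𝓘(ℝ, E) P)) p) :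
    DifferentiableAt ℝ (inChart p V) (extChartAt 𝓘(ℝ, E) p p) := by
  have h := (mdifferentiableWithinAt_univ.2 hV).differentiableWithinAt_mpullbackWithin_vectorField
  have heq := mpullbackWithin_extChartAt_symm_eventuallyEq_inChart p V
  rw [Set.preimage_univ, Set.univ_inter, ModelWithCorners.range_eq_univ] at h
  rw [ModelWithCorners.range_eq_univ] at heq
  exact (differentiableWithinAt_univ.1 h).congr_of_eventuallyEq heq.symm

theorem mlieBracket_eq_lieBracket_inChart [IsManifold 𝓘(ℝ, E) 1 P]
    (V W : ∀ q : P, TangentSpace 𝓘(ℝ, E) q) (p : P) :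
    mlieBracket 𝓘(ℝ, E) V W p =
      lieBracket ℝ (inChart p V) (inChart p W) (extChartAt 𝓘(ℝ, E) p p) := by
  have h := mlieBracketWithin_apply (I := 𝓘(ℝ, E)) (s := Set.univ) (V := V) (W := W) (x₀ := p)
  have hV := mpullbackWithin_extChartAt_symm_eventuallyEq_inChart p V
  have hW := mpullbackWithin_extChartAt_symm_eventuallyEq_inChart p W
  rw [mfderiv_extChartAt_self, Set.preimage_univ, Set.univ_inter,
    ModelWithCorners.range_eq_univ] at h
  rw [ModelWithCorners.range_eq_univ] at hV hW
  rw [← mlieBracketWithin_univ, ← lieBracketWithin_univ]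
  refine (h.trans (congrArg (fun L : E →L[ℝ] E => L _) ContinuousLinearMap.inverse_id)).trans ?_
  exact Filter.EventuallyEq.lieBracketWithin_vectorField_eq_nhds (E := E) hV hW

theorem fderiv_extChartAt_comp [IsManifold 𝓘(ℝ, E) 1 P] {x : E} {t : ℝ}
    (hx : x ∈ (extChartAt 𝓘(ℝ, E) p).target)
    (ha : MDifferentiableAt (𝓘(ℝ, E).prod 𝓘(ℝ, ℝ)) 𝓘(ℝ, E) a ((extChartAt 𝓘(ℝ, E) p).symm x, t))
    (hsource : a ((extChartAt 𝓘(ℝ, E) p).symm x, t) ∈ (extChartAt 𝓘(ℝ, E) p).source)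
    (v : E) (r : ℝ) :
    fderiv ℝ (fun z : E × ℝ => extChartAt 𝓘(ℝ, E) p (a ((extChartAt 𝓘(ℝ, E) p).symm z.1, z.2)))
        (x, t) (v, r) =
      modelDeriv 𝓘(ℝ, E) 𝓘(ℝ, E) (extChartAt 𝓘(ℝ, E) p) (a ((extChartAt 𝓘(ℝ, E) p).symm x, t))
        (modelDeriv (𝓘(ℝ, E).prod 𝓘(ℝ, ℝ)) 𝓘(ℝ, E) a ((extChartAt 𝓘(ℝ, E) p).symm x, t)
          (modelDeriv 𝓘(ℝ, E) 𝓘(ℝ, E) (extChartAt 𝓘(ℝ, E) p).symm x v, r)) := by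
  have hsymm : MDifferentiableAt 𝓘(ℝ, E) 𝓘(ℝ, E) (extChartAt 𝓘(ℝ, E) p).symm x :=
    ((contMDiffOn_extChartAt_symm (n := 1) p).contMDiffAt
      ((isOpen_extChartAt_target p).mem_nhds hx)).mdifferentiableAt (by simp)
  have hchart := mdifferentiableAt_extChartAt (I := 𝓘(ℝ, E)) (x := p)
    (by rwa [← extChartAt_source 𝓘(ℝ, E)])
  have hfst : MDifferentiableAt 𝓘(ℝ, E × ℝ) 𝓘(ℝ, E) Prod.fst (x, t) :=
    differentiableAt_fst.mdifferentiableAt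
  have hsnd : MDifferentiableAt 𝓘(ℝ, E × ℝ) 𝓘(ℝ, ℝ) Prod.snd (x, t) :=
    differentiableAt_snd.mdifferentiableAt
  have hsymm_fst : MDifferentiableAt 𝓘(ℝ, E × ℝ) 𝓘(ℝ, E)
      (fun z : E × ℝ => (extChartAt 𝓘(ℝ, E) p).symm z.1) (x, t) :=
    MDifferentiableAt.comp (x, t) (g := (extChartAt 𝓘(ℝ, E) p).symm) hsymm hfst
  have hpair := hsymm_fst.prodMk hsnd
  have hfst_apply : modelDeriv 𝓘(ℝ, E × ℝ) 𝓘(ℝ, E) Prod.fst (x, t) (v, r) = v := by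
    rw [modelDeriv, mfderiv_eq_fderiv, fderiv_fst]; rfl
  have hsnd_apply : modelDeriv 𝓘(ℝ, E × ℝ) 𝓘(ℝ, ℝ) Prod.snd (x, t) (v, r) = r := by
    rw [modelDeriv, mfderiv_eq_fderiv, fderiv_snd]; rfl
  rw [← mfderiv_eq_fderiv]
  refine (modelDeriv_comp (f := fun z => a ((extChartAt 𝓘(ℝ, E) p).symm z.1, z.2)) hchart
    (MDifferentiableAt.comp (x, t) (g := a) ha hpair) rfl (.of_forall fun _ => rfl) (v, r)).trans ?_
  rw [modelDeriv_comp ha hpair rfl (.of_forall fun _ => rfl), modelDeriv_prodMk hsymm_fst hsnd,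
    modelDeriv_comp hsymm hfst rfl (.of_forall fun _ => rfl), hfst_apply, hsnd_apply]

theorem hasDerivAt_mlieBracket [IsManifold 𝓘(ℝ, E) 2 P] [CompleteSpace E]
    {V Y : ∀ q : P, TangentSpace 𝓘(ℝ, E) q} {Z : ℝ → E}
    (ha : ContMDiffAt (𝓘(ℝ, E).prod 𝓘(ℝ, ℝ)) 𝓘(ℝ, E) 2 a (p, 0)) (ha₀ : ∀ᶠ q in 𝓝 p, a (q, 0) = q)
    (hV : ∀ᶠ q in 𝓝 p, modelDeriv 𝓘(ℝ, ℝ) 𝓘(ℝ, E) (fun t => a (q, t)) 0 1 = V q)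
    (hY : MDifferentiableAt 𝓘(ℝ, E) 𝓘(ℝ, E).tangent (fun q => (Y q : TangentBundle 𝓘(ℝ, E) P)) p)
    (hZ : ∀ᶠ t in 𝓝 (0 : ℝ),
      modelDeriv 𝓘(ℝ, E) 𝓘(ℝ, E) (fun q => a (q, t)) p (Z t) = Y (a (p, t))) :
    HasDerivAt Z (mlieBracket 𝓘(ℝ, E) V Y p) 0 := by
  have hsymm_p : (extChartAt 𝓘(ℝ, E) p).symm (extChartAt 𝓘(ℝ, E) p p) = p := extChartAt_to_inv p
  have hsymm_tendsto : Tendsto (extChartAt 𝓘(ℝ, E) p).symm (𝓝 (extChartAt 𝓘(ℝ, E) p p)) (𝓝 p) := by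
    simpa only [hsymm_p] using (continuousAt_extChartAt_symm (I := 𝓘(ℝ, E)) p).tendsto
  have hslice : Tendsto (fun t : ℝ => (p, t)) (𝓝 0) (𝓝 (p, 0)) := by
    rw [nhds_prod_eq]; exact tendsto_const_nhds.prodMk tendsto_id
  have ha_mdiff : ∀ᶠ z in 𝓝 (p, (0 : ℝ)),
      MDifferentiableAt (𝓘(ℝ, E).prod 𝓘(ℝ, ℝ)) 𝓘(ℝ, E) a z :=
    ((contMDiffAt_iff_contMDiffAt_nhds (by simp)).1 ha).mono fun z hz =>
      hz.mdifferentiableAt (by norm_num)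
  have ha_source : ∀ᶠ z in 𝓝 (p, (0 : ℝ)), a z ∈ (extChartAt 𝓘(ℝ, E) p).source :=
    ha.continuousAt.eventually (by
      rw [ha₀.self_of_nhds]; exact extChartAt_source_mem_nhds p)
  rw [mlieBracket_eq_lieBracket_inChart]
  refine hasDerivAt_lieBracket_of_fderiv (contDiffAt_extChartAt_comp ha ha₀.self_of_nhds) ?_ ?_
    (differentiableAt_inChart hY) ?_
  · filter_upwards [extChartAt_target_mem_nhds p, hsymm_tendsto.eventually ha₀] with x hx hax
    rw [hax, (extChartAt 𝓘(ℝ, E) p).right_inv hx]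
  · have hpair : Tendsto (fun x => ((extChartAt 𝓘(ℝ, E) p).symm x, (0 : ℝ)))
        (𝓝 (extChartAt 𝓘(ℝ, E) p p)) (𝓝 (p, 0)) := by
      rw [nhds_prod_eq]; exact hsymm_tendsto.prodMk tendsto_const_nhds
    filter_upwards [extChartAt_target_mem_nhds p, hsymm_tendsto.eventually hV,
      hsymm_tendsto.eventually ha₀, hpair.eventually ha_mdiff, hpair.eventually ha_source]
      with x hx hVx hax hmdiff hsource
    rw [fderiv_extChartAt_comp hx hmdiff hsource, map_zero, modelDeriv_prod_apply hmdiff,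
      map_zero, zero_add, hVx, hax]
    rfl
  · filter_upwards [hZ, hslice.eventually ha_mdiff, hslice.eventually ha_source]
      with t hZt hmdiff hsource
    rw [fderiv_extChartAt_comp (mem_extChartAt_target p) (by rwa [hsymm_p]) (by rwa [hsymm_p]),
      hsymm_p, inChart_extChartAt hsource, modelDeriv_extChartAt_symm_self,
      modelDeriv_prod_apply hmdiff, map_zero, add_zero, hZt]

end Chart

/-! ### Curves and smooth maps in vector spaces without a norm -/

section Multilinear

variable {R ι κ : Type*} [CommSemiring R]

theorem multilinear_apply_of_eq_sum [Fintype ι] [DecidableEq ι] [Fintype κ] {V : ι → Type*}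
    {W : Type*} [∀ i, AddCommMonoid (V i)] [∀ i, Module R (V i)] [AddCommMonoid W] [Module R W]
    (f : MultilinearMap R V W)
    {v : ∀ i, V i} {c : ι → κ → R} {e : ∀ i, κ → V i} (hv : ∀ i, v i = ∑ j, c i j • e i j) :
    f v = ∑ J : ι → κ, (∏ i, c i (J i)) • f (fun i => e i (J i)) := by
  classical
  rw [funext hv]
  simp only [MultilinearMap.map_sum, MultilinearMap.map_smul_univ]

theorem continuous_multilinear_pi [Finite ι] [Finite κ] [TopologicalSpace R]
    [IsTopologicalSemiring R] (f : MultilinearMap R (fun _ : ι => κ → R) R) : Continuous f := by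
  classical
  cases nonempty_fintype ι
  cases nonempty_fintype κ
  have h : (f : (ι → κ → R) → R) =
      fun v => ∑ J : ι → κ, (∏ i, v i (J i)) • f (fun i => Pi.single (J i) 1) :=
    funext fun v => multilinear_apply_of_eq_sum f fun i => pi_eq_sum_univ' (v i)
  rw [h]
  fun_prop

end Multilinear

section WeakDeriv

variable {V W : Type*} [AddCommGroup V] [Module ℝ V] [AddCommGroup W] [Module ℝ W]

/-- The curve `u` has derivative `u'` at `t` when tested by linear functionals. This notion makes
sense in a finite-dimensional space, such as `𝕜 ⊗ 𝔤`, for which no norm has been chosen. -/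
def HasWeakDerivAt (u : ℝ → V) (u' : V) (t : ℝ) : Prop :=
  ∀ l : V →ₗ[ℝ] ℝ, HasDerivAt (fun s => l (u s)) (l u') t

theorem HasWeakDerivAt.map {u : ℝ → V} {u' : V} {t : ℝ} (h : HasWeakDerivAt u u' t)
    (L : V →ₗ[ℝ] W) : HasWeakDerivAt (fun s => L (u s)) (L u') t :=
  fun l => h (l ∘ₗ L)

theorem HasWeakDerivAt.add {u v : ℝ → V} {u' v' : V} {t : ℝ} (hu : HasWeakDerivAt u u' t)
    (hv : HasWeakDerivAt v v' t) : HasWeakDerivAt (fun s => u s + v s) (u' + v') t := by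
  intro l
  simpa using! (hu l).add (hv l)

theorem HasWeakDerivAt.prodMk {u : ℝ → V} {v : ℝ → W} {u' : V} {v' : W} {t : ℝ}
    (hu : HasWeakDerivAt u u' t) (hv : HasWeakDerivAt v v' t) :
    HasWeakDerivAt (fun s => (u s, v s)) (u', v') t := by
  simpa using (hu.map (LinearMap.inl ℝ V W)).add (hv.map (LinearMap.inr ℝ V W))

theorem hasWeakDerivAt_const (v : V) (t : ℝ) : HasWeakDerivAt (fun _ => v) 0 t := by
  intro l
  simpa using hasDerivAt_const t (l v)

theorem HasWeakDerivAt.unique [Module.Finite ℝ V] {u : ℝ → V} {u' v' : V} {t : ℝ}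
    (h : HasWeakDerivAt u u' t) (h' : HasWeakDerivAt u v' t) : u' = v' := by
  rw [← sub_eq_zero, ← Module.forall_dual_apply_eq_zero_iff ℝ]
  intro l
  rw [map_sub, sub_eq_zero]
  exact (h l).unique (h' l)

theorem HasWeakDerivAt.congr {u v : ℝ → V} {u' : V} {t : ℝ} (h : HasWeakDerivAt u u' t)
    (e : v =ᶠ[𝓝 t] u) : HasWeakDerivAt v u' t :=
  fun l => (h l).congr_of_eventuallyEq (e.fun_comp l)

theorem hasWeakDerivAt_iff_hasDerivAt {E : Type*} [NormedAddCommGroup E] [NormedSpace ℝ E]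
    [FiniteDimensional ℝ E] {u : ℝ → E} {u' : E} {t : ℝ} :
    HasWeakDerivAt u u' t ↔ HasDerivAt u u' t := by
  refine ⟨fun h => ?_, fun h l => ?_⟩
  · let b := Module.finBasis ℝ E
    have hsum : HasDerivAt (fun s => ∑ i, b.coord i (u s) • b i) (∑ i, b.coord i u' • b i) t :=
      HasDerivAt.fun_sum fun i _ => (h (b.coord i)).smul_const (b i)
    simpa only [Module.Basis.coord_apply, b.sum_repr] using hsum
  · exact (LinearMap.toContinuousLinearMap l).hasFDerivAt.comp_hasDerivAt t h

theorem HasWeakDerivAt.multilinear [Module.Finite ℝ V] {ι : Type*} [Fintype ι] [DecidableEq ι]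
    (f : MultilinearMap ℝ (fun _ : ι => V) W) {u : ι → ℝ → V} {u' : ι → V} {t : ℝ}
    (hu : ∀ i, HasWeakDerivAt (u i) (u' i) t) :
    HasWeakDerivAt (fun s => f (fun i => u i s))
      (∑ j, f (Function.update (fun i => u i t) j (u' j))) t := by
  intro l
  let e := (Module.finBasis ℝ V).equivFun
  let F := (l.compMultilinearMap f).compLinearMap (fun _ => e.symm.toLinearMap)
  let Fc : ContinuousMultilinearMap ℝ (fun _ : ι => Fin (Module.finrank ℝ V) → ℝ) ℝ :=
    ⟨F, continuous_multilinear_pi F⟩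
  have hFc : ∀ v : ι → V, Fc (fun i => e (v i)) = l (f v) := fun v =>
    congrArg (fun v => l (f v)) (funext fun i => e.symm_apply_apply (v i))
  have hcoord : ∀ i, HasFDerivAt (fun s => e (u i s))
      (ContinuousLinearMap.toSpanSingleton ℝ (e (u' i))) t :=
    fun i => (hasWeakDerivAt_iff_hasDerivAt.1 ((hu i).map e.toLinearMap)).hasFDerivAt
  have hderiv := (HasFDerivAt.multilinear_comp Fc hcoord).hasDerivAt
  simp only [hFc] at hderiv
  refine hderiv.congr_deriv ?_
  simp only [sum_apply, ContinuousLinearMap.comp_apply,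
    ContinuousLinearMap.toSpanSingleton_apply, one_smul, map_sum]
  refine Finset.sum_congr rfl fun j _ => ?_
  rw [← hFc]
  exact congrArg Fc (funext fun i => (Function.apply_update (fun _ => e) _ j (u' j) i).symm)

theorem HasWeakDerivAt.apply_operator [Module.Finite ℝ V] {ρ : ℝ → V →ₗ[ℝ] W} {D : V →ₗ[ℝ] W}
    {t : ℝ} (hρ : ∀ v, HasWeakDerivAt (fun s => ρ s v) (D v) t) {u : ℝ → V} {u' : V}
    (hu : HasWeakDerivAt u u' t) :
    HasWeakDerivAt (fun s => ρ s (u s)) (ρ t u' + D (u t)) t := by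
  let b := Module.finBasis ℝ V
  have hb : ∀ (L : V →ₗ[ℝ] ℝ) v, L v = ∑ i, b.coord i v * L (b i) := by
    intro L v
    conv_lhs => rw [← b.sum_repr v]
    simp only [map_sum, map_smul, smul_eq_mul, Module.Basis.coord_apply]
  intro l
  have hsum := HasDerivAt.fun_sum (u := Finset.univ)
    (A := fun i s => b.coord i (u s) * l (ρ s (b i)))
    (fun i _ => (hu (b.coord i)).mul (hρ (b i) l))
  refine (hsum.congr_deriv ?_).congr_of_eventuallyEq (.of_forall fun s => hb (l ∘ₗ ρ s) (u s))
  rw [map_add, Finset.sum_add_distrib]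
  exact (congrArg₂ (· + ·) (hb (l ∘ₗ ρ t) u') (hb (l ∘ₗ D) (u t))).symm

end WeakDeriv

section SmoothInto

variable {k : ℕ} {P : Type*} [TopologicalSpace P] [ChartedSpace (EuclideanSpace ℝ (Fin k)) P]
  {V W : Type*} [AddCommGroup V] [Module ℝ V] [AddCommGroup W] [Module ℝ W]

/-- The pointwise version of `SmoothInto`. -/
def SmoothIntoAt (k : ℕ) {P : Type*} [TopologicalSpace P]
    [ChartedSpace (EuclideanSpace ℝ (Fin k)) P] {V : Type*} [AddCommGroup V] [Module ℝ V]
    (f : P → V) (p : P) : Prop :=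
  ∀ l : V →ₗ[ℝ] ℝ, ContMDiffAt (𝓡 k) 𝓘(ℝ, ℝ) ∞ (fun p => l (f p)) p

theorem smoothInto_iff_forall {f : P → V} : SmoothInto k f ↔ ∀ p, SmoothIntoAt k f p :=
  ⟨fun h p l => h l p, fun h l p => h p l⟩

theorem SmoothInto.smoothIntoAt {f : P → V} (hf : SmoothInto k f) (p : P) : SmoothIntoAt k f p :=
  smoothInto_iff_forall.1 hf p

theorem SmoothInto.const (v : V) : SmoothInto k (fun _ : P => v) :=
  fun _ => contMDiff_const

theorem SmoothIntoAt.map {f : P → V} {p : P} (hf : SmoothIntoAt k f p) (L : V →ₗ[ℝ] W) :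
    SmoothIntoAt k (fun q => L (f q)) p :=
  fun l => hf (l ∘ₗ L)

theorem SmoothIntoAt.congr {f g : P → V} {p : P} (hf : SmoothIntoAt k f p) (h : g =ᶠ[𝓝 p] f) :
    SmoothIntoAt k g p :=
  fun l => (hf l).congr_of_eventuallyEq (h.fun_comp l)

theorem SmoothIntoAt.sum {ι : Type*} (S : Finset ι) {f : ι → P → V} {p : P}
    (h : ∀ i ∈ S, SmoothIntoAt k (f i) p) : SmoothIntoAt k (fun q => ∑ i ∈ S, f i q) p := by
  intro l
  simp only [map_sum]
  exact contMDiffAt_finsetSum fun i hi => h i hi l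

theorem SmoothIntoAt.fun_smul {c : P → ℝ} {f : P → V} {p : P}
    (hc : ContMDiffAt (𝓡 k) 𝓘(ℝ, ℝ) ∞ c p) (hf : SmoothIntoAt k f p) :
    SmoothIntoAt k (fun q => c q • f q) p := by
  intro l
  simp only [map_smul, smul_eq_mul]
  exact hc.mul (hf l)

theorem smoothIntoAt_iff_contMDiffAt {E : Type*} [NormedAddCommGroup E] [NormedSpace ℝ E]
    [FiniteDimensional ℝ E] {f : P → E} {p : P} :
    SmoothIntoAt k f p ↔ ContMDiffAt (𝓡 k) 𝓘(ℝ, E) ∞ f p := by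
  refine ⟨fun hf => ?_, fun hf l =>
    ContMDiffAt.comp p (LinearMap.toContinuousLinearMap l).contMDiff.contMDiffAt hf⟩
  let b := Module.finBasis ℝ E
  have hsum : ContMDiffAt (𝓡 k) 𝓘(ℝ, E) ∞ (fun q => ∑ i, b.coord i (f q) • b i) p :=
    contMDiffAt_finsetSum fun i _ => (hf (b.coord i)).smul contMDiffAt_const
  simpa only [Module.Basis.coord_apply, b.sum_repr] using hsum

theorem SmoothIntoAt.apply_operator [Module.Finite ℝ V] {ρ : P → V →ₗ[ℝ] W} {f : P → V} {p : P}
    (hρ : ∀ v, SmoothIntoAt k (fun q => ρ q v) p) (hf : SmoothIntoAt k f p) :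
    SmoothIntoAt k (fun q => ρ q (f q)) p := by
  let b := Module.finBasis ℝ V
  have hsum : SmoothIntoAt k (fun q => ∑ i, b.coord i (f q) • ρ q (b i)) p :=
    SmoothIntoAt.sum _ fun i _ => SmoothIntoAt.fun_smul (hf (b.coord i)) (hρ (b i))
  refine hsum.congr (Eventually.of_forall fun q => ?_)
  simp only [← map_smul, ← map_sum, Module.Basis.coord_apply, b.sum_repr]

theorem smoothIntoAt_multilinear {ι κ : Type*} [Finite ι] [Fintype κ]
    {T : P → Type*} [∀ q, AddCommGroup (T q)] [∀ q, Module ℝ (T q)]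
    (β : ∀ q, MultilinearMap ℝ (fun _ : ι => T q) W) {p : P} {Z : ι → ∀ q, T q} {e : κ → ∀ q, T q}
    {c : ι → κ → P → ℝ} (hc : ∀ i j, ContMDiffAt (𝓡 k) 𝓘(ℝ, ℝ) ∞ (c i j) p)
    (hβ : ∀ J : ι → κ, SmoothIntoAt k (fun q => β q (fun i => e (J i) q)) p)
    (hZ : ∀ᶠ q in 𝓝 p, ∀ i, Z i q = ∑ j, c i j q • e j q) :
    SmoothIntoAt k (fun q => β q (fun i => Z i q)) p := by
  classical
  cases nonempty_fintype ι
  have hsum : SmoothIntoAt k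
      (fun q => ∑ J : ι → κ, (∏ i, c i (J i) q) • β q (fun i => e (J i) q)) p :=
    SmoothIntoAt.sum _ fun J _ => SmoothIntoAt.fun_smul
      (contMDiffAt_finsetProd fun i _ => hc i (J i)) (hβ J)
  exact hsum.congr (hZ.mono fun q hq => multilinear_apply_of_eq_sum (β q) hq)

theorem map_dirDeriv [Module.Finite ℝ V] {f : P → V} {p : P} (hf : SmoothIntoAt k f p)
    (v : TangentSpace (𝓡 k) p) (l : V →ₗ[ℝ] ℝ) :
    l (dirDeriv (k := k) f p v) = modelDeriv (𝓡 k) 𝓘(ℝ, ℝ) (fun q => l (f q)) p v := by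
  let b := Module.finBasis ℝ V
  let D : Fin (Module.finrank ℝ V) → EuclideanSpace ℝ (Fin k) →L[ℝ] ℝ :=
    fun i => modelDeriv (𝓡 k) 𝓘(ℝ, ℝ) (fun q => b.coord i (f q)) p
  have hexpand : (fun q => l (f q)) = ∑ i, l (b i) • fun q => b.coord i (f q) := by
    funext q
    conv_lhs => rw [← b.sum_repr (f q)]
    simp only [map_sum, map_smul, smul_eq_mul, Finset.sum_apply, Pi.smul_apply, mul_comm,
      Module.Basis.coord_apply]
  have hsum : HasMFDerivAt (𝓡 k) 𝓘(ℝ, ℝ) (∑ i, l (b i) • fun q => b.coord i (f q)) p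
      (∑ i, l (b i) • D i) := HasMFDerivAt.sum fun i _ =>
    ((hf (b.coord i)).mdifferentiableAt (by simp)).hasMFDerivAt.const_smul (l (b i))
  have hl : modelDeriv (𝓡 k) 𝓘(ℝ, ℝ) (fun q => l (f q)) p = ∑ i, l (b i) • D i :=
    (congrArg (modelDeriv (𝓡 k) 𝓘(ℝ, ℝ) · p) hexpand).trans hsum.mfderiv
  have hdir : dirDeriv (k := k) f p v = ∑ i, D i v • b i := rfl
  have happly (w : EuclideanSpace ℝ (Fin k)) :
      (∑ i, l (b i) • D i) w = ∑ i, D i w * l (b i) := by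
    simp only [sum_apply, smul_apply, smul_eq_mul, mul_comm]
  simp only [hl, hdir, map_sum, map_smul, smul_eq_mul]
  exact (happly v).symm

theorem hasWeakDerivAt_dirDeriv [Module.Finite ℝ V] {f : P → V} {p : P} (hf : SmoothIntoAt k f p)
    {c : ℝ → P} (hc : MDifferentiableAt 𝓘(ℝ, ℝ) (𝓡 k) c 0) (h0 : c 0 = p)
    {v : TangentSpace (𝓡 k) p} (hv : modelDeriv 𝓘(ℝ, ℝ) (𝓡 k) c 0 1 = v) :
    HasWeakDerivAt (fun t => f (c t)) (dirDeriv (k := k) f p v) 0 := by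
  intro l
  have hl : MDifferentiableAt (𝓡 k) 𝓘(ℝ, ℝ) (fun q => l (f q)) p :=
    (hf l).mdifferentiableAt (by simp)
  rw [map_dirDeriv hf v l, ← hv, ← modelDeriv_comp hl hc h0 (.of_forall fun _ => rfl)]
  subst h0
  have hcomp : MDifferentiableAt 𝓘(ℝ, ℝ) 𝓘(ℝ, ℝ) (fun t => l (f (c t))) 0 :=
    MDifferentiableAt.comp (g := fun q => l (f q)) (0 : ℝ) hl hc
  have hderiv : HasFDerivAt (fun t => l (f (c t)))
      (modelDeriv 𝓘(ℝ, ℝ) 𝓘(ℝ, ℝ) (fun t => l (f (c t))) 0) 0 := hcomp.hasMFDerivAt.hasFDerivAt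
  exact hderiv.hasDerivAt

end SmoothInto

/-! ### Smooth families of tangent vectors -/

section TangentFamily

variable {E : Type*} [NormedAddCommGroup E] [NormedSpace ℝ E] {P : Type*} [TopologicalSpace P]
  [ChartedSpace E P] [IsManifold 𝓘(ℝ, E) ∞ P]
  {EN : Type*} [NormedAddCommGroup EN] [NormedSpace ℝ EN] {N : Type*} [TopologicalSpace N]
  [ChartedSpace EN N]

theorem trivializationAt_self_snd (p : P) (v : TangentSpace 𝓘(ℝ, E) p) :
    (trivializationAt E (TangentSpace 𝓘(ℝ, E) : P → Type _) p
      (⟨p, v⟩ : TangentBundle 𝓘(ℝ, E) P)).2 = v := by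
  have h := TangentBundle.continuousLinearMapAt_trivializationAt (I := 𝓘(ℝ, E))
    (mem_chart_source E p)
  rw [mfderiv_extChartAt_self] at h
  have hv := congrFun (congrArg DFunLike.coe h) v
  rwa [Bundle.Trivialization.continuousLinearMapAt_apply,
    Bundle.Trivialization.coe_linearMapAt_of_mem _ (by simp)] at hv

theorem contMDiffAt_tangentBundle_mk_const {p : P} {v : N → E} {x₀ : N}
    (hv : ContMDiffAt 𝓘(ℝ, EN) 𝓘(ℝ, E) ∞ v x₀) :
    ContMDiffAt 𝓘(ℝ, EN) 𝓘(ℝ, E).tangent ∞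
      (fun x => (⟨p, v x⟩ : TangentBundle 𝓘(ℝ, E) P)) x₀ := by
  rw [Bundle.contMDiffAt_totalSpace]
  exact ⟨contMDiffAt_const, hv.congr_of_eventuallyEq
    (Eventually.of_forall fun x => trivializationAt_self_snd p (v x))⟩

theorem contMDiffAt_of_tangentBundle_mk_const {p : P} {q : N → P}
    {v : ∀ x, TangentSpace 𝓘(ℝ, E) (q x)} {x₀ : N} (hq : ∀ᶠ x in 𝓝 x₀, q x = p)
    (hv : ContMDiffAt 𝓘(ℝ, EN) 𝓘(ℝ, E).tangent ∞
      (fun x => (⟨q x, v x⟩ : TangentBundle 𝓘(ℝ, E) P)) x₀) :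
    ContMDiffAt 𝓘(ℝ, EN) 𝓘(ℝ, E) ∞ (fun x => (v x : E)) x₀ := by
  rw [Bundle.contMDiffAt_totalSpace] at hv
  have hq₀ : q x₀ = p := hq.self_of_nhds
  refine hv.2.congr_of_eventuallyEq (hq.mono fun x hx => ?_)
  have key (y z : P) (hyz : z = y) (w : E) :
      (trivializationAt E (TangentSpace 𝓘(ℝ, E) : P → Type _) y
        (⟨z, w⟩ : TangentBundle 𝓘(ℝ, E) P)).2 = w := by
    subst hyz
    exact trivializationAt_self_snd z w
  exact (key _ _ (hx.trans hq₀.symm) (v x)).symm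

variable [IsManifold 𝓘(ℝ, EN) ∞ N] {EA : Type*} [NormedAddCommGroup EA] [NormedSpace ℝ EA]
  {A : Type*} [TopologicalSpace A] [ChartedSpace EA A] [IsManifold 𝓘(ℝ, EA) ∞ A]

theorem contMDiffAt_mfderiv_apply {F : N → A → P} {a : N → A}
    {v : ∀ x, TangentSpace 𝓘(ℝ, EA) (a x)} {x₀ : N}
    (hF : ContMDiffAt (𝓘(ℝ, EN).prod 𝓘(ℝ, EA)) 𝓘(ℝ, E) ∞ (Function.uncurry F) (x₀, a x₀))
    (hv : ContMDiffAt 𝓘(ℝ, EN) 𝓘(ℝ, EA).tangent ∞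
      (fun x => (⟨a x, v x⟩ : TangentBundle 𝓘(ℝ, EA) A)) x₀) :
    ContMDiffAt 𝓘(ℝ, EN) 𝓘(ℝ, E).tangent ∞
      (fun x => (⟨F x (a x), modelDeriv 𝓘(ℝ, EA) 𝓘(ℝ, E) (F x) (a x) (v x)⟩ :
        TangentBundle 𝓘(ℝ, E) P)) x₀ := by
  have ha : ContMDiffAt 𝓘(ℝ, EN) 𝓘(ℝ, EA) ∞ a x₀ := (Bundle.contMDiffAt_totalSpace.1 hv).1
  exact ContMDiffAt.clm_apply_of_inCoordinates (ContMDiffAt.mfderiv F a hF ha (m := ∞) (by simp))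
    hv (ContMDiffAt.comp x₀ (g := Function.uncurry F) hF (contMDiffAt_id.prodMk ha))

end TangentFamily

section ChartCurve

variable {E : Type*} [NormedAddCommGroup E] [NormedSpace ℝ E] {P : Type*} [TopologicalSpace P]
  [ChartedSpace E P]

/-- The curve through `p` which is a straight line with velocity `v` in the preferred chart. -/
def chartCurve (p : P) (v : E) (t : ℝ) : P :=
  (extChartAt 𝓘(ℝ, E) p).symm (extChartAt 𝓘(ℝ, E) p p + t • v)

theorem chartCurve_zero (p : P) (v : E) : chartCurve p v 0 = p := by
  rw [chartCurve, zero_smul, add_zero]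
  exact extChartAt_to_inv p

theorem contMDiffAt_chartCurve [IsManifold 𝓘(ℝ, E) ∞ P] (p : P) (v : E) :
    ContMDiffAt 𝓘(ℝ, ℝ) 𝓘(ℝ, E) ∞ (chartCurve p v) 0 := by
  refine ContMDiffAt.comp_of_eq (g := (extChartAt 𝓘(ℝ, E) p).symm) (y := extChartAt 𝓘(ℝ, E) p p)
    ((contMDiffOn_extChartAt_symm p).contMDiffAt (extChartAt_target_mem_nhds p))
    (ContDiff.contMDiff ?_).contMDiffAt (by simp)
  fun_prop

theorem modelDeriv_chartCurve [IsManifold 𝓘(ℝ, E) 1 P] (p : P) (v : E) :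
    modelDeriv 𝓘(ℝ, ℝ) 𝓘(ℝ, E) (chartCurve p v) 0 1 = v := by
  have hline : HasDerivAt (fun t : ℝ => extChartAt 𝓘(ℝ, E) p p + t • v) v 0 := by
    simpa using! ((hasDerivAt_id (0 : ℝ)).smul_const v).const_add (extChartAt 𝓘(ℝ, E) p p)
  have hsymm := ((contMDiffOn_extChartAt_symm (I := 𝓘(ℝ, E)) (n := 1) p).contMDiffAt
    (extChartAt_target_mem_nhds p)).mdifferentiableAt one_ne_zero
  rw [modelDeriv_comp (h := chartCurve p v) hsymm hline.differentiableAt.mdifferentiableAt (by simp)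
    (.of_forall fun _ => rfl), modelDeriv_extChartAt_symm_self, modelDeriv, mfderiv_eq_fderiv]
  exact hline.deriv

end ChartCurve

/-! ### The adjoint representation -/

section Adjoint

variable {n : ℕ} {G : Type*} [TopologicalSpace G] [ChartedSpace (EuclideanSpace ℝ (Fin n)) G]
  [Group G] (𝕜 : Type*) [RCLike 𝕜]

theorem Ad_one : Ad n (1 : G) = LinearMap.id := by
  ext1 η
  have h : (fun h : G => 1 * h * 1⁻¹) = fun h => h := funext fun h => by simp
  exact (congrArg (modelDeriv (𝓡 n) (𝓡 n) · 1 η) h).trans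
    (modelDeriv_id (E₁ := EuclideanSpace ℝ (Fin n)) 1 η)

theorem AdK_one : AdK n 𝕜 (1 : G) = LinearMap.id := by
  rw [AdK, Ad_one, LinearMap.baseChange_id]

/-- A curve in `G` through `1` with velocity `ξ`, which takes the place of `t ↦ exp (t ξ)`. -/
def curve (ξ : LieAlg n G) : ℝ → G := chartCurve (E := EuclideanSpace ℝ (Fin n)) 1 ξ

theorem curve_zero (ξ : LieAlg n G) : curve ξ 0 = (1 : G) :=
  chartCurve_zero (E := EuclideanSpace ℝ (Fin n)) 1 ξ

variable [LieGroup (𝓡 n) ∞ G]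

theorem isManifold_of_lieGroup : IsManifold (𝓡 n) ∞ G :=
  (inferInstance : LieGroup (𝓡 n) ∞ G).toContMDiffMul.toIsManifold

theorem contMDiff_conj (g : G) : ContMDiff (𝓡 n) (𝓡 n) ∞ (fun h : G => g * h * g⁻¹) :=
  (contMDiff_const.mul contMDiff_id).mul contMDiff_const

theorem smoothInto_Ad (η : LieAlg n G) : SmoothInto n (fun g : G => Ad n g η) := by
  have : IsManifold (𝓡 n) ∞ G := isManifold_of_lieGroup
  refine smoothInto_iff_forall.2 fun g₀ => smoothIntoAt_iff_contMDiffAt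
    (E := EuclideanSpace ℝ (Fin n)).2 ?_
  have hF : ContMDiffAt ((𝓡 n).prod (𝓡 n)) (𝓡 n) ∞
      (Function.uncurry fun g h : G => g * h * g⁻¹) (g₀, 1) :=
    ((contMDiff_fst.mul contMDiff_snd).mul contMDiff_fst.inv).contMDiffAt
  exact contMDiffAt_of_tangentBundle_mk_const (p := (1 : G)) (q := fun g : G => g * 1 * g⁻¹)
    (.of_forall fun g => by simp)
    (contMDiffAt_mfderiv_apply (a := fun _ : G => (1 : G)) (v := fun _ => η) hF contMDiffAt_const)

theorem Ad_mul (g h : G) : Ad n (g * h) = Ad n g ∘ₗ Ad n h :=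
  LinearMap.ext fun η => modelDeriv_comp ((contMDiff_conj g).mdifferentiable (by simp) 1)
    ((contMDiff_conj h).mdifferentiable (by simp) 1) (by simp)
    (.of_forall fun x => by simp [mul_assoc]) η

theorem Ad_inv_apply_Ad (g : G) (η : LieAlg n G) : Ad n g⁻¹ (Ad n g η) = η := by
  rw [← LinearMap.comp_apply, ← Ad_mul, inv_mul_cancel, Ad_one, LinearMap.id_apply]

theorem Ad_apply_Ad_inv (g : G) (η : LieAlg n G) : Ad n g (Ad n g⁻¹ η) = η := by
  rw [← LinearMap.comp_apply, ← Ad_mul, mul_inv_cancel, Ad_one, LinearMap.id_apply]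

theorem AdK_mul_apply (g h : G) (v : LieAlgK n G 𝕜) :
    AdK n 𝕜 (g * h) v = AdK n 𝕜 g (AdK n 𝕜 h v) := by
  rw [AdK, Ad_mul, LinearMap.baseChange_comp, LinearMap.comp_apply, AdK, AdK]

theorem AdK_inv_apply_AdK (g : G) (v : LieAlgK n G 𝕜) : AdK n 𝕜 g⁻¹ (AdK n 𝕜 g v) = v := by
  rw [← AdK_mul_apply, inv_mul_cancel, AdK_one, LinearMap.id_apply]

theorem AdK_apply_AdK_inv (g : G) (v : LieAlgK n G 𝕜) : AdK n 𝕜 g (AdK n 𝕜 g⁻¹ v) = v := by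
  rw [← AdK_mul_apply, mul_inv_cancel, AdK_one, LinearMap.id_apply]

theorem smoothInto_AdK (v : LieAlgK n G 𝕜) : SmoothInto n (fun g : G => AdK n 𝕜 g v) := by
  induction v using TensorProduct.induction_on with
  | zero => simpa using SmoothInto.zero
  | tmul z η => exact fun l => smoothInto_Ad η (l ∘ₗ TensorProduct.mk ℝ 𝕜 (LieAlg n G) z)
  | add x y hx hy => simpa using hx.add hy

theorem contMDiffAt_curve (ξ : LieAlg n G) :
    ContMDiffAt 𝓘(ℝ, ℝ) (𝓡 n) ∞ (curve ξ : ℝ → G) 0 :=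
  have : IsManifold (𝓡 n) ∞ G := isManifold_of_lieGroup
  contMDiffAt_chartCurve (E := EuclideanSpace ℝ (Fin n)) 1 ξ

theorem modelDeriv_comp_curve {E : Type*} [NormedAddCommGroup E] [NormedSpace ℝ E] {P : Type*}
    [TopologicalSpace P] [ChartedSpace E P] {f : G → P} {h : ℝ → P}
    (hf : MDifferentiableAt (𝓡 n) 𝓘(ℝ, E) f 1) (ξ : LieAlg n G) (hh : ∀ t, h t = f (curve ξ t)) :
    modelDeriv 𝓘(ℝ, ℝ) 𝓘(ℝ, E) h 0 1 = modelDeriv (𝓡 n) 𝓘(ℝ, E) f 1 ξ := by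
  have : IsManifold (𝓡 n) ∞ G := isManifold_of_lieGroup
  exact (modelDeriv_comp hf ((contMDiffAt_curve ξ).mdifferentiableAt (by simp)) (curve_zero ξ)
    (.of_forall hh) 1).trans (congrArg (modelDeriv (𝓡 n) 𝓘(ℝ, E) f 1)
      (modelDeriv_chartCurve (E := EuclideanSpace ℝ (Fin n)) 1 ξ))

theorem hasWeakDerivAt_Ad_curve (ξ η : LieAlg n G) :
    HasWeakDerivAt (fun t => Ad n (curve ξ t) η) ⁅ξ, η⁆ 0 := by
  have : IsManifold (𝓡 n) ∞ G := isManifold_of_lieGroup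
  have hmul_right (g : G) : ContMDiff (𝓡 n) (𝓡 n) ∞ (fun h : G => h * g) := contMDiff_mul_right
  have hmul_left (g : G) : ContMDiff (𝓡 n) (𝓡 n) ∞ (fun h : G => g * h) := contMDiff_mul_left
  have hflow : ContMDiffAt ((𝓡 n).prod 𝓘(ℝ, ℝ)) (𝓡 n) 2
      (fun z : G × ℝ => z.1 * curve ξ z.2) (1, 0) :=
    (contMDiffAt_fst.mul (ContMDiffAt.comp ((1, 0) : G × ℝ) (contMDiffAt_curve ξ)
      contMDiffAt_snd)).of_le (WithTop.coe_le_coe.mpr (le_top : (2 : ℕ∞) ≤ ⊤))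
  refine (hasWeakDerivAt_iff_hasDerivAt (E := EuclideanSpace ℝ (Fin n))).2 ?_
  rw [GroupLieAlgebra.bracket_def]
  refine hasDerivAt_mlieBracket hflow (.of_forall fun q => by simp [curve_zero])
    (.of_forall fun q => modelDeriv_comp_curve
      ((hmul_left q).mdifferentiable (by simp) 1) ξ fun _ => rfl)
    (mdifferentiableAt_mulInvariantVectorField η) (.of_forall fun t => ?_)
  have hconj : modelDeriv (𝓡 n) (𝓡 n) (fun x : G => curve ξ t * x) 1 η =
      modelDeriv (𝓡 n) (𝓡 n) (fun x : G => x * curve ξ t) 1 (Ad n (curve ξ t) η) :=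
    modelDeriv_comp ((hmul_right _).mdifferentiable (by simp) 1)
      ((contMDiff_conj (curve ξ t)).mdifferentiable (by simp) 1) (by simp)
      (.of_forall fun x => by simp) η
  exact hconj.symm.trans
    (congrArg (fun g : G => modelDeriv (𝓡 n) (𝓡 n) (fun x => g * x) 1 η) (one_mul _).symm)

theorem hasWeakDerivAt_AdK_curve (ξ : LieAlg n G) (v : LieAlgK n G 𝕜) :
    HasWeakDerivAt (fun t => AdK n 𝕜 (curve ξ t) v) (adK n 𝕜 ξ v) 0 := by
  induction v using TensorProduct.induction_on with
  | zero => simpa using hasWeakDerivAt_const (0 : LieAlgK n G 𝕜) 0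
  | tmul z η => exact (hasWeakDerivAt_Ad_curve ξ η).map (TensorProduct.mk ℝ 𝕜 (LieAlg n G) z)
  | add x y hx hy => simpa using hx.add hy

end Adjoint

/-! ### The determinant of the adjoint representation -/

section LocallyConstant

variable {E : Type*} [NormedAddCommGroup E] [NormedSpace ℝ E] {P : Type*} [TopologicalSpace P]
  [ChartedSpace E P] [IsManifold 𝓘(ℝ, E) 1 P] {F : Type*} [NormedAddCommGroup F] [NormedSpace ℝ F]

theorem isLocallyConstant_of_modelDeriv_eq_zero {f : P → F}
    (hf : MDifferentiable 𝓘(ℝ, E) 𝓘(ℝ, F) f)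
    (hzero : ∀ p, modelDeriv 𝓘(ℝ, E) 𝓘(ℝ, F) f p = 0) : IsLocallyConstant f := by
  refine (IsLocallyConstant.iff_eventually_eq f).2 fun p => ?_
  let φ := extChartAt 𝓘(ℝ, E) p
  obtain ⟨r, hr, hball⟩ := Metric.mem_nhds_iff.1 (extChartAt_target_mem_nhds (I := 𝓘(ℝ, E)) p)
  have hsymm : MDifferentiableOn 𝓘(ℝ, E) 𝓘(ℝ, E) φ.symm (Metric.ball (φ p) r) :=
    ((contMDiffOn_extChartAt_symm (n := 1) p).mdifferentiableOn one_ne_zero).mono hball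
  have hderiv (x : E) (hx : x ∈ Metric.ball (φ p) r) :
      HasFDerivAt (f ∘ φ.symm) (0 : E →L[ℝ] F) x := by
    have hcomp := HasMFDerivAt.comp x (hf (φ.symm x)).hasMFDerivAt
      (hsymm.mdifferentiableAt (Metric.isOpen_ball.mem_nhds hx)).hasMFDerivAt
    have hz : mfderiv 𝓘(ℝ, E) 𝓘(ℝ, F) f (φ.symm x) = 0 := hzero _
    rw [hz] at hcomp
    exact hcomp.hasFDerivAt
  filter_upwards [extChartAt_source_mem_nhds (I := 𝓘(ℝ, E)) p,
    (continuousAt_extChartAt (I := 𝓘(ℝ, E)) p).preimage_mem_nhds (Metric.ball_mem_nhds _ hr)]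
    with q hq hq'
  have hconst := Metric.isOpen_ball.is_const_of_fderiv_eq_zero (𝕜 := ℝ)
    (convex_ball (φ p) r).isPreconnected
    (fun y hy => (hderiv y hy).differentiableAt.differentiableWithinAt)
    (fun y hy => (hderiv y hy).fderiv) hq' (Metric.mem_ball_self hr)
  rwa [Function.comp_apply, Function.comp_apply, φ.left_inv hq, extChartAt_to_inv] at hconst

end LocallyConstant

section Determinant

variable {R V ι : Type*} [CommRing R] [AddCommGroup V] [Module R V] [Fintype ι] [DecidableEq ι]
  (b : Module.Basis ι R V)

theorem det_update_basis (j : ι) (v : V) : b.det (Function.update b j v) = b.coord j v := by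
  conv_lhs => rw [← b.sum_repr v]
  rw [AlternatingMap.map_update_sum, Finset.sum_eq_single j]
  · simp [b.det_self]
  · intro i _ hij
    rw [AlternatingMap.map_update_smul, AlternatingMap.map_update_self _ _ hij.symm, smul_zero]
  · simp

theorem sum_det_update_basis (f : V →ₗ[R] V) :
    ∑ j, b.det (Function.update b j (f (b j))) = LinearMap.trace R V f := by
  simp [det_update_basis, LinearMap.trace_eq_matrix_trace R b, Matrix.trace,
    LinearMap.toMatrix_apply]

end Determinant

section Semisimple

variable (R L : Type*) [CommRing R] [LieRing L] [LieAlgebra R L]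

theorem lie_top_top_of_isSemisimple [LieAlgebra.IsSemisimple R L] :
    ⁅(⊤ : LieIdeal R L), (⊤ : LieIdeal R L)⁆ = ⊤ := by
  obtain ⟨J, hJ⟩ := exists_isCompl ⁅(⊤ : LieIdeal R L), (⊤ : LieIdeal R L)⁆
  have habelian : IsLieAbelian J := by
    rw [LieSubmodule.lie_abelian_iff_lie_self_eq_bot]
    exact le_bot_iff.1
      (hJ.disjoint (LieSubmodule.mono_lie le_top le_top) (LieSubmodule.lie_le_left J J))
  have hbot : J = ⊥ := LieAlgebra.HasTrivialRadical.eq_bot_of_isSolvable J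
  simpa [hbot] using hJ.sup_eq_top

variable {R L}

theorem trace_ad_of_isSemisimple [LieAlgebra.IsSemisimple R L] (ξ : L) :
    LinearMap.trace R L (LieAlgebra.ad R L ξ) = 0 := by
  have hmem : ξ ∈ ⁅(⊤ : LieIdeal R L), (⊤ : LieIdeal R L)⁆ := by
    rw [lie_top_top_of_isSemisimple]
    exact LieSubmodule.mem_top ξ
  rw [← LieSubmodule.mem_toSubmodule, LieSubmodule.lieIdeal_oper_eq_linear_span'] at hmem
  induction hmem using Submodule.span_induction with
  | mem _ h =>
    obtain ⟨x, -, y, -, rfl⟩ := h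
    have hcomm : LieAlgebra.ad R L ⁅x, y⁆ =
        LieAlgebra.ad R L x * LieAlgebra.ad R L y - LieAlgebra.ad R L y * LieAlgebra.ad R L x :=
      LinearMap.ext fun z => lie_lie x y z
    rw [hcomm, map_sub, LinearMap.trace_mul_comm, sub_self]
  | zero => simp
  | add x y _ _ hx hy => rw [map_add, map_add, hx, hy, add_zero]
  | smul c x _ hx => rw [map_smul, map_smul, hx, smul_zero]

end Semisimple

section Connected

variable {n : ℕ} {G : Type*} [TopologicalSpace G] [ChartedSpace (EuclideanSpace ℝ (Fin n)) G]
  [Group G] [LieGroup (𝓡 n) ∞ G]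

theorem mdifferentiable_mul_left (g : G) : MDifferentiable (𝓡 n) (𝓡 n) (fun h : G => g * h) :=
  (contMDiff_mul_left (I := 𝓡 n) (n := ∞)).mdifferentiable (by simp)

theorem exists_modelDeriv_mul_left_eq (g : G) (v : EuclideanSpace ℝ (Fin n)) :
    ∃ ξ : LieAlg n G, modelDeriv (𝓡 n) (𝓡 n) (fun h : G => g * h) 1 ξ = v :=
  ⟨modelDeriv (𝓡 n) (𝓡 n) (fun h : G => g⁻¹ * h) g v,
    (modelDeriv_comp (h := fun h : G => h) (mdifferentiable_mul_left g 1)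
      (mdifferentiable_mul_left g⁻¹ g) (inv_mul_cancel g)
      (.of_forall fun x => by simp) v).symm.trans
      (modelDeriv_id (E₁ := EuclideanSpace ℝ (Fin n)) g v)⟩

theorem apply_eq_of_hasDerivAt_mul_curve [PreconnectedSpace G] {F : Type*} [NormedAddCommGroup F]
    [NormedSpace ℝ F] {f : G → F} (hf : MDifferentiable (𝓡 n) 𝓘(ℝ, F) f)
    (hzero : ∀ (g : G) (ξ : LieAlg n G), HasDerivAt (fun t => f (g * curve ξ t)) 0 0) (g h : G) :
    f g = f h := by
  have : IsManifold (𝓡 n) ∞ G := isManifold_of_lieGroup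
  refine (isLocallyConstant_of_modelDeriv_eq_zero hf fun g =>
    ContinuousLinearMap.ext fun v => ?_).apply_eq_of_preconnectedSpace g h
  obtain ⟨ξ, rfl⟩ := exists_modelDeriv_mul_left_eq g v
  have hfg : MDifferentiableAt (𝓡 n) 𝓘(ℝ, F) (fun h : G => f (g * h)) 1 :=
    (hf (g * 1)).comp (1 : G) (mdifferentiable_mul_left g 1)
  have hcurve : modelDeriv (𝓡 n) 𝓘(ℝ, F) (fun h : G => f (g * h)) 1 ξ = 0 :=
    (modelDeriv_comp_curve hfg ξ fun _ => rfl).symm.trans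
      ((congrArg (fun L : ℝ →L[ℝ] F => L 1) mfderiv_eq_fderiv).trans (hzero g ξ).deriv)
  exact (modelDeriv_comp (hf g) (mdifferentiable_mul_left g 1) (mul_one g)
    (.of_forall fun _ => rfl) ξ).symm.trans hcurve

theorem hasDerivAt_det_Ad_mul_curve (b : Module.Basis (Fin n) ℝ (LieAlg n G)) (g : G)
    (ξ : LieAlg n G) :
    HasDerivAt (fun t => b.det (fun i => Ad n (g * curve ξ t) (b i)))
      (LinearMap.det (Ad n g) * LinearMap.trace ℝ _ (LieAlgebra.ad ℝ (LieAlg n G) ξ)) 0 := by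
  have hcurve := (HasWeakDerivAt.multilinear b.det.toMultilinearMap
    (fun i => hasWeakDerivAt_Ad_curve ξ (b i)) LinearMap.id).const_mul (LinearMap.det (Ad n g))
  have hb : (fun i => Ad n (curve ξ 0 : G) (b i)) = b :=
    funext fun i => by rw [curve_zero, Ad_one, LinearMap.id_apply]
  refine (hcurve.congr_of_eventuallyEq (.of_forall fun t => ?_)).congr_deriv ?_
  · simp only [Ad_mul]
    exact b.det_comp (Ad n g) _
  · rw [hb, ← sum_det_update_basis b]
    rfl

theorem det_Ad_basis [PreconnectedSpace G] (b : Module.Basis (Fin n) ℝ (LieAlg n G))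
    (hunimodular : ∀ ξ, LinearMap.trace ℝ _ (LieAlgebra.ad ℝ (LieAlg n G) ξ) = 0) (g : G) :
    b.det (fun i => Ad n g (b i)) = 1 := by
  have hsmooth : ContMDiff (𝓡 n) 𝓘(ℝ, ℝ) ∞ (fun g : G => b.det (fun i => Ad n g (b i))) := by
    simp only [Module.Basis.det_apply, Matrix.det_apply', Module.Basis.toMatrix_apply]
    exact contMDiff_finsetSum fun σ _ => contMDiff_const.mul
      (contMDiff_finsetProd fun i _ => smoothInto_Ad (b i) (b.coord (σ i)))
  rw [apply_eq_of_hasDerivAt_mul_curve (hsmooth.mdifferentiable (by simp))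
    (fun g ξ => by simpa only [hunimodular ξ, mul_zero] using hasDerivAt_det_Ad_mul_curve b g ξ)
    g 1, Ad_one]
  exact b.det_self

end Connected

/-! ### Forms of top inner degree -/

section Alternating

variable {R V W ι κ : Type*} [CommRing R] [AddCommGroup V] [Module R V] [AddCommGroup W]
  [Module R W]

theorem multilinear_eq_of_sub_mem [Finite ι] (f : MultilinearMap R (fun _ : ι => V) W)
    (K : Submodule R V) (hK : ∀ v i, v i ∈ K → f v = 0) {v w : ι → V} (h : ∀ i, v i - w i ∈ K) :
    f v = f w := by
  classical
  have := Fintype.ofFinite ι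
  have key : ∀ S : Finset ι, f (S.piecewise v w) = f w := by
    intro S
    induction S using Finset.induction_on with
    | empty => simp
    | insert j S hj ih =>
      have hw : f (S.piecewise v w) = f (Function.update (S.piecewise v w) j (w j)) :=
        congrArg f (Function.eq_update_iff.2 ⟨by simp [hj], fun _ _ => rfl⟩)
      rw [Finset.piecewise_insert, ← ih, ← sub_eq_zero, hw, ← MultilinearMap.map_update_sub]
      exact hK _ j (by simpa using h j)
  simpa using key Finset.univ

theorem alternating_apply_eq_det_smul [Fintype ι] [DecidableEq ι] (b : Module.Basis ι R V)
    (f : V [⋀^ι]→ₗ[R] W) (z : ι → V) : f z = b.det z • f b := by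
  let g : V [⋀^ι]→ₗ[R] W := (LinearMap.toSpanSingleton R W (f b)).compAlternatingMap b.det
  have hb : f b = g b := by simp [g, b.det_self]
  have h : f = g := b.ext_alternating fun u hu => by
    let σ : Equiv.Perm ι := Equiv.ofBijective u (Finite.injective_iff_bijective.1 hu)
    exact (f.map_perm b σ).trans (hb ▸ (g.map_perm b σ).symm)
  exact DFunLike.congr_fun h z

/-- The alternating map in the remaining arguments obtained from `f` by fixing those indexed by the
left summand. -/
def fixInl (f : V [⋀^ι ⊕ κ]→ₗ[R] W) (y : ι → V) : V [⋀^κ]→ₗ[R] W :=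
  { f.toMultilinearMap.currySum y with
    map_eq_zero_of_eq' := fun _ _ _ h hij =>
      f.map_eq_zero_of_eq _ h (Sum.inr_injective.ne hij) }

theorem fixInl_apply (f : V [⋀^ι ⊕ κ]→ₗ[R] W) (y : ι → V) (z : κ → V) :
    fixInl f y z = f (Sum.elim y z) := rfl

/-- The alternating map in the remaining arguments obtained from `f` by fixing those indexed by the
right summand. -/
def fixInr (f : V [⋀^ι ⊕ κ]→ₗ[R] W) (z : κ → V) : V [⋀^ι]→ₗ[R] W :=
  fixInl (f.domDomCongr (Equiv.sumComm ι κ)) z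

theorem fixInr_apply (f : V [⋀^ι ⊕ κ]→ₗ[R] W) (z : κ → V) (y : ι → V) :
    fixInr f z y = f (Sum.elim y z) :=
  (fixInl_apply _ _ _).trans (congrArg f (by ext (i | i) <;> rfl))

theorem domCoprod_sumElim_of_eq_zero {W' : Type*} [AddCommGroup W'] [Module R W'] [Fintype ι]
    [Fintype κ] [DecidableEq ι] [DecidableEq κ] (f : V [⋀^ι]→ₗ[R] W) (g : V [⋀^κ]→ₗ[R] W')
    (y : ι → V) (z : κ → V) (hf : ∀ v i j, v i = z j → f v = 0) :
    f.domCoprod g (Sum.elim y z) = f y ⊗ₜ g z := by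
  change (f.domCoprod g).toMultilinearMap (Sum.elim y z) = _
  rw [AlternatingMap.domCoprod_coe, sum_apply]
  refine (Finset.sum_eq_single (Quotient.mk'' (1 : Equiv.Perm (ι ⊕ κ))) ?_ (by simp)).trans ?_
  rotate_left
  · simp [AlternatingMap.domCoprod.summand_mk'', MultilinearMap.domCoprod_apply]
  · intro σ _ hσ
    induction σ using Quotient.inductionOn' with | _ σ
    obtain ⟨i, j, hij⟩ : ∃ i j, σ (Sum.inl i) = Sum.inr j := by
      by_contra! hcon
      refine hσ (Quotient.sound' ?_).symm
      rw [QuotientGroup.leftRel_apply, inv_one, one_mul]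
      refine Equiv.Perm.mem_sumCongrHom_range_of_perm_mapsTo_inl ?_
      rintro _ ⟨i, rfl⟩
      rcases h : σ (Sum.inl i) with j | j
      · exact ⟨j, rfl⟩
      · exact absurd h (hcon i j)
    have hzero : f (fun i => Sum.elim y z (σ (Sum.inl i))) = 0 :=
      hf _ i j (by rw [hij, Sum.elim_inr])
    rw [AlternatingMap.domCoprod.summand_mk'', smul_apply,
      MultilinearMap.domDomCongr_apply, MultilinearMap.domCoprod_apply,
      AlternatingMap.coe_multilinearMap, hzero, TensorProduct.zero_tmul, smul_zero]

theorem exists_perm_natAdd_mem {r n : ℕ} {S : Finset (Fin (r + n))} (hS : S.card = n) :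
    ∃ σ : Equiv.Perm (Fin (r + n)), ∀ j : Fin n, σ (Fin.natAdd r j) ∈ S := by
  let e : {x // x ∈ Finset.univ.map (Fin.natAddEmb (m := n) r)} ≃ {x // x ∈ S} :=
    Finset.equivOfCardEq (by simp [hS])
  exact ⟨e.extendSubtype, fun j =>
    e.extendSubtype_mem _ (Finset.mem_map.2 ⟨j, Finset.mem_univ _, rfl⟩)⟩

theorem append_comp_finSumFinEquiv {X : Type*} {r n : ℕ} (y : Fin r → X) (z : Fin n → X) :
    Fin.append y z ∘ finSumFinEquiv = Sum.elim y z := by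
  ext (i | i) <;> simp

end Alternating

section InnerDegree

variable {R T L W ι κ : Type*} [CommRing R] [AddCommGroup T] [Module R T] [AddCommGroup L]
  [Module R L] [AddCommGroup W] [Module R W]

theorem apply_sumElim_basis_eq_zero (b : Module.Basis κ R L) (f : (T × L) [⋀^ι ⊕ κ]→ₗ[R] W)
    {y : ι → T × L} {i : ι} (hi : (y i).1 = 0) : f (Sum.elim y fun j => (0, b j)) = 0 := by
  classical
  let v : ι ⊕ κ → T × L := Sum.elim y fun j => (0, b j)
  let ℓ : L →ₗ[R] W :=
    (f.toMultilinearMap.toLinearMap v (Sum.inl i)).comp (LinearMap.inr R T L)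
  have hℓ : ℓ = 0 := b.ext fun j =>
    f.map_eq_zero_of_eq (i := Sum.inl i) (j := Sum.inr j) _ (by simp [v]) (by simp)
  have hv : v = Function.update v (Sum.inl i) (0, (y i).2) := by
    rw [Function.eq_update_iff]
    exact ⟨Prod.ext hi rfl, fun _ _ => rfl⟩
  exact (congrArg f hv).trans (LinearMap.congr_fun hℓ (y i).2)

variable {r n : ℕ}

/-- The component in `Λʳ T* ⊗ Λⁿ L*` of a form `f` on `T ⊕ L`, evaluated on the basis `b` of `L`
in its last `n` arguments. -/
def innerPart (b : Fin n → L) (f : (T × L) [⋀^Fin (r + n)]→ₗ[R] W) : T [⋀^Fin r]→ₗ[R] W :=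
  (fixInr (f.domDomCongr finSumFinEquiv.symm) fun j => (0, b j)).compLinearMap
    (LinearMap.inl R T L)

theorem domDomCongr_finSumFinEquiv_symm_sumElim {X : Type*} [AddCommGroup X] [Module R X]
    (f : X [⋀^Fin (r + n)]→ₗ[R] W) (y : Fin r → X) (z : Fin n → X) :
    f.domDomCongr finSumFinEquiv.symm (Sum.elim y z) = f (Fin.append y z) := by
  rw [← append_comp_finSumFinEquiv]
  exact congrArg f (funext fun i => by simp)

theorem innerPart_apply (b : Fin n → L) (f : (T × L) [⋀^Fin (r + n)]→ₗ[R] W) (Y : Fin r → T) :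
    innerPart b f Y = f (Fin.append (fun i => (Y i, 0)) fun j => (0, b j)) :=
  (fixInr_apply _ _ _).trans (domDomCongr_finSumFinEquiv_symm_sumElim f _ _)

theorem innerPart_compLinearMap_prodMap {T' : Type*} [AddCommGroup T'] [Module R T'] (b : Fin n → L)
    (f : (T × L) [⋀^Fin (r + n)]→ₗ[R] W) (φ : T' →ₗ[R] T) (Y : Fin r → T') :
    innerPart b (f.compLinearMap (φ.prodMap LinearMap.id)) Y =
      innerPart b f fun i => φ (Y i) := by
  rw [innerPart_apply, innerPart_apply, AlternatingMap.compLinearMap_apply]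
  congr 1
  funext i
  refine Fin.addCases (fun i => ?_) (fun j => ?_) i
  · simp only [Fin.append_left, LinearMap.prodMap_apply, LinearMap.id_apply]
  · simp only [Fin.append_right, LinearMap.prodMap_apply, map_zero, LinearMap.id_apply]

theorem apply_append_inr (b : Module.Basis (Fin n) R L) (f : (T × L) [⋀^Fin (r + n)]→ₗ[R] W)
    (y : Fin r → T × L) (c : Fin n → L) :
    f (Fin.append y fun j => (0, c j)) = b.det c • innerPart b f fun i => (y i).1 := by
  let g := f.domDomCongr finSumFinEquiv.symm
  have hdet : f (Fin.append y fun j => (0, c j)) =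
      b.det c • f (Fin.append y fun j => (0, b j)) := by
    simp only [← domDomCongr_finSumFinEquiv_symm_sumElim]
    exact alternating_apply_eq_det_smul b ((fixInl g y).compLinearMap (LinearMap.inr R T L)) c
  have hfst : fixInr g (fun j => (0, b j)) y = fixInr g (fun j => (0, b j)) fun i => ((y i).1, 0) :=
    multilinear_eq_of_sub_mem (fixInr g fun j => (0, b j)).toMultilinearMap
      (LinearMap.ker (LinearMap.fst R T L))
      (fun v i hi => (fixInr_apply _ _ _).trans (apply_sumElim_basis_eq_zero b g hi))
      fun i => by simp
  rw [hdet, ← domDomCongr_finSumFinEquiv_symm_sumElim, ← fixInr_apply]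
  exact congrArg (b.det c • ·) hfst

theorem apply_append_basis (b : Module.Basis (Fin n) R L) (f : (T × L) [⋀^Fin (r + n)]→ₗ[R] W)
    (y : Fin r → T × L) :
    f (Fin.append y fun j => (0, b j)) = innerPart b f fun i => (y i).1 := by
  rw [apply_append_inr b, b.det_self, one_smul]

end InnerDegree

section InnerDegreeLT

variable {T L W : Type*} [AddCommGroup T] [Module ℝ T] [AddCommGroup L] [Module ℝ L]
  [AddCommGroup W] [Module ℝ W] {r n : ℕ}

theorem innerDegreeLT_iff (b : Module.Basis (Fin n) ℝ L) (f : (T × L) [⋀^Fin (r + n)]→ₗ[ℝ] W) :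
    InnerDegreeLT n f ↔ ∀ Y, innerPart b f Y = 0 := by
  refine ⟨fun h Y => ?_, fun h v S hS hv => ?_⟩
  · rw [innerPart_apply]
    refine h _ (Finset.univ.map (Fin.natAddEmb r)) (by simp) fun i hi => ?_
    obtain ⟨j, -, rfl⟩ := Finset.mem_map.1 hi
    simp
  · obtain ⟨σ, hσ⟩ := exists_perm_natAdd_mem hS
    have hsplit : v ∘ σ = Fin.append (fun i => v (σ (Fin.castAdd n i)))
        fun j => (0, (v (σ (Fin.natAdd r j))).2) := by
      funext i
      refine Fin.addCases (fun i => ?_) (fun j => ?_) i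
      · simp
      · simp [Prod.ext_iff, hv _ (hσ j)]
    have hzero : Equiv.Perm.sign σ • f v = 0 := by
      rw [← f.map_perm, hsplit, apply_append_inr b, h, smul_zero]
    exact (smul_eq_zero_iff_eq _).1 hzero

theorem wedge_append (α : T [⋀^Fin r]→ₗ[ℝ] W) (β : (T × L) [⋀^Fin n]→ₗ[ℝ] ℝ)
    (y : Fin r → T × L) (z : Fin n → T × L) (hz : ∀ j, (z j).1 = 0) :
    wedge α β (Fin.append y z) = β z • α (fun i => (y i).1) := by
  change TensorProduct.rid ℝ W ((α.compLinearMap (LinearMap.fst ℝ T L)).domCoprod β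
    (Fin.append y z ∘ finSumFinEquiv)) = _
  rw [append_comp_finSumFinEquiv, domCoprod_sumElim_of_eq_zero]
  · exact TensorProduct.rid_tmul _ _
  · exact fun v i j hij => α.map_coord_zero i ((congrArg Prod.fst hij).trans (hz j))

theorem innerDegreeLT_sub_wedge_iff (b : Module.Basis (Fin n) ℝ L)
    (f : (T × L) [⋀^Fin (r + n)]→ₗ[ℝ] W) (α : T [⋀^Fin r]→ₗ[ℝ] W)
    (β : (T × L) [⋀^Fin n]→ₗ[ℝ] ℝ) :
    InnerDegreeLT n (f - wedge α β) ↔ ∀ Y, innerPart b f Y = β (fun j => (0, b j)) • α Y := by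
  simp only [innerDegreeLT_iff b, innerPart_apply, AlternatingMap.sub_apply, sub_eq_zero,
    wedge_append α β _ _ fun j => (rfl : (((0, b j) : T × L)).1 = 0)]

end InnerDegreeLT

/-! ### Geometry of a principal bundle -/

section Geometry

theorem tangentBundle_mk_eq_of_eq {E : Type*} [NormedAddCommGroup E] [NormedSpace ℝ E] {N : Type*}
    [TopologicalSpace N] [ChartedSpace E N] {p q : N} (h : p = q) (v : E) :
    (⟨p, v⟩ : TangentBundle 𝓘(ℝ, E) N) = ⟨q, v⟩ := by
  subst h
  rfl

variable {n k m : ℕ} {G P M : Type*}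
  [TopologicalSpace G] [ChartedSpace (EuclideanSpace ℝ (Fin n)) G] [Group G]
  [TopologicalSpace P] [ChartedSpace (EuclideanSpace ℝ (Fin k)) P]
  [TopologicalSpace M] [ChartedSpace (EuclideanSpace ℝ (Fin m)) M]

namespace PrincipalBundle

variable (Q : PrincipalBundle n k m G P M)

theorem contMDiff_act_right (g : G) : ContMDiff (𝓡 k) (𝓡 k) ∞ (fun p => Q.act p g) :=
  Q.smooth_act.comp (contMDiff_id.prodMk contMDiff_const)

theorem mdifferentiable_act_right (g : G) : MDifferentiable (𝓡 k) (𝓡 k) (fun p => Q.act p g) :=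
  (Q.contMDiff_act_right g).mdifferentiable (by simp)

theorem mdifferentiable_act_left (p : P) : MDifferentiable (𝓡 n) (𝓡 k) (fun g => Q.act p g) :=
  (Q.smooth_act.comp (contMDiff_const.prodMk contMDiff_id)).mdifferentiable (by simp)

theorem mdifferentiable_proj : MDifferentiable (𝓡 k) (𝓡 m) Q.proj :=
  Q.smooth_proj.mdifferentiable (by simp)

theorem act_act_inv (p : P) (g : G) : Q.act (Q.act p g) g⁻¹ = p := by
  rw [← Q.act_mul, mul_inv_cancel, Q.act_one]

theorem act_inv_act (p : P) (g : G) : Q.act (Q.act p g⁻¹) g = p := by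
  rw [← Q.act_mul, inv_mul_cancel, Q.act_one]

/-- The map `ξ ↦ ξ^P(p)` as a linear map. -/
def fundLin (p : P) : LieAlg n G →ₗ[ℝ] TangentSpace (𝓡 k) p :=
  (modelDeriv (𝓡 n) (𝓡 k) (fun g : G => Q.act p g) 1).toLinearMap

theorem fundLin_apply (p : P) (ξ : LieAlg n G) : Q.fundLin p ξ = Q.fund ξ p := rfl

theorem dproj_dR (g : G) (p : P) (Y : TangentSpace (𝓡 k) p) :
    (Q.dproj (Q.act p g) (Q.dR g p Y) : EuclideanSpace ℝ (Fin m)) = Q.dproj p Y :=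
  (modelDeriv_comp (h := Q.proj) (Q.mdifferentiable_proj (Q.act p g))
    (Q.mdifferentiable_act_right g p) rfl (.of_forall fun a => (Q.proj_act a g).symm) Y).symm

theorem dproj_fund (ξ : LieAlg n G) (p : P) : Q.dproj p (Q.fund ξ p) = 0 :=
  (modelDeriv_comp (h := fun _ : G => Q.proj p) (Q.mdifferentiable_proj p)
    (Q.mdifferentiable_act_left p 1) (Q.act_one p) (.of_forall fun g => (Q.proj_act p g).symm)
    ξ).symm.trans (modelDeriv_const _ _ _)

theorem dR_fund [LieGroup (𝓡 n) ∞ G] (g : G) (p : P) (ξ : LieAlg n G) :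
    Q.dR g p (Q.fund ξ p) = Q.fund (Ad n g⁻¹ ξ) (Q.act p g) := by
  have hleft := modelDeriv_comp (Q.mdifferentiable_act_right g p) (Q.mdifferentiable_act_left p 1)
    (Q.act_one p) (.of_forall fun a => rfl) ξ
  have hright := modelDeriv_comp (h := fun a => Q.act (Q.act p a) g)
    (Q.mdifferentiable_act_left (Q.act p g) 1) ((contMDiff_conj g⁻¹).mdifferentiable (by simp) 1)
    (by simp) (.of_forall fun a => by simp only [← Q.act_mul]; congr 1; group) ξ
  exact hleft.symm.trans hright

theorem contMDiffAt_fund [LieGroup (𝓡 n) ∞ G] [IsManifold (𝓡 k) ∞ P] {c : P → LieAlg n G} {p : P}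
    (hc : SmoothIntoAt k c p) :
    ContMDiffAt (𝓡 k) (𝓡 k).tangent ∞
      (fun q => (⟨q, Q.fund (c q) q⟩ : TangentBundle (𝓡 k) P)) p := by
  have : IsManifold (𝓡 n) ∞ G := isManifold_of_lieGroup
  have hv := contMDiffAt_tangentBundle_mk_const (p := (1 : G))
    ((smoothIntoAt_iff_contMDiffAt (E := EuclideanSpace ℝ (Fin n))).1 hc)
  exact (contMDiffAt_mfderiv_apply (F := Q.act) (a := fun _ : P => (1 : G)) (Q.smooth_act (p, 1))
    hv).congr_of_eventuallyEq
      (.of_forall fun q => (tangentBundle_mk_eq_of_eq (Q.act_one q) _).symm)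

theorem contMDiffAt_dproj [IsManifold (𝓡 k) ∞ P] [IsManifold (𝓡 m) ∞ M]
    {Y : ∀ p : P, TangentSpace (𝓡 k) p} {p : P}
    (hY : ContMDiffAt (𝓡 k) (𝓡 k).tangent ∞ (fun q => (⟨q, Y q⟩ : TangentBundle (𝓡 k) P)) p) :
    ContMDiffAt (𝓡 k) (𝓡 m).tangent ∞
      (fun q => (⟨Q.proj q, Q.dproj q (Y q)⟩ : TangentBundle (𝓡 m) M)) p :=
  contMDiffAt_mfderiv_apply (F := fun (_ : P) (q : P) => Q.proj q) (a := fun q => q)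
    (ContMDiffAt.comp (p, p) (Q.smooth_proj p) contMDiffAt_snd) hY

end PrincipalBundle

/-! ### Local trivializations -/

namespace IsLocalTriv

variable {Q : PrincipalBundle n k m G P M} {U : Set M} {s : M → P} {τ : P → G}
  (ht : IsLocalTriv (n := n) (k := k) (m := m) Q.proj Q.act U s τ)

include ht

theorem fibre_act_mul {p : P} (hp : Q.proj p ∈ U) (g : G) : τ (Q.act p g) = τ p * g := by
  conv_lhs => rw [← ht.section_act p hp, ← Q.act_mul]
  exact ht.fibre_act _ hp _

theorem contMDiffAt_section {x : M} (hx : x ∈ U) : ContMDiffAt (𝓡 m) (𝓡 k) ∞ s x :=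
  ht.smooth_section.contMDiffAt (ht.isOpen.mem_nhds hx)

theorem preimage_mem_nhds {p : P} (hp : Q.proj p ∈ U) : Q.proj ⁻¹' U ∈ 𝓝 p :=
  Q.smooth_proj.continuous.continuousAt.preimage_mem_nhds (ht.isOpen.mem_nhds hp)

theorem contMDiffAt_fibre {p : P} (hp : Q.proj p ∈ U) : ContMDiffAt (𝓡 k) (𝓡 n) ∞ τ p :=
  ht.smooth_fibre.contMDiffAt (ht.preimage_mem_nhds hp)

theorem mdifferentiableAt_act_section {x : M} (hx : x ∈ U) (g : G) :
    MDifferentiableAt (𝓡 m) (𝓡 k) (fun x => Q.act (s x) g) x :=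
  MDifferentiableAt.comp x (Q.mdifferentiable_act_right g (s x))
    ((ht.contMDiffAt_section hx).mdifferentiableAt (by simp))

theorem dproj_mfderiv_section {x : M} (hx : x ∈ U) (v : TangentSpace (𝓡 m) x) :
    (Q.dproj (s x) (mfderiv (𝓡 m) (𝓡 k) s x v) : EuclideanSpace ℝ (Fin m)) = v := by
  have h := modelDeriv_comp (h := fun y : M => y) (Q.mdifferentiable_proj (s x))
    ((ht.contMDiffAt_section hx).mdifferentiableAt (by simp)) rfl (by
      filter_upwards [ht.isOpen.mem_nhds hx] with y hy using (ht.proj_section y hy).symm) v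
  exact h.symm.trans (modelDeriv_id (E₁ := EuclideanSpace ℝ (Fin m)) x v)

end IsLocalTriv

namespace PrincipalBundle

section Lift

variable {Q : PrincipalBundle n k m G P M} {U : Set M} {s : M → P} {τ : P → G}

variable (Q s τ) in
/-- The tangent vector at `p` over a tangent vector of the base that is tangent to the translate
through `p` of the local section `s` of a trivialization with fibre coordinate `τ`. -/
def lift (p : P) : TangentSpace (𝓡 m) (Q.proj p) →ₗ[ℝ] TangentSpace (𝓡 k) p :=
  (modelDeriv (𝓡 m) (𝓡 k) (fun x => Q.act (s x) (τ p)) (Q.proj p)).toLinearMap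

variable (ht : IsLocalTriv (n := n) (k := k) (m := m) Q.proj Q.act U s τ)

include ht

theorem dproj_lift {p : P} (hp : Q.proj p ∈ U) (v : TangentSpace (𝓡 m) (Q.proj p)) :
    Q.dproj p (Q.lift s τ p v) = v := by
  have h := modelDeriv_comp (h := fun x : M => x) (Q.mdifferentiable_proj p)
    (ht.mdifferentiableAt_act_section hp (τ p)) (ht.section_act p hp) (by
      filter_upwards [ht.isOpen.mem_nhds hp] with x hx
      rw [Q.proj_act, ht.proj_section x hx]) v
  exact h.symm.trans (modelDeriv_id (E₁ := EuclideanSpace ℝ (Fin m)) (Q.proj p) v)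

theorem dR_lift {p : P} (hp : Q.proj p ∈ U) (g : G) (v : TangentSpace (𝓡 m) (Q.proj p)) :
    (Q.dR g p (Q.lift s τ p v) : EuclideanSpace ℝ (Fin k)) =
      Q.lift s τ (Q.act p g) (v : EuclideanSpace ℝ (Fin m)) := by
  have h := modelDeriv_comp (h := fun x => Q.act (s x) (τ (Q.act p g)))
    (Q.mdifferentiable_act_right g p) (ht.mdifferentiableAt_act_section hp (τ p))
    (ht.section_act p hp) (.of_forall fun x => by rw [ht.fibre_act_mul hp, Q.act_mul]) v
  refine h.symm.trans ?_
  unfold lift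
  rw [Q.proj_act]
  rfl

theorem contMDiffAt_lift [IsManifold (𝓡 k) ∞ P] [IsManifold (𝓡 m) ∞ M] {p : P}
    (hp : Q.proj p ∈ U) {v : ∀ q, TangentSpace (𝓡 m) (Q.proj q)}
    (hv : ContMDiffAt (𝓡 k) (𝓡 m).tangent ∞
      (fun q => (⟨Q.proj q, v q⟩ : TangentBundle (𝓡 m) M)) p) :
    ContMDiffAt (𝓡 k) (𝓡 k).tangent ∞
      (fun q => (⟨q, Q.lift s τ q (v q)⟩ : TangentBundle (𝓡 k) P)) p := by
  have hF : ContMDiffAt ((𝓡 k).prod (𝓡 m)) (𝓡 k) ∞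
      (Function.uncurry fun (q : P) (x : M) => Q.act (s x) (τ q)) (p, Q.proj p) :=
    ContMDiffAt.comp (p, Q.proj p) (Q.smooth_act _)
      ((ContMDiffAt.comp (p, Q.proj p) (ht.contMDiffAt_section hp) contMDiffAt_snd).prodMk
        (ContMDiffAt.comp (p, Q.proj p) (ht.contMDiffAt_fibre hp) contMDiffAt_fst))
  refine (contMDiffAt_mfderiv_apply hF hv).congr_of_eventuallyEq ?_
  filter_upwards [ht.preimage_mem_nhds hp] with q hq
  exact (tangentBundle_mk_eq_of_eq (ht.section_act q hq) _).symm

variable [LieGroup (𝓡 n) ∞ G]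

theorem exists_eq_lift_add_fund {p : P} (hp : Q.proj p ∈ U) (Y : TangentSpace (𝓡 k) p) :
    ∃ ξ : LieAlg n G, Y = Q.lift s τ p (Q.dproj p Y) + Q.fund ξ p := by
  have hsec : MDifferentiableAt (𝓡 k) (𝓡 k) (fun q => Q.act (s (Q.proj q)) (τ p)) p :=
    MDifferentiableAt.comp p (ht.mdifferentiableAt_act_section hp (τ p)) (Q.mdifferentiable_proj p)
  have hfib : MDifferentiableAt (𝓡 k) (𝓡 n) (fun q => (τ p)⁻¹ * τ q) p :=
    (contMDiffAt_const.mul (ht.contMDiffAt_fibre hp)).mdifferentiableAt (n := ∞) (by simp)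
  have hid := modelDeriv_comp_prodMk (h := fun q : P => q)
    (Q.smooth_act.mdifferentiable (by simp) (p, (1 : G))) hsec hfib (ht.section_act p hp) (by simp)
    (by
      filter_upwards [ht.preimage_mem_nhds hp] with q hq
      rw [← Q.act_mul, mul_inv_cancel_left, ht.section_act q hq]) Y
  simp only [Q.act_one] at hid
  rw [modelDeriv_comp (h := fun q => Q.act (s (Q.proj q)) (τ p))
    (ht.mdifferentiableAt_act_section hp (τ p)) (Q.mdifferentiable_proj p) rfl
    (.of_forall fun _ => rfl) Y, modelDeriv_id] at hid
  exact ⟨_, (modelDeriv_id (E₁ := EuclideanSpace ℝ (Fin k)) p Y).symm.trans hid⟩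

theorem fund_injective_of_isLocalTriv {p : P} (hp : Q.proj p ∈ U) :
    Function.Injective (Q.fundLin p) := by
  refine (injective_iff_map_eq_zero (Q.fundLin p)).2 fun ξ hξ => ?_
  have hfib : MDifferentiableAt (𝓡 k) (𝓡 n) (fun q => (τ p)⁻¹ * τ q) p :=
    (contMDiffAt_const.mul (ht.contMDiffAt_fibre hp)).mdifferentiableAt (n := ∞) (by simp)
  have h := modelDeriv_comp (h := fun g : G => g) hfib (Q.mdifferentiable_act_left p 1)
    (Q.act_one p) (.of_forall fun g => by rw [ht.fibre_act_mul hp, inv_mul_cancel_left]) ξ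
  exact (modelDeriv_id (E₁ := EuclideanSpace ℝ (Fin n)) (1 : G) ξ).symm.trans
    (h.trans ((congrArg _ hξ).trans (map_zero _)))

end Lift

variable (Q : PrincipalBundle n k m G P M)

theorem proj_surjective : Function.Surjective Q.proj := fun x => by
  obtain ⟨U, s, τ, hx, ht⟩ := Q.locally_trivial x
  exact ⟨s x, ht.proj_section x hx⟩

theorem exists_act_eq_of_proj_eq {p q : P} (h : Q.proj p = Q.proj q) : ∃ g, Q.act p g = q := by
  obtain ⟨U, s, τ, hp, ht⟩ := Q.locally_trivial (Q.proj p)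
  refine ⟨(τ p)⁻¹ * τ q, ?_⟩
  calc Q.act p ((τ p)⁻¹ * τ q)
      = Q.act (Q.act (s (Q.proj p)) (τ p)) ((τ p)⁻¹ * τ q) := by rw [ht.section_act p hp]
    _ = q := by rw [← Q.act_mul, mul_inv_cancel_left, h, ht.section_act q (h ▸ hp)]

theorem dproj_surjective (p : P) : Function.Surjective (Q.dproj p) := by
  obtain ⟨U, s, τ, hp, ht⟩ := Q.locally_trivial (Q.proj p)
  exact fun v => ⟨_, dproj_lift ht hp v⟩

theorem exists_fund_of_dproj_eq_zero [LieGroup (𝓡 n) ∞ G] {p : P} {Y : TangentSpace (𝓡 k) p}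
    (hY : Q.dproj p Y = 0) : ∃ ξ : LieAlg n G, Q.fund ξ p = Y := by
  obtain ⟨U, s, τ, hp, ht⟩ := Q.locally_trivial (Q.proj p)
  obtain ⟨ξ, hξ⟩ := exists_eq_lift_add_fund ht hp Y
  rw [hY, map_zero, zero_add] at hξ
  exact ⟨ξ, hξ.symm⟩

end PrincipalBundle

end Geometry

/-! ### Local frames -/

section Frame

section Cutoff

variable {E : Type*} [NormedAddCommGroup E] [NormedSpace ℝ E] {H : Type*} [TopologicalSpace H]
  {I : ModelWithCorners ℝ E H} {N : Type*} [TopologicalSpace N] [ChartedSpace H N]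

theorem exists_cutoff [FiniteDimensional ℝ E] [IsManifold I ∞ N] [T2Space N] {x₀ : N} {U : Set N}
    (hU : U ∈ 𝓝 x₀) :
    ∃ χ : N → ℝ, ContMDiff I 𝓘(ℝ, ℝ) ∞ χ ∧ tsupport χ ⊆ U ∧ ∀ᶠ x in 𝓝 x₀, χ x = 1 := by
  obtain ⟨f, -, hf⟩ := (SmoothBumpFunction.nhds_basis_tsupport (I := I) x₀).mem_iff.1 hU
  exact ⟨f, f.contMDiff, hf, f.eventuallyEq_one⟩

theorem eq_zero_of_tsupport_subset {X R : Type*} [TopologicalSpace X] [Zero R] {χ : X → R}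
    {U : Set X} (hU : tsupport χ ⊆ U) {x : X} (hx : x ∉ U) : χ x = 0 :=
  image_eq_zero_of_notMem_tsupport fun h => hx (hU h)

theorem exists_contMDiffSection_smul {F : Type*} [NormedAddCommGroup F] [NormedSpace ℝ F]
    {V : N → Type*} [TopologicalSpace (Bundle.TotalSpace F V)] [∀ x, AddCommGroup (V x)]
    [∀ x, Module ℝ (V x)] [∀ x, TopologicalSpace (V x)] [FiberBundle F V] [VectorBundle ℝ F V]
    {r : ℕ∞ω} {χ : N → ℝ} (hχ : ContMDiff I 𝓘(ℝ, ℝ) r χ) {U : Set N} (hU : IsOpen U)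
    (hχU : tsupport χ ⊆ U) {Z : ∀ x, V x}
    (hZ : ∀ x ∈ U, ContMDiffAt I (I.prod 𝓘(ℝ, F)) r (fun y => Bundle.TotalSpace.mk' F y (Z y)) x) :
    ∃ X : ContMDiffSection I F r V, ∀ x, X x = χ x • Z x :=
  ⟨⟨fun x => χ x • Z x, ContMDiffOn.smul_section_of_tsupport hχ.contMDiffOn hU hχU
    fun x hx => (hZ x hx).contMDiffWithinAt⟩, fun _ => rfl⟩

end Cutoff

section LocalFrame

variable {𝕜 : Type*} [NontriviallyNormedField 𝕜]
  {E : Type*} [NormedAddCommGroup E] [NormedSpace 𝕜 E] {H : Type*} [TopologicalSpace H]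
  {I : ModelWithCorners 𝕜 E H} {N : Type*} [TopologicalSpace N] [ChartedSpace H N]
  {F : Type*} [NormedAddCommGroup F] [NormedSpace 𝕜 F]
  {V : N → Type*} [TopologicalSpace (Bundle.TotalSpace F V)]
  [∀ x, AddCommGroup (V x)] [∀ x, Module 𝕜 (V x)] [∀ x, TopologicalSpace (V x)] [FiberBundle F V]
  {r : ℕ∞ω} {ι : Type*} {e : ι → ∀ x : N, V x} {u : Set N}

theorem sum_localFrame_coeff_smul [Fintype ι] (he : IsLocalFrameOn I F r e u) {x : N} (hx : x ∈ u)
    (v : V x) : ∑ i, he.coeff i x v • e i x = v := by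
  simpa only [IsLocalFrameOn.coeff, hx, dif_pos, Module.Basis.coord_apply, he.toBasisAt_coe hx]
    using (he.toBasisAt hx).sum_repr v

theorem localFrame_coeff_sum_smul [Fintype ι] (he : IsLocalFrameOn I F r e u) {x : N} (hx : x ∈ u)
    (c : ι → 𝕜) (i : ι) : he.coeff i x (∑ j, c j • e j x) = c i := by
  simp only [IsLocalFrameOn.coeff, hx, dif_pos, Module.Basis.coord_apply,
    ← he.toBasisAt_coe hx, Module.Basis.repr_sum_self]

variable [CompleteSpace 𝕜]

theorem exists_inverse_sum_smulRight_eq_coeff [Fintype ι] (he : IsLocalFrameOn I F r e u)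
    (T : Bundle.Trivialization F (Bundle.TotalSpace.proj : Bundle.TotalSpace F V → N))
    [T.IsLinear 𝕜] {x : N} (hx : x ∈ u) (hT : x ∈ T.baseSet) :
    ∃ A : (ι → 𝕜) ≃L[𝕜] F, (A : (ι → 𝕜) →L[𝕜] F) =
        ∑ j, (ContinuousLinearMap.proj j).smulRight (T ⟨x, e j x⟩).2 ∧
      ∀ v i, A.symm (T ⟨x, v⟩).2 i = he.coeff i x v := by
  let A := (he.toBasisAt hx).equivFun.symm ≪≫ₗ T.linearEquivAt 𝕜 x hT
  refine ⟨A.toContinuousLinearEquiv, ?_, fun v i => ?_⟩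
  · ext c
    simp [A]
  · change (he.toBasisAt hx).repr ((T.linearEquivAt 𝕜 x hT).symm (T.linearEquivAt 𝕜 x hT v)) i = _
    rw [LinearEquiv.symm_apply_apply]
    simp only [IsLocalFrameOn.coeff, hx, dif_pos, Module.Basis.coord_apply]

theorem contMDiffAt_localFrame_coeff [Finite ι] [VectorBundle 𝕜 F V] [ContMDiffVectorBundle r F V I]
    {E' : Type*} [NormedAddCommGroup E'] [NormedSpace 𝕜 E'] {H' : Type*} [TopologicalSpace H']
    {J : ModelWithCorners 𝕜 E' H'} {N' : Type*} [TopologicalSpace N'] [ChartedSpace H' N']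
    (he : IsLocalFrameOn I F r e u) (hu : IsOpen u) {f : N' → N} {y₀ : N'} (hy₀ : f y₀ ∈ u)
    {t : ∀ y : N', V (f y)}
    (ht : ContMDiffAt J (I.prod 𝓘(𝕜, F)) r (fun y => Bundle.TotalSpace.mk' F (f y) (t y)) y₀)
    (i : ι) : ContMDiffAt J 𝓘(𝕜, 𝕜) r (fun y => he.coeff i (f y) (t y)) y₀ := by
  have := Fintype.ofFinite ι
  let T := trivializationAt F V (f y₀)
  let A (x : N) : (ι → 𝕜) →L[𝕜] F :=
    ∑ j, (ContinuousLinearMap.proj j).smulRight (T ⟨x, e j x⟩).2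
  have hA : ContMDiffAt I 𝓘(𝕜, (ι → 𝕜) →L[𝕜] F) r A (f y₀) :=
    contMDiffAt_finsetSum fun j _ => ContMDiffAt.comp (f y₀)
      (ContinuousLinearMap.smulRightL 𝕜 (ι → 𝕜) F (.proj j)).contMDiff.contMDiffAt
      ((Bundle.contMDiffAt_section (f y₀)).1 (he.contMDiffAt hu hy₀ j))
  have hT : f y₀ ∈ T.baseSet := FiberBundle.mem_baseSet_trivializationAt' (f y₀)
  obtain ⟨hf, htriv⟩ := Bundle.contMDiffAt_totalSpace.1 ht
  have hinv : ContMDiffAt J 𝓘(𝕜, F →L[𝕜] (ι → 𝕜)) r (fun y => (A (f y)).inverse) y₀ := by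
    obtain ⟨A₀, hA₀, -⟩ := exists_inverse_sum_smulRight_eq_coeff he T hy₀ hT
    have h := (contDiffAt_map_inverse (n := r) A₀).contMDiffAt
    rw [hA₀] at h
    exact h.comp y₀ (hA.comp y₀ hf)
  have hcoeff : ∀ᶠ y in 𝓝 y₀,
      he.coeff i (f y) (t y) = (A (f y)).inverse (T ⟨f y, t y⟩).2 i := by
    filter_upwards [hf.continuousAt.eventually (hu.mem_nhds hy₀),
      hf.continuousAt.eventually (T.open_baseSet.mem_nhds hT)] with y hy hyT
    obtain ⟨B, hB, hcoeff⟩ := exists_inverse_sum_smulRight_eq_coeff he T hy hyT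
    rw [show A (f y) = B from hB.symm, ContinuousLinearMap.inverse_equiv]
    exact (hcoeff _ _).symm
  refine ContMDiffAt.congr_of_eventuallyEq ?_ hcoeff
  exact contMDiffAt_pi_space.1 (hinv.clm_apply htriv) i

end LocalFrame

theorem exists_contMDiffSection_isLocalFrameOn {E : Type*} [NormedAddCommGroup E] [NormedSpace ℝ E]
    [FiniteDimensional ℝ E] {H : Type*} [TopologicalSpace H] {I : ModelWithCorners ℝ E H}
    {N : Type*} [TopologicalSpace N] [ChartedSpace H N] [IsManifold I ∞ N] [T2Space N]
    {F : Type*} [NormedAddCommGroup F] [NormedSpace ℝ F] {V : N → Type*}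
    [TopologicalSpace (Bundle.TotalSpace F V)] [∀ x, AddCommGroup (V x)] [∀ x, Module ℝ (V x)]
    [∀ x, TopologicalSpace (V x)] [FiberBundle F V] [VectorBundle ℝ F V]
    [ContMDiffVectorBundle ∞ F V I] {ι : Type*} (b : Module.Basis ι ℝ F) (x₀ : N) :
    ∃ (W : Set N) (e : ι → ContMDiffSection I F ∞ V), IsOpen W ∧ x₀ ∈ W ∧
      IsLocalFrameOn I F ∞ (fun j x => e j x) W := by
  let T := trivializationAt F V x₀
  have hT := T.isLocalFrameOn_localFrame_baseSet I ∞ b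
  have hx₀ : x₀ ∈ T.baseSet := FiberBundle.mem_baseSet_trivializationAt' x₀
  obtain ⟨χ, hχ, hχT, hχ1⟩ := exists_cutoff (I := I) (T.open_baseSet.mem_nhds hx₀)
  choose e he using fun j => exists_contMDiffSection_smul hχ T.open_baseSet hχT
    fun x hx => hT.contMDiffAt T.open_baseSet hx j
  obtain ⟨W, hWχ, hW, hxW⟩ := eventually_nhds_iff.1 hχ1
  refine ⟨W ∩ T.baseSet, e, hW.inter T.open_baseSet, ⟨hxW, hx₀⟩, ?_⟩
  refine (hT.mono Set.inter_subset_right).congr fun j x hx => ?_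
  rw [he, hWχ _ hx.1, one_smul]

end Frame

section InvariantFrame

variable {n k m : ℕ} {G P M : Type*}
  [TopologicalSpace G] [ChartedSpace (EuclideanSpace ℝ (Fin n)) G] [Group G]
  [TopologicalSpace P] [ChartedSpace (EuclideanSpace ℝ (Fin k)) P]
  [TopologicalSpace M] [ChartedSpace (EuclideanSpace ℝ (Fin m)) M]

namespace PrincipalBundle

section TrivField

variable {ι κ : Type*} {Q : PrincipalBundle n k m G P M} {U : Set M} {s : M → P} {τ : P → G}

variable (Q s τ) in
/-- The fields on `P` defined by a local trivialization with section `s` and fibre coordinate `τ`: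
the lifts of the vector fields `V j` on `M` and the right-invariant vertical fields given by the
elements `ξ a` of the Lie algebra. -/
def trivField (V : ι → ∀ x : M, TangentSpace (𝓡 m) x) (ξ : κ → LieAlg n G) :
    ι ⊕ κ → ∀ p : P, TangentSpace (𝓡 k) p :=
  Sum.elim (fun j p => Q.lift s τ p (V j (Q.proj p))) fun a p => Q.fund (Ad n (τ p)⁻¹ (ξ a)) p

variable [LieGroup (𝓡 n) ∞ G] (ht : IsLocalTriv (n := n) (k := k) (m := m) Q.proj Q.act U s τ)
  {V : ι → ∀ x : M, TangentSpace (𝓡 m) x} {ξ : κ → LieAlg n G}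

include ht

theorem dR_trivField {p : P} (hp : Q.proj p ∈ U) (g : G) (j : ι ⊕ κ) :
    Q.dR g p (Q.trivField s τ V ξ j p) = Q.trivField s τ V ξ j (Q.act p g) := by
  rcases j with j | a
  · refine (dR_lift ht hp g _).trans ?_
    change Q.lift s τ (Q.act p g) (V j (Q.proj p)) =
      Q.lift s τ (Q.act p g) (V j (Q.proj (Q.act p g)))
    rw [Q.proj_act]
  · change Q.dR g p (Q.fund _ p) = Q.fund (Ad n (τ (Q.act p g))⁻¹ (ξ a)) _
    rw [Q.dR_fund, ht.fibre_act_mul hp, mul_inv_rev, Ad_mul]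
    rfl

theorem exists_basis_eq_trivField {p : P} (hp : Q.proj p ∈ U)
    (v : Module.Basis ι ℝ (TangentSpace (𝓡 m) (Q.proj p))) (b : Module.Basis κ ℝ (LieAlg n G))
    (hv : ∀ j, v j = V j (Q.proj p)) :
    ∃ e : Module.Basis (ι ⊕ κ) ℝ (TangentSpace (𝓡 k) p), ∀ j, e j = Q.trivField s τ V b j p := by
  let Φ : TangentSpace (𝓡 m) (Q.proj p) × LieAlg n G →ₗ[ℝ] TangentSpace (𝓡 k) p :=
    (Q.lift s τ p).coprod (Q.fundLin p ∘ₗ Ad n (τ p)⁻¹)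
  have hΦ : Function.Bijective Φ := by
    refine ⟨(injective_iff_map_eq_zero Φ).2 ?_, fun Y => ?_⟩
    · rintro ⟨u, η⟩ (h : Q.lift s τ p u + Q.fundLin p (Ad n (τ p)⁻¹ η) = 0)
      have hu : u = 0 := by
        have hproj := congrArg (Q.dproj p) h
        rwa [map_add, dproj_lift ht hp, fundLin_apply, dproj_fund, add_zero, map_zero] at hproj
      rw [hu, map_zero, zero_add] at h
      have hη := (injective_iff_map_eq_zero _).1 (fund_injective_of_isLocalTriv ht hp) _ h
      rw [hu, ← Ad_apply_Ad_inv (τ p) η, hη, map_zero, Prod.mk_zero_zero]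
    · obtain ⟨η, hη⟩ := exists_eq_lift_add_fund ht hp Y
      refine ⟨(Q.dproj p Y, Ad n (τ p) η), ?_⟩
      simp only [Φ, LinearMap.coprod_apply, LinearMap.comp_apply, Ad_inv_apply_Ad, fundLin_apply,
        ← hη]
  refine ⟨(v.prod b).map (LinearEquiv.ofBijective Φ hΦ), ?_⟩
  rintro (j | a)
  · simp [Φ, trivField, hv]
  · simp [Φ, trivField, fundLin_apply]

variable [IsManifold (𝓡 k) ∞ P]

theorem contMDiffAt_trivField [IsManifold (𝓡 m) ∞ M] {W : Set M}
    (hV : IsLocalFrameOn (𝓡 m) (EuclideanSpace ℝ (Fin m)) ∞ V W) (hW : IsOpen W) {p : P}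
    (hpU : Q.proj p ∈ U) (hpW : Q.proj p ∈ W) (j : ι ⊕ κ) :
    ContMDiffAt (𝓡 k) (𝓡 k).tangent ∞
      (fun q => (⟨q, Q.trivField s τ V ξ j q⟩ : TangentBundle (𝓡 k) P)) p := by
  rcases j with j | a
  · exact contMDiffAt_lift ht hpU
      (ContMDiffAt.comp p (hV.contMDiffAt hW hpW j) (Q.smooth_proj p))
  · exact Q.contMDiffAt_fund fun l => ContMDiffAt.comp p (g := fun h => l (Ad n h (ξ a)))
      (smoothInto_Ad (ξ a) l (τ p)⁻¹) (ht.contMDiffAt_fibre hpU).inv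

theorem isLocalFrameOn_trivField [IsManifold (𝓡 m) ∞ M] {W : Set M}
    (hV : IsLocalFrameOn (𝓡 m) (EuclideanSpace ℝ (Fin m)) ∞ V W) (hW : IsOpen W)
    (b : Module.Basis κ ℝ (LieAlg n G)) :
    IsLocalFrameOn (𝓡 k) (EuclideanSpace ℝ (Fin k)) ∞ (Q.trivField s τ V b)
      (Q.proj ⁻¹' (U ∩ W)) where
  linearIndependent {p} hp := by
    obtain ⟨e, he⟩ := exists_basis_eq_trivField ht hp.1 (hV.toBasisAt hp.2) b
      (hV.toBasisAt_coe hp.2)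
    rw [← funext he]
    exact e.linearIndependent
  generating {p} hp := by
    obtain ⟨e, he⟩ := exists_basis_eq_trivField ht hp.1 (hV.toBasisAt hp.2) b
      (hV.toBasisAt_coe hp.2)
    rw [← funext he]
    exact e.span_eq.ge
  contMDiffOn j p hp := (contMDiffAt_trivField ht hV hW hp.1 hp.2 j).contMDiffWithinAt

end TrivField

variable {Q : PrincipalBundle n k m G P M}

theorem exists_contMDiff_comp_proj_eq_mul {χ : M → ℝ} (hχ : ContMDiff (𝓡 m) 𝓘(ℝ, ℝ) ∞ χ)
    {W : Set M} (hχW : tsupport χ ⊆ W) {f : P → ℝ}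
    (hf : ∀ p, Q.proj p ∈ W → ContMDiffAt (𝓡 k) 𝓘(ℝ, ℝ) ∞ f p)
    (hinv : ∀ p, Q.proj p ∈ W → ∀ g, f (Q.act p g) = f p) :
    ∃ F : M → ℝ, ContMDiff (𝓡 m) 𝓘(ℝ, ℝ) ∞ F ∧ ∀ p, F (Q.proj p) = χ (Q.proj p) * f p := by
  have hF (p : P) : χ (Q.proj p) * f (Function.surjInv Q.proj_surjective (Q.proj p)) =
      χ (Q.proj p) * f p := by
    by_cases hp : Q.proj p ∈ W
    · obtain ⟨g, hg⟩ := Q.exists_act_eq_of_proj_eq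
        (Function.surjInv_eq Q.proj_surjective (Q.proj p)).symm
      rw [← hg, hinv p hp]
    · rw [eq_zero_of_tsupport_subset hχW hp, zero_mul, zero_mul]
  refine ⟨fun x => χ x * f (Function.surjInv Q.proj_surjective x),
    contMDiff_of_tsupport fun x hx => ?_, hF⟩
  have hxW : x ∈ W := hχW (tsupport_mul_subset_left hx)
  obtain ⟨U, s, τ, hxU, ht⟩ := Q.locally_trivial x
  have hs : ContMDiffAt (𝓡 m) 𝓘(ℝ, ℝ) ∞ (fun y => χ y * f (s y)) x :=
    (hχ x).mul (ContMDiffAt.comp x (hf (s x) (by rwa [ht.proj_section x hxU]))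
      (ht.contMDiffAt_section hxU))
  refine hs.congr_of_eventuallyEq ?_
  filter_upwards [ht.isOpen.mem_nhds hxU] with y hy
  simpa only [ht.proj_section y hy] using hF (s y)

variable [IsManifold (𝓡 k) ∞ P]

variable (Q) in
theorem exists_invField_smul {χ : M → ℝ} (hχ : ContMDiff (𝓡 m) 𝓘(ℝ, ℝ) ∞ χ) {U : Set M}
    (hU : IsOpen U) (hχU : tsupport χ ⊆ U) {Z : ∀ p : P, TangentSpace (𝓡 k) p}
    (hZ : ∀ p, Q.proj p ∈ U → ContMDiffAt (𝓡 k) (𝓡 k).tangent ∞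
      (fun q => (⟨q, Z q⟩ : TangentBundle (𝓡 k) P)) p)
    (hinv : ∀ g p, Q.proj p ∈ U → Q.dR g p (Z p) = Z (Q.act p g)) :
    ∃ X : Q.InvField, ∀ p, X.1 p = χ (Q.proj p) • Z p := by
  have hsupp : tsupport (fun p => χ (Q.proj p)) ⊆ Q.proj ⁻¹' U :=
    (tsupport_comp_subset_preimage χ Q.smooth_proj.continuous).trans (Set.preimage_mono hχU)
  obtain ⟨X, hX⟩ := exists_contMDiffSection_smul (hχ.comp Q.smooth_proj)
    (hU.preimage Q.smooth_proj.continuous) hsupp hZ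
  refine ⟨⟨X, fun g p => ?_⟩, hX⟩
  rw [hX, hX, map_smul]
  change χ (Q.proj p) • _ = χ (Q.proj (Q.act p g)) • _
  rw [Q.proj_act]
  by_cases hp : Q.proj p ∈ U
  · rw [hinv g p hp]
  · rw [eq_zero_of_tsupport_subset hχU hp, zero_smul, zero_smul]

variable (Q) in
theorem exists_invField_mul {f : M → ℝ} (hf : ContMDiff (𝓡 m) 𝓘(ℝ, ℝ) ∞ f) (X : Q.InvField) :
    ∃ Y : Q.InvField, ∀ p, Y.1 p = f (Q.proj p) • X.1 p :=
  Q.exists_invField_smul hf isOpen_univ (Set.subset_univ _) (fun p _ => X.1.contMDiff p)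
    fun g p _ => X.2 g p

variable (Q) in
theorem exists_invFrame [LieGroup (𝓡 n) ∞ G] [IsManifold (𝓡 m) ∞ M] [T2Space M] (x₀ : M) :
    ∃ (W : Set M) (e : Fin m ⊕ Fin n → Q.InvField), IsOpen W ∧ x₀ ∈ W ∧
      IsLocalFrameOn (𝓡 k) (EuclideanSpace ℝ (Fin k)) ∞ (fun j => (e j).1) (Q.proj ⁻¹' W) := by
  obtain ⟨U, s, τ, hx₀, ht⟩ := Q.locally_trivial x₀
  let T := trivializationAt (EuclideanSpace ℝ (Fin m)) (TangentSpace (𝓡 m) : M → Type _) x₀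
  have hV := T.isLocalFrameOn_localFrame_baseSet (𝓡 m) ∞
    (EuclideanSpace.basisFun (Fin m) ℝ).toBasis
  have hx₀' : x₀ ∈ U ∩ T.baseSet := ⟨hx₀, FiberBundle.mem_baseSet_trivializationAt' x₀⟩
  have hUT := ht.isOpen.inter T.open_baseSet
  let b : Module.Basis (Fin n) ℝ (LieAlg n G) := (EuclideanSpace.basisFun (Fin n) ℝ).toBasis
  obtain ⟨χ, hχ, hχU, hχ1⟩ := exists_cutoff (I := 𝓡 m) (hUT.mem_nhds hx₀')
  choose e he using fun j => Q.exists_invField_smul (Z := Q.trivField s τ _ b j) hχ hUT hχU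
    (fun p hp => contMDiffAt_trivField ht hV T.open_baseSet hp.1 hp.2 j)
    fun g p hp => dR_trivField ht hp.1 g j
  obtain ⟨W, hWχ, hW, hxW⟩ := eventually_nhds_iff.1 hχ1
  refine ⟨W ∩ (U ∩ T.baseSet), e, hW.inter hUT, ⟨hxW, hx₀'⟩, ?_⟩
  refine ((isLocalFrameOn_trivField ht hV T.open_baseSet b).mono fun p hp => hp.2).congr
    fun j p hp => ?_
  rw [he, hWχ _ hp.1, one_smul]

theorem invFrame_coeff_dR {ι : Type*} [Finite ι] {e : ι → Q.InvField} {W : Set M}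
    (he : IsLocalFrameOn (𝓡 k) (EuclideanSpace ℝ (Fin k)) ∞ (fun j => (e j).1) (Q.proj ⁻¹' W))
    {p : P} (hp : Q.proj p ∈ W) (g : G) (Y : TangentSpace (𝓡 k) p) (i : ι) :
    he.coeff i (Q.act p g) (Q.dR g p Y) = he.coeff i p Y := by
  cases nonempty_fintype ι
  have hpg : Q.act p g ∈ Q.proj ⁻¹' W := by rwa [Set.mem_preimage, Q.proj_act]
  have hY : Q.dR g p Y = ∑ j, he.coeff j p Y • (e j).1 (Q.act p g) := by
    conv_lhs => rw [← sum_localFrame_coeff_smul he hp Y]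
    rw [map_sum]
    exact Finset.sum_congr rfl fun j _ => by rw [map_smul, (e j).2 g p]
  rw [hY, localFrame_coeff_sum_smul he hpg]

theorem exists_contMDiff_smul_eq_sum_smul_invFrame {ι : Type*} [Fintype ι] {e : ι → Q.InvField}
    {W : Set M} (hW : IsOpen W)
    (he : IsLocalFrameOn (𝓡 k) (EuclideanSpace ℝ (Fin k)) ∞ (fun j => (e j).1) (Q.proj ⁻¹' W))
    {χ : M → ℝ} (hχ : ContMDiff (𝓡 m) 𝓘(ℝ, ℝ) ∞ χ) (hχW : tsupport χ ⊆ W) (X : Q.InvField) :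
    ∃ F : ι → M → ℝ, (∀ j, ContMDiff (𝓡 m) 𝓘(ℝ, ℝ) ∞ (F j)) ∧
      (∀ j p, F j (Q.proj p) = χ (Q.proj p) * he.coeff j p (X.1 p)) ∧
      ∀ p, χ (Q.proj p) • X.1 p = ∑ j, F j (Q.proj p) • (e j).1 p := by
  choose F hF hFX using fun j => exists_contMDiff_comp_proj_eq_mul hχ hχW
    (f := fun p => he.coeff j p (X.1 p)) (fun p hp => contMDiffAt_localFrame_coeff he
      (hW.preimage Q.smooth_proj.continuous) hp (X.1.contMDiff p) j)
    fun p hp g => by rw [← X.2 g p, invFrame_coeff_dR he hp]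
  refine ⟨F, hF, hFX, fun p => ?_⟩
  simp only [hFX, mul_smul, ← Finset.smul_sum]
  by_cases hp : Q.proj p ∈ W
  · rw [sum_localFrame_coeff_smul he hp]
  · rw [eq_zero_of_tsupport_subset hχW hp, zero_smul, zero_smul]

end PrincipalBundle

end InvariantFrame

/-! ### Forms of the Atiyah Lie algebroid at a point -/

section Pointwise

variable {n k m : ℕ} {G P M : Type*}
  [TopologicalSpace G] [ChartedSpace (EuclideanSpace ℝ (Fin n)) G] [Group G]
  [TopologicalSpace P] [ChartedSpace (EuclideanSpace ℝ (Fin k)) P] [IsManifold (𝓡 k) ∞ P]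
  [TopologicalSpace M] [ChartedSpace (EuclideanSpace ℝ (Fin m)) M] {𝕜 : Type*} [RCLike 𝕜]

namespace PrincipalBundle

variable {Q : PrincipalBundle n k m G P M} {q : ℕ}

variable (Q) in
/-- The evaluation `X ↦ X_p` of invariant vector fields. -/
def evalField (p : P) : Q.InvField →ₗ[ℝ] TangentSpace (𝓡 k) p where
  toFun X := X.1 p
  map_add' _ _ := rfl
  map_smul' _ _ := rfl

variable (Q 𝕜) in
/-- The evaluation `v ↦ v(p)` of equivariant maps. -/
def evalMap (p : P) : Q.EquivMap 𝕜 →ₗ[ℝ] LieAlgK n G 𝕜 where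
  toFun v := v.1 p
  map_add' _ _ := rfl
  map_smul' _ _ := rfl

variable [LieGroup (𝓡 n) ∞ G] [IsManifold (𝓡 m) ∞ M] [T2Space M]

theorem LieForm.apply_eq_zero (w : Q.LieForm 𝕜 q) (X : Fin q → Q.InvField) (i : Fin q) {p : P}
    (h : (X i).1 p = 0) : (w.1 X).1 p = 0 := by
  obtain ⟨W, e, hW, hpW, he⟩ := Q.exists_invFrame (Q.proj p)
  obtain ⟨χ, hχ, hχW, hχ1⟩ := exists_cutoff (I := 𝓡 m) (hW.mem_nhds hpW)
  obtain ⟨F, hF, hFX, hsum⟩ := exists_contMDiff_smul_eq_sum_smul_invFrame hW he hχ hχW (X i)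
  obtain ⟨Y, hY⟩ := Q.exists_invField_mul hχ (X i)
  choose E hE using fun j => Q.exists_invField_mul (hF j) (e j)
  have hYE : Y = ∑ j, E j := by
    refine Subtype.ext (ContMDiffSection.ext fun r => ?_)
    calc Y.1 r = ∑ j, (E j).1 r := by
          rw [hY, hsum]
          exact (Finset.sum_congr rfl fun j _ => hE j r).symm
      _ = (∑ j, E j).1 r := (map_sum (Q.evalField r) E Finset.univ).symm
  have hterm (j : Fin m ⊕ Fin n) : (w.1 (Function.update X i (E j))).1 p = 0 := by
    have hj := w.2 _ (hF j) (Function.update X i (e j)) i (E j)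
      (fun r => by rw [hE j r, Function.update_self]) p
    rw [Function.update_idem] at hj
    rw [hj, hFX, h, map_zero, mul_zero, zero_smul]
  have hYX := w.2 χ hχ X i Y hY p
  rw [hχ1.self_of_nhds, one_smul] at hYX
  rw [← hYX, hYE, AlternatingMap.map_update_sum]
  exact (map_sum (Q.evalMap 𝕜 p) _ Finset.univ).trans (Finset.sum_eq_zero fun j _ => hterm j)

variable (Q) in
theorem evalField_surjective (p : P) : Function.Surjective (Q.evalField p) := by
  intro Y
  obtain ⟨W, e, -, hpW, he⟩ := Q.exists_invFrame (Q.proj p)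
  refine ⟨∑ j, he.coeff j p Y • e j, ?_⟩
  rw [map_sum]
  refine Eq.trans ?_ (sum_localFrame_coeff_smul he hpW Y)
  exact Finset.sum_congr rfl fun j _ => map_smul _ _ _

variable (Q) in
/-- A linear choice of invariant vector fields with prescribed values at `p`. -/
def extendField (p : P) : TangentSpace (𝓡 k) p →ₗ[ℝ] Q.InvField :=
  ((Q.evalField p).exists_rightInverse_of_surjective
    (LinearMap.range_eq_top.2 (Q.evalField_surjective p))).choose

theorem extendField_apply (p : P) (Y : TangentSpace (𝓡 k) p) : (Q.extendField p Y).1 p = Y :=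
  LinearMap.congr_fun ((Q.evalField p).exists_rightInverse_of_surjective
    (LinearMap.range_eq_top.2 (Q.evalField_surjective p))).choose_spec Y

namespace LieForm

/-- The alternating form on `T_p P` given by the values at `p` of a form of the Atiyah Lie
algebroid. -/
def pointForm (w : Q.LieForm 𝕜 q) (p : P) : TangentSpace (𝓡 k) p [⋀^Fin q]→ₗ[ℝ] LieAlgK n G 𝕜 :=
  (Q.evalMap 𝕜 p).compAlternatingMap (w.1.compLinearMap (Q.extendField p))

theorem pointForm_apply (w : Q.LieForm 𝕜 q) (p : P) (X : Fin q → Q.InvField)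
    {Y : Fin q → TangentSpace (𝓡 k) p} (h : ∀ i, (X i).1 p = Y i) :
    pointForm w p Y = (w.1 X).1 p := by
  refine multilinear_eq_of_sub_mem ((Q.evalMap 𝕜 p).compMultilinearMap w.1.toMultilinearMap)
    (LinearMap.ker (Q.evalField p)) (fun v i hi => apply_eq_zero w v i hi)
    (v := fun i => Q.extendField p (Y i)) (w := X) fun i => ?_
  rw [LinearMap.mem_ker, map_sub, sub_eq_zero]
  exact (extendField_apply p (Y i)).trans (h i).symm

theorem pointForm_dR (w : Q.LieForm 𝕜 q) (g : G) (p : P) (Y : Fin q → TangentSpace (𝓡 k) p) :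
    pointForm w (Q.act p g) (fun i => Q.dR g p (Y i)) = AdK n 𝕜 g⁻¹ (pointForm w p Y) := by
  have hY (i : Fin q) : (Q.extendField p (Y i)).1 (Q.act p g) = Q.dR g p (Y i) := by
    rw [← (Q.extendField p (Y i)).2 g p, extendField_apply]
  rw [pointForm_apply w (Q.act p g) (fun i => Q.extendField p (Y i)) hY]
  exact (w.1 fun i => Q.extendField p (Y i)).2.2 g p

theorem smoothInto_pointForm (w : Q.LieForm 𝕜 q) (Z : Fin q → VF k P) :
    SmoothInto k (fun p => pointForm w p (fun i => Z i p)) := by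
  refine smoothInto_iff_forall.2 fun p => ?_
  obtain ⟨W, e, hW, hpW, he⟩ := Q.exists_invFrame (Q.proj p)
  have hW' : IsOpen (Q.proj ⁻¹' W) := hW.preimage Q.smooth_proj.continuous
  refine smoothIntoAt_multilinear (fun p => (pointForm w p).toMultilinearMap)
    (Z := fun i p => Z i p) (e := fun j p => (e j).1 p) (c := fun i j p => he.coeff j p (Z i p))
    (fun i j => contMDiffAt_localFrame_coeff he hW' hpW ((Z i).contMDiff p) j) (fun J => ?_) ?_
  · exact (smoothInto_iff_forall.1 (w.1 fun i => e (J i)).2.1 p).congr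
      (.of_forall fun r => pointForm_apply w r (fun i => e (J i)) fun i => rfl)
  · filter_upwards [hW'.mem_nhds hpW] with r hr i using
      (sum_localFrame_coeff_smul he hr (Z i r)).symm

/-- The value at `p` of the basic form on `TP ⊕ (P × 𝔤)` which corresponds to a form of the Atiyah
Lie algebroid: horizontality prescribes it on `Y ⊕ ξ = (Y - ξ^P) ⊕ 0 + ξ^P ⊕ ξ`. -/
def basicForm (w : Q.LieForm 𝕜 q) (p : P) :
    (TangentSpace (𝓡 k) p × LieAlg n G) [⋀^Fin q]→ₗ[ℝ] LieAlgK n G 𝕜 :=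
  (pointForm w p).compLinearMap
    (LinearMap.fst ℝ (TangentSpace (𝓡 k) p) (LieAlg n G) -
      Q.fundLin p ∘ₗ LinearMap.snd ℝ (TangentSpace (𝓡 k) p) (LieAlg n G))

theorem basicForm_eq_pointForm (w : Q.LieForm 𝕜 q) (p : P)
    (v : Fin q → TangentSpace (𝓡 k) p × LieAlg n G) :
    basicForm w p v = pointForm w p (fun i => (v i).1 - Q.fund (v i).2 p) := rfl

theorem basicForm_apply (w : Q.LieForm 𝕜 q) (p : P) (X : Fin q → Q.InvField)
    {v : Fin q → TangentSpace (𝓡 k) p × LieAlg n G}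
    (h : ∀ i, (X i).1 p = (v i).1 - Q.fund (v i).2 p) : basicForm w p v = (w.1 X).1 p :=
  pointForm_apply w p X h

theorem basicForm_dR (w : Q.LieForm 𝕜 q) (g : G) (p : P)
    (v : Fin q → TangentSpace (𝓡 k) p × LieAlg n G) :
    basicForm w (Q.act p g) (fun i => (Q.dR g p (v i).1, Ad n g⁻¹ (v i).2)) =
      AdK n 𝕜 g⁻¹ (basicForm w p v) := by
  rw [basicForm_eq_pointForm, basicForm_eq_pointForm, ← pointForm_dR]
  congr 1
  funext i
  rw [map_sub, Q.dR_fund]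

theorem smoothInto_basicForm (w : Q.LieForm 𝕜 q) (Y : Fin q → VF k P)
    {c : Fin q → P → LieAlg n G} (hc : ∀ i, SmoothInto k (c i)) :
    SmoothInto k (fun p => basicForm w p (fun i => (Y i p, c i p))) :=
  smoothInto_pointForm w fun i => ⟨_, (Y i).contMDiff.sub_section fun p =>
    Q.contMDiffAt_fund (smoothInto_iff_forall.1 (hc i) p)⟩

end LieForm

/-- The inclusion `Ω_Lie(P, 𝔤) ↪ Ω_TLA(P, 𝔤)`. -/
def inclusion (q : ℕ) : Q.LieForm 𝕜 q →ₗ[𝕜] TLAForm n k G P 𝕜 q where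
  toFun w := ⟨fun p => LieForm.basicForm w p, fun Y _ hc => LieForm.smoothInto_basicForm w Y hc⟩
  map_add' _ _ := rfl
  map_smul' _ _ := rfl

end PrincipalBundle

end Pointwise

/-! ### Invariance and equivariance -/

section Invariance

variable {n k m : ℕ} {G P M : Type*}
  [TopologicalSpace G] [ChartedSpace (EuclideanSpace ℝ (Fin n)) G] [Group G]
  [TopologicalSpace P] [ChartedSpace (EuclideanSpace ℝ (Fin k)) P]
  [TopologicalSpace M] [ChartedSpace (EuclideanSpace ℝ (Fin m)) M] {𝕜 : Type*} [RCLike 𝕜]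

theorem dirDeriv_const {V : Type*} [AddCommGroup V] [Module ℝ V] [Module.Finite ℝ V] (u : V)
    (p : P) (v : TangentSpace (𝓡 k) p) : dirDeriv (k := k) (fun _ : P => u) p v = 0 := by
  simp [dirDeriv, mfderiv_const]

namespace PrincipalBundle

section Translate

variable (Q : PrincipalBundle n k m G P M)

/-- The value at `p` of the translate by `g` of the section `Y ⊕ c` of `TP ⊕ (P × 𝔤)`, for the
action of `G` through `R_g` and `Ad`. -/
def translate (g : G) (Y : ∀ p : P, TangentSpace (𝓡 k) p) (c : P → LieAlg n G) (p : P) :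
    EuclideanSpace ℝ (Fin k) × LieAlg n G :=
  (Q.dR g⁻¹ (Q.act p g) (Y (Q.act p g)), Ad n g (c (Q.act p g)))

theorem dR_translate (g : G) (Y : ∀ p : P, TangentSpace (𝓡 k) p) (c : P → LieAlg n G) (p : P) :
    Q.dR g p (Q.translate g Y c p).1 = Y (Q.act p g) :=
  (modelDeriv_comp (E₁ := EuclideanSpace ℝ (Fin k)) (h := fun q => q)
    (Q.mdifferentiable_act_right g p) (Q.mdifferentiable_act_right g⁻¹ (Q.act p g))
    (Q.act_act_inv p g) (.of_forall fun a => (Q.act_inv_act a g).symm) _).symm.trans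
    (modelDeriv_id (E₁ := EuclideanSpace ℝ (Fin k)) _ (Y (Q.act p g)))

theorem translate_one (Y : ∀ p : P, TangentSpace (𝓡 k) p) (c : P → LieAlg n G) (p : P) :
    Q.translate 1 Y c p = (Y p, c p) := by
  have hact : (fun q => Q.act q (1 : G)) = id := funext Q.act_one
  have hdR (v : EuclideanSpace ℝ (Fin k)) : (Q.dR 1 p v : EuclideanSpace ℝ (Fin k)) = v :=
    (congrArg (fun f => modelDeriv (𝓡 k) (𝓡 k) f p v) hact).trans (modelDeriv_id p v)
  refine Prod.ext ?_ ?_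
  · refine (hdR _).symm.trans ((Q.dR_translate 1 Y c p).trans ?_)
    exact congrArg (fun q => (Y q : EuclideanSpace ℝ (Fin k))) (Q.act_one p)
  · change Ad n 1 (c (Q.act p 1)) = c p
    rw [Q.act_one, Ad_one]
    rfl

theorem act_curve_zero (ξ : LieAlg n G) (p : P) : Q.act p (curve ξ 0) = p := by
  rw [curve_zero, Q.act_one]

variable [LieGroup (𝓡 n) ∞ G]

theorem Ad_inv_translate (g : G) (Y : ∀ p : P, TangentSpace (𝓡 k) p) (c : P → LieAlg n G) (p : P) :
    Ad n g⁻¹ (Q.translate g Y c p).2 = c (Q.act p g) :=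
  Ad_inv_apply_Ad g _

theorem modelDeriv_act_curve (ξ : LieAlg n G) (p : P) :
    modelDeriv 𝓘(ℝ, ℝ) (𝓡 k) (fun t => Q.act p (curve ξ t)) 0 1 = Q.fund ξ p :=
  modelDeriv_comp_curve (Q.mdifferentiable_act_left p 1) ξ fun _ => rfl

theorem hasWeakDerivAt_act_curve (ξ : LieAlg n G) {V : Type*} [AddCommGroup V] [Module ℝ V]
    [Module.Finite ℝ V] {f : P → V} {p : P} (hf : SmoothIntoAt k f p) :
    HasWeakDerivAt (fun t => f (Q.act p (curve ξ t))) (dirDeriv (k := k) f p (Q.fund ξ p)) 0 :=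
  hasWeakDerivAt_dirDeriv hf
    (MDifferentiableAt.comp (0 : ℝ) (Q.mdifferentiable_act_left p _)
      ((contMDiffAt_curve ξ).mdifferentiableAt (by simp)))
    (Q.act_curve_zero ξ p) (Q.modelDeriv_act_curve ξ p)

theorem hasWeakDerivAt_AdK_act_curve (ξ : LieAlg n G) {f : P → LieAlgK n G 𝕜} {p : P}
    (hf : SmoothIntoAt k f p) :
    HasWeakDerivAt (fun t => AdK n 𝕜 (curve ξ t) (f (Q.act p (curve ξ t))))
      (dirDeriv (k := k) f p (Q.fund ξ p) + adK n 𝕜 ξ (f p)) 0 := by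
  have h := HasWeakDerivAt.apply_operator (ρ := fun t => (AdK n 𝕜 (curve ξ t)).restrictScalars ℝ)
    (D := (adK n 𝕜 ξ).restrictScalars ℝ) (fun v => hasWeakDerivAt_AdK_curve 𝕜 ξ v)
    (Q.hasWeakDerivAt_act_curve ξ hf)
  simp only [curve_zero, Q.act_one, AdK_one] at h
  exact h

theorem hasWeakDerivAt_Ad_act_curve (ξ : LieAlg n G) {f : P → LieAlg n G} {p : P}
    (hf : SmoothIntoAt k f p) :
    HasWeakDerivAt (fun t => Ad n (curve ξ t) (f (Q.act p (curve ξ t))))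
      (dirDeriv (k := k) f p (Q.fund ξ p) + ⁅ξ, f p⁆) 0 := by
  have h := HasWeakDerivAt.apply_operator (ρ := fun t => Ad n (curve ξ t))
    (D := LieAlgebra.ad ℝ (LieAlg n G) ξ) (fun v => hasWeakDerivAt_Ad_curve ξ v)
    (Q.hasWeakDerivAt_act_curve ξ hf)
  simp only [curve_zero, Q.act_one, Ad_one] at h
  exact h

variable [IsManifold (𝓡 k) ∞ P]

theorem hasDerivAt_mlieBracket_fund (ξ : LieAlg n G) (Y : VF k P) (p : P)
    {Z : ℝ → EuclideanSpace ℝ (Fin k)}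
    (hZ : ∀ t, Q.dR (curve ξ t) p (Z t) = Y (Q.act p (curve ξ t))) :
    HasDerivAt Z (mlieBracket (𝓡 k) (Q.fund ξ) Y p : EuclideanSpace ℝ (Fin k)) 0 := by
  have hflow : ContMDiffAt ((𝓡 k).prod 𝓘(ℝ, ℝ)) (𝓡 k) 2
      (fun z : P × ℝ => Q.act z.1 (curve (G := G) ξ z.2)) (p, 0) :=
    (ContMDiffAt.comp ((p, 0) : P × ℝ) (Q.smooth_act (p, curve ξ 0)) (contMDiffAt_fst.prodMk
      (ContMDiffAt.comp ((p, 0) : P × ℝ) (contMDiffAt_curve ξ) contMDiffAt_snd))).of_le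
      (WithTop.coe_le_coe.mpr (le_top : (2 : ℕ∞) ≤ ⊤))
  exact hasDerivAt_mlieBracket hflow (.of_forall (Q.act_curve_zero ξ))
    (.of_forall (Q.modelDeriv_act_curve ξ)) (Y.contMDiff.mdifferentiable (by simp) p)
    (.of_forall hZ)

theorem mlieBracket_fund_invField (ξ : LieAlg n G) (X : Q.InvField) (p : P) :
    mlieBracket (𝓡 k) (Q.fund ξ) X.1 p = 0 :=
  (Q.hasDerivAt_mlieBracket_fund ξ X.1 p (Z := fun _ => X.1 p) fun _ => X.2 _ p).unique
    (hasDerivAt_const (0 : ℝ) _)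

theorem hasWeakDerivAt_translate (ξ : LieAlg n G) (Y : VF k P) {c : P → LieAlg n G} {p : P}
    (hc : SmoothIntoAt k c p) :
    HasWeakDerivAt (fun t => Q.translate (curve ξ t) Y c p)
      (tlaBracket (Q.fund ξ) Y (fun _ => ξ) c p) 0 := by
  have hbracket : tlaBracket (Q.fund ξ) Y (fun _ => ξ) c p =
      (mlieBracket (𝓡 k) (Q.fund ξ) Y p, dirDeriv (k := k) c p (Q.fund ξ p) + ⁅ξ, c p⁆) := by
    rw [tlaBracket, dirDeriv_const, sub_zero]
  rw [hbracket]
  exact (hasWeakDerivAt_iff_hasDerivAt.2 (Q.hasDerivAt_mlieBracket_fund ξ Y p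
    fun t => Q.dR_translate (curve ξ t) Y c p)).prodMk (Q.hasWeakDerivAt_Ad_act_curve ξ hc)

theorem lieDeriv_eq_zero {q : ℕ} (w : TLAForm n k G P 𝕜 q)
    (hw : ∀ g p (v : Fin q → TangentSpace (𝓡 k) p × LieAlg n G),
      w.1 (Q.act p g) (fun i => (Q.dR g p (v i).1, Ad n g⁻¹ (v i).2)) = AdK n 𝕜 g⁻¹ (w.1 p v))
    (ξ : LieAlg n G) (Y : Fin q → VF k P) (c : Fin q → P → LieAlg n G)
    (hc : ∀ i, SmoothInto k (c i)) (p : P) : Q.lieDeriv ξ w Y c p = 0 := by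
  have hfin : Module.Finite ℝ (EuclideanSpace ℝ (Fin k) × LieAlg n G) :=
    inferInstanceAs (Module.Finite ℝ (EuclideanSpace ℝ (Fin k) × EuclideanSpace ℝ (Fin n)))
  let f : MultilinearMap ℝ (fun _ : Fin q => EuclideanSpace ℝ (Fin k) × LieAlg n G)
    (LieAlgK n G 𝕜) := (w.1 p).toMultilinearMap
  have hequiv (g : G) : AdK n 𝕜 g (w.1 (Q.act p g) fun i => (Y i (Q.act p g), c i (Q.act p g))) =
      f fun i => Q.translate g (Y i) (c i) p := by
    rw [← AdK_apply_AdK_inv 𝕜 g (f fun i => Q.translate g (Y i) (c i) p)]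
    refine congrArg (AdK n 𝕜 g) (Eq.trans ?_ (hw g p fun i => Q.translate g (Y i) (c i) p))
    simp only [dR_translate, Ad_inv_translate]
  have hleft := Q.hasWeakDerivAt_AdK_act_curve ξ ((w.2 Y c hc).smoothIntoAt p)
  have hright := HasWeakDerivAt.multilinear f fun i =>
    Q.hasWeakDerivAt_translate ξ (Y i) ((hc i).smoothIntoAt p)
  simp only [curve_zero, translate_one] at hright
  rw [lieDeriv, sub_eq_zero]
  exact hleft.unique (hright.congr (.of_forall fun t => hequiv (curve ξ t)))

end Translate

section Equivariance

variable {Q : PrincipalBundle n k m G P M} [LieGroup (𝓡 n) ∞ G]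

theorem apply_act_of_dirDeriv_fund [PreconnectedSpace G] {f : P → LieAlgK n G 𝕜}
    (hf : SmoothInto k f)
    (hderiv : ∀ ξ p, dirDeriv (k := k) f p (Q.fund ξ p) + adK n 𝕜 ξ (f p) = 0) (g : G) (p : P) :
    f (Q.act p g) = AdK n 𝕜 g⁻¹ (f p) := by
  suffices hconst : AdK n 𝕜 g (f (Q.act p g)) = f p by rw [← hconst, AdK_inv_apply_AdK]
  rw [← sub_eq_zero, ← Module.forall_dual_apply_eq_zero_iff ℝ]
  intro l
  have hsmooth : ContMDiff (𝓡 n) 𝓘(ℝ, ℝ) ∞ (fun g : G => l (AdK n 𝕜 g (f (Q.act p g)))) :=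
    fun g => SmoothIntoAt.apply_operator (ρ := fun g => (AdK n 𝕜 g).restrictScalars ℝ)
      (f := fun g => f (Q.act p g)) (fun v => (smoothInto_AdK 𝕜 v).smoothIntoAt g)
      (fun l' => ContMDiffAt.comp g (g := fun p => l' (f p)) (hf l' _)
        (Q.smooth_act.comp (contMDiff_const.prodMk contMDiff_id) g)) l
  have heq := apply_eq_of_hasDerivAt_mul_curve (hsmooth.mdifferentiable (by simp))
    (fun g ξ => ?_) g 1
  · rw [map_sub, heq, AdK_one, Q.act_one, LinearMap.id_apply, sub_self]
  have hzero := (Q.hasWeakDerivAt_AdK_act_curve ξ (hf.smoothIntoAt (Q.act p g))).map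
    ((AdK n 𝕜 g).restrictScalars ℝ)
  rw [hderiv, map_zero] at hzero
  simp only [AdK_mul_apply, Q.act_mul]
  have hzero_l := hzero l
  rw [map_zero] at hzero_l
  exact hzero_l

variable [IsManifold (𝓡 k) ∞ P]

theorem IsBasic.dirDeriv_apply_invField {q : ℕ} {w : TLAForm n k G P 𝕜 q} (hw : Q.IsBasic w)
    (X : Fin q → Q.InvField) (ξ : LieAlg n G) (p : P) :
    dirDeriv (k := k) (fun r => w.1 r fun i => ((X i).1 r, 0)) p (Q.fund ξ p) +
      adK n 𝕜 ξ (w.1 p fun i => ((X i).1 p, 0)) = 0 := by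
  have hinv := hw.invariant ξ (fun i => (X i).1) (fun _ _ => 0) (fun _ => SmoothInto.zero) p
  rw [lieDeriv, Finset.sum_eq_zero, sub_zero] at hinv
  · exact hinv
  · intro j _
    refine (w.1 p).map_coord_zero j ?_
    rw [Function.update_self, tlaBracket, mlieBracket_fund_invField, dirDeriv_const,
      dirDeriv_const, lie_zero, sub_zero, add_zero]
    rfl

theorem IsBasic.apply_invField_act [PreconnectedSpace G] {q : ℕ} {w : TLAForm n k G P 𝕜 q}
    (hw : Q.IsBasic w) (X : Fin q → Q.InvField) (g : G) (p : P) :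
    w.1 (Q.act p g) (fun i => ((X i).1 (Q.act p g), 0)) =
      AdK n 𝕜 g⁻¹ (w.1 p (fun i => ((X i).1 p, 0))) :=
  apply_act_of_dirDeriv_fund
    (w.2 (fun i => (X i).1) (fun _ _ => 0) fun _ => SmoothInto.zero)
    (hw.dirDeriv_apply_invField X) g p

theorem IsBasic.apply_eq {q : ℕ} {w : TLAForm n k G P 𝕜 q} (hw : Q.IsBasic w) (p : P)
    (v : Fin q → TangentSpace (𝓡 k) p × LieAlg n G) :
    w.1 p v = w.1 p (fun i => ((v i).1 - Q.fund (v i).2 p, 0)) := by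
  refine multilinear_eq_of_sub_mem (w.1 p).toMultilinearMap
    (LinearMap.range ((Q.fundLin p).prod LinearMap.id)) ?_ fun i => ?_
  · rintro u i ⟨ξ, hξ⟩
    exact hw.horizontal ξ p u i hξ.symm
  · exact ⟨(v i).2, Prod.ext (sub_sub_cancel _ _).symm (sub_zero _).symm⟩

end Equivariance

end PrincipalBundle

end Invariance

section Inclusion

variable {n k m : ℕ} {G P M : Type*}
  [TopologicalSpace G] [ChartedSpace (EuclideanSpace ℝ (Fin n)) G] [Group G]
  [LieGroup (𝓡 n) ∞ G]
  [TopologicalSpace P] [ChartedSpace (EuclideanSpace ℝ (Fin k)) P] [IsManifold (𝓡 k) ∞ P]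
  [TopologicalSpace M] [ChartedSpace (EuclideanSpace ℝ (Fin m)) M]

namespace PrincipalBundle

variable {Q : PrincipalBundle n k m G P M} {𝕜 : Type*} [RCLike 𝕜] {q : ℕ}

/-- The restriction `(X₁, …, X_q) ↦ w(X₁ ⊕ 0, …, X_q ⊕ 0)` of a form on the trivial Lie algebroid
to the Atiyah Lie algebroid, for a form whose restriction takes values in the equivariant maps. -/
def restrictInvField (w : TLAForm n k G P 𝕜 q)
    (hw : ∀ (X : Fin q → Q.InvField) g p, w.1 (Q.act p g) (fun i => ((X i).1 (Q.act p g), 0)) =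
      AdK n 𝕜 g⁻¹ (w.1 p (fun i => ((X i).1 p, 0)))) : Q.LieForm 𝕜 q :=
  let lift₀ (p : P) : Q.InvField →ₗ[ℝ] TangentSpace (𝓡 k) p × LieAlg n G :=
    LinearMap.inl ℝ (TangentSpace (𝓡 k) p) (LieAlg n G) ∘ₗ Q.evalField p
  let R (p : P) : Q.InvField [⋀^Fin q]→ₗ[ℝ] LieAlgK n G 𝕜 := (w.1 p).compLinearMap (lift₀ p)
  ⟨{  toFun := fun X => ⟨fun p => R p X,
        w.2 (fun i => (X i).1) (fun _ _ => 0) fun _ => SmoothInto.zero, hw X⟩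
      map_update_add' := fun X i a c => Subtype.ext (funext fun p => (R p).map_update_add' X i a c)
      map_update_smul' := fun X i a c =>
        Subtype.ext (funext fun p => (R p).map_update_smul' X i a c)
      map_eq_zero_of_eq' := fun X i j h hij =>
        Subtype.ext (funext fun p => (R p).map_eq_zero_of_eq' X i j h hij) }, by
    intro f _ X i Y hY p
    have hlift : lift₀ p Y = f (Q.proj p) • lift₀ p (X i) := by
      rw [← map_smul]
      exact Prod.ext (hY p) rfl
    change w.1 p (lift₀ p ∘ Function.update X i Y) = f (Q.proj p) • w.1 p (lift₀ p ∘ X)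
    rw [Function.comp_update, hlift, AlternatingMap.map_update_smul]
    exact congrArg (fun v => f (Q.proj p) • w.1 p v) (Function.update_eq_self i (lift₀ p ∘ X))⟩

theorem IsBasic.exists_corresponds [PreconnectedSpace G] {w : TLAForm n k G P 𝕜 q}
    (hw : Q.IsBasic w) : ∃ η : Q.LieForm 𝕜 q, Q.Corresponds w η :=
  ⟨restrictInvField w hw.apply_invField_act, fun _ _ => rfl⟩

variable [IsManifold (𝓡 m) ∞ M] [T2Space M]

theorem isBasic_inclusion (w : Q.LieForm 𝕜 q) : Q.IsBasic (inclusion q w) where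
  horizontal ξ p v i hi := by
    refine (LieForm.pointForm w p).map_coord_zero i ?_
    change (v i).1 - Q.fund (v i).2 p = 0
    rw [hi, sub_self]
  invariant ξ Y c hc p := Q.lieDeriv_eq_zero _ (LieForm.basicForm_dR w) ξ Y c hc p

theorem corresponds_inclusion (w : Q.LieForm 𝕜 q) : Q.Corresponds (inclusion q w) w := by
  intro X p
  refine (LieForm.basicForm_apply w p X fun i => ?_).symm
  change (X i).1 p = (X i).1 p - Q.fundLin p 0
  rw [map_zero, sub_zero]

theorem inclusion_eq_iff (w : Q.LieForm 𝕜 q) (w' : TLAForm n k G P 𝕜 q) :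
    inclusion q w = w' ↔ Q.IsBasic w' ∧ Q.Corresponds w' w := by
  constructor
  · rintro rfl
    exact ⟨isBasic_inclusion w, corresponds_inclusion w⟩
  · rintro ⟨hw, hc⟩
    refine Subtype.ext (funext fun p => AlternatingMap.ext fun v => ?_)
    let X (i : Fin q) : Q.InvField := Q.extendField p ((v i).1 - Q.fund (v i).2 p)
    have hX (i : Fin q) : (X i).1 p = (v i).1 - Q.fund (v i).2 p := extendField_apply p _
    rw [hw.apply_eq p v]
    refine (LieForm.basicForm_apply w p X hX).trans ((hc X p).trans ?_)
    simp only [hX]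

theorem inclusion_injective (q : ℕ) :
    Function.Injective (inclusion q : Q.LieForm 𝕜 q →ₗ[𝕜] TLAForm n k G P 𝕜 q) := by
  intro w η h
  refine Subtype.ext (AlternatingMap.ext fun X => Subtype.ext (funext fun p => ?_))
  rw [corresponds_inclusion w X p, h, ← corresponds_inclusion η X p]

theorem exists_inclusion_eq [PreconnectedSpace G] {w : TLAForm n k G P 𝕜 q} (hw : Q.IsBasic w) :
    ∃ η : Q.LieForm 𝕜 q, inclusion q η = w := by
  obtain ⟨η, hη⟩ := hw.exists_corresponds
  exact ⟨η, (inclusion_eq_iff η w).2 ⟨hw, hη⟩⟩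

end PrincipalBundle

end Inclusion

/-! ### The algebraic integration -/

section AlgIntegral

variable {n k : ℕ} {G P : Type*}
  [TopologicalSpace G] [ChartedSpace (EuclideanSpace ℝ (Fin n)) G] [Group G]
  [TopologicalSpace P] [ChartedSpace (EuclideanSpace ℝ (Fin k)) P] [IsManifold (𝓡 k) ∞ P]
  {𝕜 : Type*} [RCLike 𝕜] {r : ℕ}

theorem smoothInto_innerPart (b : Fin n → LieAlg n G) (w : TLAForm n k G P 𝕜 (r + n))
    (Y : Fin r → VF k P) : SmoothInto k (fun p => innerPart b (w.1 p) fun i => Y i p) := by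
  let Z : Fin (r + n) → VF k P := Fin.append Y fun _ => 0
  let c : Fin (r + n) → P → LieAlg n G := Fin.append (fun _ _ => 0) fun j _ => b j
  have hc (i : Fin (r + n)) : SmoothInto k (c i) := by
    refine Fin.addCases (fun i => ?_) (fun j => ?_) i
    · rw [show c (Fin.castAdd n i) = fun _ => 0 from Fin.append_left _ _ i]
      exact SmoothInto.zero
    · rw [show c (Fin.natAdd r j) = fun _ => b j from Fin.append_right _ _ j]
      exact SmoothInto.const (b j)
  have hZc (p : P) : (fun i => (Z i p, c i p)) =
      Fin.append (fun i => ((Y i p, 0) : TangentSpace (𝓡 k) p × LieAlg n G))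
        fun j => (0, b j) := by
    funext i
    refine Fin.addCases (fun i => ?_) (fun j => ?_) i
    · simp only [Z, c, Fin.append_left]
    · simp only [Z, c, Fin.append_right]
      rfl
  simpa only [hZc, ← innerPart_apply] using w.2 Z c hc

variable [LieGroup (𝓡 n) ∞ G] (b : Module.Basis (Fin n) ℝ (LieAlg n G))

theorem killingVolume_self_ne_zero (hs : LieAlgebra.IsSemisimple ℝ (LieAlg n G)) :
    killingVolume b b ≠ 0 := by
  have hdet := (LinearMap.BilinForm.nondegenerate_iff_det_ne_zero b).1
    (LieAlgebra.IsKilling.killingForm_nondegenerate ℝ (LieAlg n G))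
  have hmatrix : (Matrix.of fun i j => killingForm ℝ (LieAlg n G) (b i) (b j)) =
      LinearMap.BilinForm.toMatrix b (killingForm ℝ (LieAlg n G)) := by
    ext i j
    rw [Matrix.of_apply, LinearMap.BilinForm.toMatrix_apply]
  rw [killingVolume, AlternatingMap.smul_apply, b.det_self, smul_eq_mul, mul_one, hmatrix]
  exact (Real.sqrt_pos.2 (abs_pos.2 hdet)).ne'

/-- The integration `∫_alg : Ω_TLA(P, 𝔤) → Ω(P) ⊗ 𝔤`, which takes the factor of
`√|k| θ¹ ∧ ⋯ ∧ θⁿ`. It is defined for every `G`, with the value `0` where `|k| = 0`. -/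
def algIntegral (r : ℕ) : TLAForm n k G P 𝕜 (r + n) →ₗ[𝕜] VForm n k G P 𝕜 r where
  toFun w := ⟨fun p => (killingVolume b b)⁻¹ • innerPart b (w.1 p), fun Y =>
    smoothInto_iff_forall.2 fun p => SmoothIntoAt.fun_smul contMDiffAt_const
      ((smoothInto_innerPart b w Y).smoothIntoAt p)⟩
  map_add' w w' := Subtype.ext (funext fun p => AlternatingMap.ext fun Y =>
    smul_add (killingVolume b b)⁻¹ (innerPart b (w.1 p) Y) (innerPart b (w'.1 p) Y))
  map_smul' c w := Subtype.ext (funext fun p => AlternatingMap.ext fun Y =>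
    smul_comm (killingVolume b b)⁻¹ c (innerPart b (w.1 p) Y))

theorem algIntegral_apply (w : TLAForm n k G P 𝕜 (r + n)) (p : P)
    (Y : Fin r → TangentSpace (𝓡 k) p) :
    (algIntegral b r w).1 p Y = (killingVolume b b)⁻¹ • innerPart b (w.1 p) Y := rfl

theorem algIntegral_eq_iff (hs : LieAlgebra.IsSemisimple ℝ (LieAlg n G))
    (w : TLAForm n k G P 𝕜 (r + n)) (η : VForm n k G P 𝕜 r) :
    algIntegral b r w = η ↔ IsAlgIntegral b w η := by
  have h0 := killingVolume_self_ne_zero b hs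
  simp only [IsAlgIntegral, innerDegreeLT_sub_wedge_iff b]
  constructor
  · rintro rfl p Y
    rw [algIntegral_apply]
    exact (smul_inv_smul₀ h0 _).symm
  · intro h
    refine Subtype.ext (funext fun p => AlternatingMap.ext fun Y => ?_)
    rw [algIntegral_apply, h p Y]
    exact inv_smul_smul₀ h0 _

end AlgIntegral

/-! ### Tensorial forms -/

section Tensorial

variable {n k m : ℕ} {G P M : Type*}
  [TopologicalSpace G] [ChartedSpace (EuclideanSpace ℝ (Fin n)) G] [Group G]
  [TopologicalSpace P] [ChartedSpace (EuclideanSpace ℝ (Fin k)) P]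
  [TopologicalSpace M] [ChartedSpace (EuclideanSpace ℝ (Fin m)) M]
  {𝕜 : Type*} [RCLike 𝕜] {r : ℕ}

namespace PrincipalBundle

theorem IsTensorial.apply_eq [IsManifold (𝓡 k) ∞ P] {Q : PrincipalBundle n k m G P M}
    {τ : VForm n k G P 𝕜 r} (hτ : Q.IsTensorial τ) {p : P} {Y Y' : Fin r → TangentSpace (𝓡 k) p}
    (h : ∀ i, Q.dproj p (Y i) = Q.dproj p (Y' i)) : τ.1 p Y = τ.1 p Y' :=
  multilinear_eq_of_sub_mem (τ.1 p).toMultilinearMap (LinearMap.ker (Q.dproj p))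
    (fun v i hi => hτ.horizontal p v i hi) fun i => LinearMap.sub_mem_ker_iff.2 (h i)

variable (Q : PrincipalBundle n k m G P M)

/-- A linear right inverse of the differential of the projection at `p`. All the tangent spaces of
`M` are the model space, so that it applies to `T_x M` for `x = π(p)` as well. -/
def dprojSection (p : P) : EuclideanSpace ℝ (Fin m) →ₗ[ℝ] TangentSpace (𝓡 k) p :=
  ((Q.dproj p).exists_rightInverse_of_surjective
    (LinearMap.range_eq_top.2 (Q.dproj_surjective p))).choose

theorem dproj_dprojSection (p : P) (v : EuclideanSpace ℝ (Fin m)) :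
    (Q.dproj p (Q.dprojSection p v) : EuclideanSpace ℝ (Fin m)) = v :=
  LinearMap.congr_fun ((Q.dproj p).exists_rightInverse_of_surjective
    (LinearMap.range_eq_top.2 (Q.dproj_surjective p))).choose_spec v

section BundleForm

variable [IsManifold (𝓡 m) ∞ M]

theorem bundleForm_congr (η : Q.BundleForm 𝕜 r) {x y : M} (h : x = y)
    {v v' : Fin r → EuclideanSpace ℝ (Fin m)} (hv : v = v') (p : P) (hp : Q.proj p = x) :
    (η.1 x v).1 ⟨p, hp⟩ = (η.1 y v').1 ⟨p, hp.trans h⟩ := by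
  subst h hv
  rfl

variable [IsManifold (𝓡 k) ∞ P] [T2Space M]

theorem exists_invField_lift (V : VF m M) (x₀ : M) :
    ∃ X : Q.InvField, ∀ᶠ x in 𝓝 x₀, ∀ p, Q.proj p = x →
      (Q.dproj p (X.1 p) : EuclideanSpace ℝ (Fin m)) = V x := by
  obtain ⟨U, s, τ, hx₀, ht⟩ := Q.locally_trivial x₀
  obtain ⟨χ, hχ, hχU, hχ1⟩ := exists_cutoff (I := 𝓡 m) (ht.isOpen.mem_nhds hx₀)
  obtain ⟨X, hX⟩ := Q.exists_invField_smul (Z := fun p => Q.lift s τ p (V (Q.proj p)))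
    hχ ht.isOpen hχU
    (fun p hp => contMDiffAt_lift ht hp (ContMDiffAt.comp p (V.contMDiff _) (Q.smooth_proj p)))
    fun g p hp => (dR_lift ht hp g _).trans (by rw [Q.proj_act])
  refine ⟨X, ?_⟩
  filter_upwards [hχ1, ht.isOpen.mem_nhds hx₀] with x hχx hx p hp
  subst hp
  rw [hX, hχx, one_smul]
  exact dproj_lift ht hx _

theorem smoothInto_bundleForm_dproj (η : Q.BundleForm 𝕜 r) (Y : Fin r → VF k P) :
    SmoothInto k
      (fun p => (η.1 (Q.proj p) fun i => Q.dproj p (Y i p)).1 ⟨p, rfl⟩) := by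
  refine smoothInto_iff_forall.2 fun p => ?_
  obtain ⟨W, e, hW, hpW, he⟩ := exists_contMDiffSection_isLocalFrameOn
    (I := 𝓡 m) (V := (TangentSpace (𝓡 m) : M → Type _))
    (EuclideanSpace.basisFun (Fin m) ℝ).toBasis (Q.proj p)
  refine smoothIntoAt_multilinear (T := fun q => TangentSpace (𝓡 m) (Q.proj q))
    (fun q => ((Q.evalFibre (Q.proj q) q rfl).compAlternatingMap
      (η.1 (Q.proj q))).toMultilinearMap)
    (Z := fun i q => Q.dproj q (Y i q)) (e := fun j q => e j (Q.proj q))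
    (c := fun i j q => he.coeff j (Q.proj q) (Q.dproj q (Y i q)))
    (fun i j => contMDiffAt_localFrame_coeff he hW hpW
      (Q.contMDiffAt_dproj ((Y i).contMDiff p)) j)
    (fun J => smoothInto_iff_forall.1 (η.2 fun i => e (J i)) p) ?_
  filter_upwards [Q.smooth_proj.continuous.continuousAt.eventually (hW.mem_nhds hpW)]
    with q hq i using (sum_localFrame_coeff_smul he hq _).symm

/-- The inclusion `Ω(M, 𝓛) ↪ Ω(P) ⊗ 𝔤`. -/
def pullback (r : ℕ) : Q.BundleForm 𝕜 r →ₗ[𝕜] VForm n k G P 𝕜 r where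
  toFun η := ⟨fun p => ((Q.evalFibre (Q.proj p) p rfl).compAlternatingMap
    (η.1 (Q.proj p))).compLinearMap (Q.dproj p), Q.smoothInto_bundleForm_dproj η⟩
  map_add' _ _ := rfl
  map_smul' _ _ := rfl

theorem pullback_apply (η : Q.BundleForm 𝕜 r) (p : P) (Y : Fin r → TangentSpace (𝓡 k) p) :
    (Q.pullback r η).1 p Y = (η.1 (Q.proj p) (fun i => Q.dproj p (Y i))).1 ⟨p, rfl⟩ := rfl

theorem pullback_eq_iff (η : Q.BundleForm 𝕜 r) (τ : VForm n k G P 𝕜 r) :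
    Q.pullback r η = τ ↔ Q.IsPullback η τ := by
  constructor
  · rintro rfl p Y
    rfl
  · intro h
    exact Subtype.ext (funext fun p => AlternatingMap.ext fun Y => (h p Y).symm)

theorem pullback_injective (r : ℕ) :
    Function.Injective (Q.pullback r : Q.BundleForm 𝕜 r →ₗ[𝕜] VForm n k G P 𝕜 r) := by
  intro η ζ h
  refine Subtype.ext (funext fun x => AlternatingMap.ext fun v => Subtype.ext (funext ?_))
  rintro ⟨p, rfl⟩
  choose Y hY using fun i => Q.dproj_surjective p (v i)
  obtain rfl : (fun i => Q.dproj p (Y i)) = v := funext hY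
  rw [← Q.pullback_apply, ← Q.pullback_apply, h]

theorem isTensorial_pullback (η : Q.BundleForm 𝕜 r) : Q.IsTensorial (Q.pullback r η) where
  horizontal p Y i hi :=
    ((Q.evalFibre (𝕜 := 𝕜) (Q.proj p) p rfl).compAlternatingMap
      (η.1 (Q.proj p))).map_coord_zero i hi
  equivariant g p Y := by
    rw [Q.pullback_apply, Q.pullback_apply,
      ← (η.1 (Q.proj p) fun i => Q.dproj p (Y i)).2 g ⟨p, rfl⟩]
    exact Q.bundleForm_congr η (Q.proj_act p g) (funext fun i => Q.dproj_dR g p (Y i)) _ _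

end BundleForm

namespace IsTensorial

variable [IsManifold (𝓡 k) ∞ P] {Q} {τ : VForm n k G P 𝕜 r} (hτ : Q.IsTensorial τ)

include hτ in
theorem apply_dprojSection_act (g : G) (p : P) (v : Fin r → EuclideanSpace ℝ (Fin m)) :
    τ.1 (Q.act p g) (fun i => Q.dprojSection (Q.act p g) (v i)) =
      AdK n 𝕜 g⁻¹ (τ.1 p fun i => Q.dprojSection p (v i)) :=
  (hτ.apply_eq fun i => (Q.dproj_dprojSection (Q.act p g) (v i)).trans
    ((Q.dproj_dprojSection p (v i)).symm.trans (Q.dproj_dR g p _).symm)).trans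
    (hτ.equivariant g p fun i => Q.dprojSection p (v i))

/-- The value at `x` of the form on `M` to which a tensorial form descends. -/
def descend (x : M) : TangentSpace (𝓡 m) x [⋀^Fin r]→ₗ[ℝ] Q.AdFibre 𝕜 x :=
  AlternatingMap.codRestrict
    (AlternatingMap.pi fun p : {p : P // Q.proj p = x} =>
      (τ.1 p.1).compLinearMap (Q.dprojSection p.1))
    ((Q.AdFibre 𝕜 x).restrictScalars ℝ)
    fun v g p => hτ.apply_dprojSection_act g p.1 v

theorem descend_apply (p : P) (Y : Fin r → TangentSpace (𝓡 k) p) :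
    (hτ.descend (Q.proj p) fun i => Q.dproj p (Y i)).1 ⟨p, rfl⟩ = τ.1 p Y :=
  hτ.apply_eq fun i => Q.dproj_dprojSection p (Q.dproj p (Y i))

variable [IsManifold (𝓡 m) ∞ M] [T2Space M]

theorem smoothInto_descend (V : Fin r → VF m M) :
    SmoothInto k (fun p : P => (hτ.descend (Q.proj p) fun i => V i (Q.proj p)).1 ⟨p, rfl⟩) := by
  refine smoothInto_iff_forall.2 fun p => ?_
  choose X hX using fun i => Q.exists_invField_lift (V i) (Q.proj p)
  refine (smoothInto_iff_forall.1 (τ.2 fun i => (X i).1) p).congr ?_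
  filter_upwards [Q.smooth_proj.continuous.continuousAt.eventually (eventually_all.2 hX)] with q hq
  exact hτ.apply_eq fun i => (Q.dproj_dprojSection q _).trans (hq i q rfl).symm

include hτ in
theorem exists_pullback : ∃ η, Q.pullback r η = τ :=
  ⟨⟨hτ.descend, hτ.smoothInto_descend⟩,
    (Q.pullback_eq_iff _ _).2 fun p Y => (hτ.descend_apply p Y).symm⟩

end IsTensorial

theorem isTensorial_iff [IsManifold (𝓡 k) ∞ P] [IsManifold (𝓡 m) ∞ M] [T2Space M]
    (τ : VForm n k G P 𝕜 r) : Q.IsTensorial τ ↔ ∃ η, Q.pullback r η = τ :=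
  ⟨fun h => h.exists_pullback, by rintro ⟨η, rfl⟩; exact Q.isTensorial_pullback η⟩

end PrincipalBundle

end Tensorial

/-! ### The inner integration -/

section Inner

variable {n k m : ℕ} {G P M : Type*}
  [TopologicalSpace G] [ChartedSpace (EuclideanSpace ℝ (Fin n)) G] [Group G]
  [TopologicalSpace P] [ChartedSpace (EuclideanSpace ℝ (Fin k)) P]
  [TopologicalSpace M] [ChartedSpace (EuclideanSpace ℝ (Fin m)) M]
  {𝕜 : Type*} [RCLike 𝕜] {r : ℕ}

namespace PrincipalBundle

theorem adFibre_ext {Q : PrincipalBundle n k m G P M} {x : M} {u u' : Q.AdFibre 𝕜 x}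
    (p : {p : P // Q.proj p = x}) (h : u.1 p = u'.1 p) : u = u' := by
  refine Subtype.ext (funext fun p' => ?_)
  obtain ⟨g, hg⟩ := Q.exists_act_eq_of_proj_eq (p.2.trans p'.2.symm)
  obtain rfl : ⟨Q.act p.1 g, (Q.proj_act p.1 g).trans p.2⟩ = p' := Subtype.ext hg
  rw [u.2, u'.2, h]

variable [IsManifold (𝓡 k) ∞ P] [LieGroup (𝓡 n) ∞ G]

theorem killingVolume_mixed {Q : PrincipalBundle n k m G P M} (conn : Q.Connection)
    (b : Module.Basis (Fin n) ℝ (LieAlg n G)) (s : M → P) (x : M) :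
    ((-1 : ℝ) ^ n • (killingVolume b).compLinearMap (conn.mixed s x)) (fun j => (0, b j)) =
      killingVolume b b := by
  have hmixed (j : Fin n) : conn.mixed s x (0, b j) = (-1 : ℝ) • b j := by
    simp [Connection.mixed]
  rw [AlternatingMap.smul_apply, AlternatingMap.compLinearMap_apply]
  simp only [hmixed]
  refine (congrArg ((-1 : ℝ) ^ n • ·)
    ((killingVolume b).toMultilinearMap.map_smul_univ (fun _ => (-1 : ℝ)) b)).trans ?_
  rw [Finset.prod_const, Finset.card_univ, Fintype.card_fin, smul_smul, ← mul_pow, neg_one_mul,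
    neg_neg, one_pow, one_smul, AlternatingMap.coe_multilinearMap]

variable [IsManifold (𝓡 m) ∞ M] [T2Space M] {Q : PrincipalBundle n k m G P M}

/-- The local expression of a form of the Atiyah Lie algebroid in the trivialization given by the
local section `s`, as the pull-back along `T_x s ⊕ id` of the corresponding basic form. -/
def LieForm.localExpr {q : ℕ} (w : Q.LieForm 𝕜 q) (s : M → P) (x : M) :
    (TangentSpace (𝓡 m) x × LieAlg n G) [⋀^Fin q]→ₗ[ℝ] LieAlgK n G 𝕜 :=
  (LieForm.basicForm w (s x)).compLinearMap
    ((mfderiv (𝓡 m) (𝓡 k) s x).toLinearMap.prodMap LinearMap.id)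

theorem isLocalExpr_iff {q : ℕ} (w : Q.LieForm 𝕜 q) (U : Set M) (s : M → P)
    (wloc : ∀ x : M, (TangentSpace (𝓡 m) x × LieAlg n G) [⋀^Fin q]→ₗ[ℝ] LieAlgK n G 𝕜) :
    Q.IsLocalExpr w U s wloc ↔ ∀ x ∈ U, wloc x = LieForm.localExpr w s x := by
  constructor
  · intro h x hx
    ext v
    have hX (i : Fin q) := Q.extendField_apply (s x)
      (mfderiv (𝓡 m) (𝓡 k) s x (v i).1 - Q.fund (v i).2 (s x))
    exact (h _ x hx (fun i => (v i).1) (fun i => (v i).2) hX).trans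
      (LieForm.basicForm_apply w (s x) _ hX).symm
  · intro h X x hx v c hX
    rw [h x hx]
    exact LieForm.basicForm_apply w (s x) X hX

variable (conn : Q.Connection) (b : Module.Basis (Fin n) ℝ (LieAlg n G))

theorem isInnerIntegral_iff (w : Q.LieForm 𝕜 (r + n)) (η : Q.BundleForm 𝕜 r) :
    Q.IsInnerIntegral b conn w η ↔ ∀ (U : Set M) (s : M → P) (τ : P → G)
      (hs : IsLocalTriv (n := n) (k := k) (m := m) Q.proj Q.act U s τ) (x : M) (hx : x ∈ U)
      (v : Fin r → TangentSpace (𝓡 m) x),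
      innerPart b (LieForm.basicForm w (s x)) (fun i => mfderiv (𝓡 m) (𝓡 k) s x (v i)) =
        killingVolume b b • (η.1 x v).1 ⟨s x, hs.proj_section x hx⟩ := by
  have hlocal (s : M → P) (x : M) (v : Fin r → TangentSpace (𝓡 m) x) :
      innerPart b (LieForm.localExpr w s x) v =
        innerPart b (LieForm.basicForm w (s x)) fun i => mfderiv (𝓡 m) (𝓡 k) s x (v i) :=
    innerPart_compLinearMap_prodMap b _ _ v
  unfold IsInnerIntegral
  refine forall_congr' fun U => forall_congr' fun s => forall_congr' fun τ =>
    forall_congr' fun hs => ?_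
  simp only [isLocalExpr_iff, innerDegreeLT_sub_wedge_iff b, killingVolume_mixed, ← hlocal]
  constructor
  · rintro ⟨wloc, hwloc, h⟩ x hx v
    rw [← hwloc x hx]
    exact h x hx v
  · exact fun h => ⟨LieForm.localExpr w s, fun x _ => rfl, h⟩

theorem IsInnerIntegral.unique {conn : Q.Connection} {b : Module.Basis (Fin n) ℝ (LieAlg n G)}
    (hsemisimple : LieAlgebra.IsSemisimple ℝ (LieAlg n G)) {w : Q.LieForm 𝕜 (r + n)}
    {η ζ : Q.BundleForm 𝕜 r} (hη : Q.IsInnerIntegral b conn w η)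
    (hζ : Q.IsInnerIntegral b conn w ζ) : η = ζ := by
  rw [isInnerIntegral_iff] at hη hζ
  refine Subtype.ext (funext fun x => AlternatingMap.ext fun v => ?_)
  obtain ⟨U, s, τ, hx, ht⟩ := Q.locally_trivial x
  exact adFibre_ext ⟨s x, ht.proj_section x hx⟩
    (smul_right_injective _ (killingVolume_self_ne_zero b hsemisimple)
      ((hη U s τ ht x hx v).symm.trans (hζ U s τ ht x hx v)))

theorem isInnerIntegral_of_pullback_eq (hsemisimple : LieAlgebra.IsSemisimple ℝ (LieAlg n G))
    {w : Q.LieForm 𝕜 (r + n)} {η : Q.BundleForm 𝕜 r}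
    (h : Q.pullback r η = algIntegral b r (inclusion (r + n) w)) :
    Q.IsInnerIntegral b conn w η := by
  rw [isInnerIntegral_iff]
  intro U s τ ht x hx v
  let Y (i : Fin r) : TangentSpace (𝓡 k) (s x) := mfderiv (𝓡 m) (𝓡 k) s x (v i)
  have hη : (η.1 x v).1 ⟨s x, ht.proj_section x hx⟩ = (Q.pullback r η).1 (s x) Y :=
    (Q.bundleForm_congr η (ht.proj_section x hx)
      (funext fun i => ht.dproj_mfderiv_section hx (v i)) (s x) rfl).symm
  rw [hη, h, algIntegral_apply]
  exact (smul_inv_smul₀ (killingVolume_self_ne_zero b hsemisimple) _).symm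

section Tensorial

variable [PreconnectedSpace G]
  (hunimodular : ∀ ξ : LieAlg n G, LinearMap.trace ℝ _ (LieAlgebra.ad ℝ (LieAlg n G) ξ) = 0)

include hunimodular in
theorem innerPart_basicForm_dR (w : Q.LieForm 𝕜 (r + n)) (g : G) (p : P)
    (Y : Fin r → TangentSpace (𝓡 k) p) :
    innerPart b (LieForm.basicForm w (Q.act p g)) (fun i => Q.dR g p (Y i)) =
      AdK n 𝕜 g⁻¹ (innerPart b (LieForm.basicForm w p) Y) := by
  let v : Fin (r + n) → TangentSpace (𝓡 k) p × LieAlg n G :=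
    Fin.append (fun i => (Y i, 0)) fun j => (0, Ad n g (b j))
  have hv : (fun i => (Q.dR g p (v i).1, Ad n g⁻¹ (v i).2)) =
      Fin.append (fun i => (Q.dR g p (Y i), 0)) fun j => (0, b j) := by
    funext i
    refine Fin.addCases (fun i => ?_) (fun j => ?_) i
    · simp only [v, Fin.append_left, map_zero]
    · simp only [v, Fin.append_right, map_zero, Ad_inv_apply_Ad]
  have hdet : LieForm.basicForm w p v = innerPart b (LieForm.basicForm w p) Y := by
    rw [apply_append_inr b, det_Ad_basis b hunimodular g, one_smul]
  rw [innerPart_apply, ← hv, LieForm.basicForm_dR, hdet]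

include hunimodular in
theorem isTensorial_algIntegral (w : Q.LieForm 𝕜 (r + n)) :
    Q.IsTensorial (algIntegral b r (inclusion (r + n) w)) where
  horizontal p Y i hi := by
    obtain ⟨ξ, hξ⟩ := Q.exists_fund_of_dproj_eq_zero hi
    let y (j : Fin r) : TangentSpace (𝓡 k) p × LieAlg n G := (Y j, if j = i then ξ else 0)
    have hzero : innerPart b ((inclusion (r + n) w).1 p) Y = 0 :=
      (apply_append_basis b _ y).symm.trans ((isBasic_inclusion w).horizontal ξ p _
        (Fin.castAdd n i) (by rw [Fin.append_left, hξ]; simp only [y, if_pos]))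
    rw [algIntegral_apply, hzero]
    exact smul_zero _
  equivariant g p Y := by
    rw [algIntegral_apply, algIntegral_apply, LinearMap.map_smul_of_tower]
    exact congrArg _ (innerPart_basicForm_dR b hunimodular w g p Y)

/-- The inner integration `∫_inner : Ω_Lie(P, 𝔤) → Ω(M, 𝓛)`, defined as the form on `M` to which
the algebraic integral of the corresponding basic form descends; see `innerIntegral_eq_iff` for
its characterization by local trivializations and connections. -/
def innerIntegral (r : ℕ) : Q.LieForm 𝕜 (r + n) →ₗ[𝕜] Q.BundleForm 𝕜 r :=
  (LinearEquiv.ofInjective (Q.pullback r) (Q.pullback_injective r)).symm.toLinearMap ∘ₗ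
    (algIntegral b r ∘ₗ inclusion (r + n)).codRestrict (LinearMap.range (Q.pullback r))
      fun w => (isTensorial_algIntegral b hunimodular w).exists_pullback

theorem pullback_innerIntegral (r : ℕ) (w : Q.LieForm 𝕜 (r + n)) :
    Q.pullback r (innerIntegral b hunimodular r w) = algIntegral b r (inclusion (r + n) w) :=
  congrArg Subtype.val ((LinearEquiv.ofInjective (Q.pullback r)
    (Q.pullback_injective r)).apply_symm_apply _)

theorem innerIntegral_eq_iff (hsemisimple : LieAlgebra.IsSemisimple ℝ (LieAlg n G))
    (w : Q.LieForm 𝕜 (r + n)) (η : Q.BundleForm 𝕜 r) :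
    innerIntegral b hunimodular r w = η ↔ Q.IsInnerIntegral b conn w η := by
  have h := isInnerIntegral_of_pullback_eq conn b hsemisimple
    (pullback_innerIntegral b hunimodular r w)
  exact ⟨by rintro rfl; exact h, fun h' => h.unique hsemisimple h'⟩

end Tensorial

end PrincipalBundle

end Inner

end AtiyahLie

end

theorem mainTheorem9_general {𝕜 : Type*} [RCLike 𝕜] {n k m : ℕ} {G P M : Type*}
    [TopologicalSpace G] [ChartedSpace (EuclideanSpace ℝ (Fin n)) G] [Group G]
    [LieGroup (𝓡 n) ∞ G] [PreconnectedSpace G]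
    [TopologicalSpace P] [ChartedSpace (EuclideanSpace ℝ (Fin k)) P] [IsManifold (𝓡 k) ∞ P]
    [TopologicalSpace M] [ChartedSpace (EuclideanSpace ℝ (Fin m)) M] [IsManifold (𝓡 m) ∞ M]
    [T2Space M]
    (Q : AtiyahLie.PrincipalBundle n k m G P M)
    (hsemisimple : LieAlgebra.IsSemisimple ℝ (AtiyahLie.LieAlg n G))
    (b : Module.Basis (Fin n) ℝ (AtiyahLie.LieAlg n G)) (conn : Q.Connection) :
    ∃ (incl : ∀ q : ℕ, Q.LieForm 𝕜 q →ₗ[𝕜] AtiyahLie.TLAForm n k G P 𝕜 q)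
      (inner : ∀ r : ℕ, Q.LieForm 𝕜 (r + n) →ₗ[𝕜] Q.BundleForm 𝕜 r)
      (alg : ∀ r : ℕ, AtiyahLie.TLAForm n k G P 𝕜 (r + n) →ₗ[𝕜] AtiyahLie.VForm n k G P 𝕜 r)
      (tens : ∀ r : ℕ, Q.BundleForm 𝕜 r →ₗ[𝕜] AtiyahLie.VForm n k G P 𝕜 r),
      (∀ q w w', incl q w = w' ↔ Q.IsBasic w' ∧ Q.Corresponds w' w) ∧
      (∀ q, Function.Injective (incl q)) ∧
      (∀ q w', Q.IsBasic w' → ∃ w, incl q w = w') ∧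
      (∀ r w η, inner r w = η ↔ Q.IsInnerIntegral b conn w η) ∧
      (∀ r w η, alg r w = η ↔ AtiyahLie.IsAlgIntegral b w η) ∧
      (∀ r η τ, tens r η = τ ↔ Q.IsPullback η τ) ∧
      (∀ r, Function.Injective (tens r)) ∧
      (∀ r τ, Q.IsTensorial τ ↔ ∃ η, tens r η = τ) ∧
      (∀ r w, alg r (incl (r + n) w) = tens r (inner r w)) :=
  have hunimodular := fun ξ : AtiyahLie.LieAlg n G =>
    AtiyahLie.trace_ad_of_isSemisimple ξ
  ⟨fun q => AtiyahLie.PrincipalBundle.inclusion q,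
    fun r => AtiyahLie.PrincipalBundle.innerIntegral b hunimodular r,
    fun r => AtiyahLie.algIntegral b r,
    fun r => Q.pullback r,
    fun _ w w' => AtiyahLie.PrincipalBundle.inclusion_eq_iff w w',
    fun q => AtiyahLie.PrincipalBundle.inclusion_injective q,
    fun _ _ hw => AtiyahLie.PrincipalBundle.exists_inclusion_eq hw,
    fun _ w η =>
      AtiyahLie.PrincipalBundle.innerIntegral_eq_iff conn b hunimodular hsemisimple w η,
    fun _ w η => AtiyahLie.algIntegral_eq_iff b hsemisimple w η,
    fun _ η τ => Q.pullback_eq_iff η τ,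
    fun r => Q.pullback_injective r,
    fun _ τ => Q.isTensorial_iff τ,
    fun r w => (AtiyahLie.PrincipalBundle.pullback_innerIntegral b hunimodular r w).symm⟩

/-- The four maps of the square exist and are pinned down by their defining properties, the
horizontal ones are injective with the basic forms and the tensorial forms as their images, and the
square commutes. In degrees below `n` both integrations take their values in the zero space. -/
theorem mainTheorem9 {𝕜 : Type*} [RCLike 𝕜] {n k m : ℕ} {G P M : Type*}
    [TopologicalSpace G] [ChartedSpace (EuclideanSpace ℝ (Fin n)) G] [Group G]
    [LieGroup (𝓡 n) ∞ G] [T2Space G] [SecondCountableTopology G] [SimplyConnectedSpace G]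
    [TopologicalSpace P] [ChartedSpace (EuclideanSpace ℝ (Fin k)) P] [IsManifold (𝓡 k) ∞ P]
    [T2Space P] [SecondCountableTopology P]
    [TopologicalSpace M] [ChartedSpace (EuclideanSpace ℝ (Fin m)) M] [IsManifold (𝓡 m) ∞ M]
    [T2Space M] [SecondCountableTopology M]
    (Q : AtiyahLie.PrincipalBundle n k m G P M)
    (_semisimple : LieAlgebra.IsSemisimple ℝ (AtiyahLie.LieAlg n G))
    (_unimodular : ∀ ξ : AtiyahLie.LieAlg n G,
      LinearMap.trace ℝ _ (LieAlgebra.ad ℝ (AtiyahLie.LieAlg n G) ξ) = 0)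
    (b : Module.Basis (Fin n) ℝ (AtiyahLie.LieAlg n G)) (conn : Q.Connection) :
    ∃ (incl : ∀ q : ℕ, Q.LieForm 𝕜 q →ₗ[𝕜] AtiyahLie.TLAForm n k G P 𝕜 q)
      (inner : ∀ r : ℕ, Q.LieForm 𝕜 (r + n) →ₗ[𝕜] Q.BundleForm 𝕜 r)
      (alg : ∀ r : ℕ, AtiyahLie.TLAForm n k G P 𝕜 (r + n) →ₗ[𝕜] AtiyahLie.VForm n k G P 𝕜 r)
      (tens : ∀ r : ℕ, Q.BundleForm 𝕜 r →ₗ[𝕜] AtiyahLie.VForm n k G P 𝕜 r),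
      (∀ q w w', incl q w = w' ↔ Q.IsBasic w' ∧ Q.Corresponds w' w) ∧
      (∀ q, Function.Injective (incl q)) ∧
      (∀ q w', Q.IsBasic w' → ∃ w, incl q w = w') ∧
      (∀ r w η, inner r w = η ↔ Q.IsInnerIntegral b conn w η) ∧
      (∀ r w η, alg r w = η ↔ AtiyahLie.IsAlgIntegral b w η) ∧
      (∀ r η τ, tens r η = τ ↔ Q.IsPullback η τ) ∧
      (∀ r, Function.Injective (tens r)) ∧
      (∀ r τ, Q.IsTensorial τ ↔ ∃ η, tens r η = τ) ∧
      (∀ r w, alg r (incl (r + n) w) = tens r (inner r w)) :=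
  mainTheorem9_general Q _semisimple b conn
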